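/- All graphs are finite, simple and connected; $m$ denotes the number of edges, $N(v)$ the set of neighbours of $v$, $N[v]=N(v)\cup\{v\}$, $e(v)=\max_{w}\mathrm{dist}(v,w)$ the eccentricity of the vertex $v$, and the diameter is $\max_v e(v)$. A graph is AT-free if it has no three vertices such that between any two of them there is a path avoiding the closed neighbourhood of the third. $\mathrm{LexBFS}(u)$ (lexicographic breadth-first search from $u$) gives the numbers $n, n-1,\dots,1$ to the vertices in the order in which they are visited, starting with $u$; the next visited vertex is always an unvisited one whose label, the decreasing list of the numbers of its visited neighbours, is lexicographically largest. Theorem. (i) There is an algorithm (for a word RAM with unit-cost operations on words of $\log_2 (n+m)+O(1)$ bits, the graph being given by adjacency lists) that computes the eccentricities of all vertices, and the diameter, of every connected AT-free graph with $m$ edges in $O(m^{3/2})$ time. (For $m=0$, i.e. the one-vertex graph, the time is $O(1)$; the bound is stated as $O((m+1)^{3/2})$.) (ii) Let $G=(V,E)$ be a connected AT-free graph with $m$ edges, let $u$ be the last vertex visited by some LexBFS of $G$, let $\sigma$ be the numbering output by a $\mathrm{LexBFS}(u)$, let $v$ be its last visited vertex, and let $\tau$ be the numbering output by a $\mathrm{LexBFS}(v)$.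 Let $d=e(v)$ and let $L_i$ be the set of vertices at distance $i$ from $v$. Let $A$ be the set obtained from $L_0\cup L_1$ by scanning its vertices by increasing number in $\sigma$, removing the non-neighbours of each scanned vertex that has not itself been removed; let $B$ and $C$ be obtained in the same way from $L_{d-1}$ and $L_d$, respectively, with the numbers of $\tau$ (if $d=0$, then $B=\emptyset$). Then $A,B,C$ are cliques, each with at most $c\sqrt{m+1}$ vertices for an absolute constant $c$. Every vertex $w$ with $e(w)\ge 3$ satisfies $e(w)=\mathrm{dist}(w,x)$ for some $x\in A\cup B\cup C$. Moreover, if $|V|\ge 2$, then $e(w)=1$ for every vertex $w$ adjacent to all other vertices, and for every other vertex $w$ $$e(w)=\max\bigl(\{2\}\cup\{\mathrm{dist}(w,x) : x\in A\cup B\cup C\}\bigr).$$ -/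

import Mathlib

/-!
Part 1: a word RAM with unit-cost instructions.
-/

namespace WordRAM

/-- A memory state: numbered registers, and numbered arrays that are addressed indirectly.
A program mentions only finitely many registers and arrays, all of them by fixed numbers. -/
structure State where
  reg : ℕ → ℕ
  arr : ℕ → ℕ → ℕ

/-- Expressions: constants, registers, array reads with a computed index, addition, truncated
subtraction and the two comparisons (with value `1` for true and `0` for false). -/
inductive Expr where
  | const (k : ℕ)
  | reg (r : ℕ)
  | get (a : ℕ) (i : Expr)
  | add (x y : Expr)
  | sub (x y : Expr)
  | lt (x y : Expr)
  | eq (x y : Expr)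

/-- The value of an expression on a machine with words of `w` bits: constants and sums
are reduced modulo `2 ^ w`. -/
def Expr.eval (w : ℕ) (s : State) : Expr → ℕ
  | .const k => k % 2 ^ w
  | .reg r => s.reg r
  | .get a i => s.arr a (i.eval w s)
  | .add x y => (x.eval w s + y.eval w s) % 2 ^ w
  | .sub x y => x.eval w s - y.eval w s
  | .lt x y => if x.eval w s < y.eval w s then 1 else 0
  | .eq x y => if x.eval w s = y.eval w s then 1 else 0

/-- The number of elementary operations in the evaluation of an expression. -/
def Expr.cost : Expr → ℕ
  | .const _ => 1
  | .reg _ => 1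
  | .get _ i => i.cost + 1
  | .add x y => x.cost + y.cost + 1
  | .sub x y => x.cost + y.cost + 1
  | .lt x y => x.cost + y.cost + 1
  | .eq x y => x.cost + y.cost + 1

/-- Programs: register assignment, array write `arr a [i] := x`, sequencing, branching and
loops. The condition of a branch or a loop holds when its value is not `0`. -/
inductive Prog where
  | skip
  | set (r : ℕ) (x : Expr)
  | put (a : ℕ) (i x : Expr)
  | seq (p q : Prog)
  | ite (b : Expr) (p q : Prog)
  | loop (b : Expr) (p : Prog)

/-- Register assignment. -/
def State.setReg (s : State) (r x : ℕ) : State where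
  reg := Function.update s.reg r x
  arr := s.arr

/-- Array write. -/
def State.setArr (s : State) (a i x : ℕ) : State where
  reg := s.reg
  arr := Function.update s.arr a (Function.update (s.arr a) i x)

/-- `Exec w p s t s'`: on a machine with words of `w` bits, the program `p` started in the
state `s` halts after exactly `t` elementary steps, in the state `s'`. -/
inductive Exec (w : ℕ) : Prog → State → ℕ → State → Prop where
  | skip (s : State) : Exec w .skip s 1 s
  | set (r : ℕ) (x : Expr) (s : State) :
      Exec w (.set r x) s (x.cost + 1) (s.setReg r (x.eval w s))
  | put (a : ℕ) (i x : Expr) (s : State) :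
      Exec w (.put a i x) s (i.cost + x.cost + 1) (s.setArr a (i.eval w s) (x.eval w s))
  | seq {p q : Prog} {s s₁ s₂ : State} {t₁ t₂ : ℕ} :
      Exec w p s t₁ s₁ → Exec w q s₁ t₂ s₂ → Exec w (.seq p q) s (t₁ + t₂) s₂
  | iteTrue {b : Expr} {p q : Prog} {s s₁ : State} {t : ℕ} :
      b.eval w s ≠ 0 → Exec w p s t s₁ → Exec w (.ite b p q) s (b.cost + 1 + t) s₁
  | iteFalse {b : Expr} {p q : Prog} {s s₁ : State} {t : ℕ} :
      b.eval w s = 0 → Exec w q s t s₁ → Exec w (.ite b p q) s (b.cost + 1 + t) s₁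
  | loopTrue {b : Expr} {p : Prog} {s s₁ s₂ : State} {t₁ t₂ : ℕ} :
      b.eval w s ≠ 0 → Exec w p s t₁ s₁ → Exec w (.loop b p) s₁ t₂ s₂ →
        Exec w (.loop b p) s (b.cost + 1 + t₁ + t₂) s₂
  | loopFalse {b : Expr} {p : Prog} {s : State} :
      b.eval w s = 0 → Exec w (.loop b p) s (b.cost + 1) s

/-- The machine is deterministic, so that running time and final state are well defined. -/
theorem Exec.deterministic {w : ℕ} {p : Prog} {s s₁ s₂ : State} {t₁ t₂ : ℕ}
    (h₁ : Exec w p s t₁ s₁) (h₂ : Exec w p s t₂ s₂) : t₁ = t₂ ∧ s₁ = s₂ := by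
  induction h₁ generalizing t₂ s₂ with
  | skip s => cases h₂; exact ⟨rfl, rfl⟩
  | set r x s => cases h₂; exact ⟨rfl, rfl⟩
  | put a i x s => cases h₂; exact ⟨rfl, rfl⟩
  | seq _ _ ih₁ ih₂ =>
    cases h₂ with
    | seq k₁ k₂ =>
      obtain ⟨rfl, rfl⟩ := ih₁ k₁
      obtain ⟨rfl, rfl⟩ := ih₂ k₂
      exact ⟨rfl, rfl⟩
  | iteTrue hb _ ih =>
    cases h₂ with
    | iteTrue _ k => obtain ⟨rfl, rfl⟩ := ih k; exact ⟨rfl, rfl⟩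
    | iteFalse hb' _ => exact absurd hb' hb
  | iteFalse hb _ ih =>
    cases h₂ with
    | iteTrue hb' _ => exact absurd hb hb'
    | iteFalse _ k => obtain ⟨rfl, rfl⟩ := ih k; exact ⟨rfl, rfl⟩
  | loopTrue hb _ _ ih₁ ih₂ =>
    cases h₂ with
    | loopTrue _ k₁ k₂ =>
      obtain ⟨rfl, rfl⟩ := ih₁ k₁
      obtain ⟨rfl, rfl⟩ := ih₂ k₂
      exact ⟨rfl, rfl⟩
    | loopFalse hb' => exact absurd hb' hb
  | loopFalse hb =>
    cases h₂ with
    | loopTrue hb' _ _ => exact absurd hb hb'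
    | loopFalse _ => exact ⟨rfl, rfl⟩

/-- `adj` is an adjacency-list representation of `G`: `adj u` lists the neighbours of `u`
without repetition, in any order. -/
def Represents {n : ℕ} (adj : Fin n → List (Fin n)) (G : SimpleGraph (Fin n)) : Prop :=
  ∀ u, (adj u).Nodup ∧ ∀ v, v ∈ adj u ↔ G.Adj u v

/-- The initial state for an input given by adjacency lists. Register `0` holds the number `n`
of vertices. Array `1` is the concatenation of the lists of the vertices `0, …, n - 1`; array `0`
gives, for each `i ≤ n`, the total length of the lists of the vertices below `i`, so that the
list of `i` occupies the cells of array `1` from `arr 0 i` up to, but excluding, `arr 0 (i + 1)`.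
All the rest is `0`. -/
def input {n : ℕ} (adj : Fin n → List (Fin n)) : State where
  reg r := if r = 0 then n else 0
  arr a i :=
    if a = 0 then (if i ≤ n then (((List.finRange n).take i).flatMap adj).length else 0)
    else if a = 1 then (((List.finRange n).flatMap adj).map Fin.val).getD i 0
    else 0

end WordRAM

/-!
Part 2: AT-free graphs, lexicographic breadth-first search, and the cliques of the sweeps.
-/

namespace ATGraph

/-- There is a path between `x` and `y` that avoids the closed neighbourhood of `z`. -/
def AvoidingPath {V : Type*} (G : SimpleGraph V) (x y z : V) : Prop :=
  ∃ p : G.Walk x y, p.IsPath ∧ ∀ a ∈ p.support, a ≠ z ∧ ¬ G.Adj z a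

/-- No three vertices form an asteroidal triple. -/
def ATFree {V : Type*} (G : SimpleGraph V) : Prop :=
  ¬ ∃ x y z : V, AvoidingPath G x y z ∧ AvoidingPath G y z x ∧ AvoidingPath G x z y

open Classical in
/-- The label of `w` at the moment when the number `i` is about to be given (the numbers being
given in decreasing order): the numbers of its already numbered neighbours, in the decreasing
order in which they have been appended. -/
noncomputable def label {V : Type*} [Fintype V] (G : SimpleGraph V)
    (σ : Fin (Fintype.card V) ≃ V) (i : Fin (Fintype.card V)) (w : V) :
    List (Fin (Fintype.card V)) :=
  (List.finRange (Fintype.card V)).reverse.filter (fun j => i < j ∧ G.Adj (σ j) w)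

/-- `σ` is a possible output of `LexBFS(u)`. Numbers start from `0`; the vertices are visited
from the largest number down to `0`, the first one is `u`, and each visited vertex has a
lexicographically largest label among the vertices not visited before. -/
def IsLexBFS {V : Type*} [Fintype V] (G : SimpleGraph V) (u : V)
    (σ : Fin (Fintype.card V) ≃ V) : Prop :=
  (σ.symm u).val + 1 = Fintype.card V ∧
    ∀ i w, σ.symm w ≤ i → label G σ i w ≤ label G σ i (σ i)

/-- `v` is the last vertex visited in the search with output `σ`. -/
def IsLast {V : Type*} [Fintype V] (σ : Fin (Fintype.card V) ≃ V) (v : V) : Prop :=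
  (σ.symm v).val = 0

open Classical in
/-- Scan a list of vertices from left to right. Each scanned vertex that has not been removed is
kept, and its non-neighbours are removed from the rest; so a vertex is kept exactly when it is
adjacent to all vertices kept before it (the argument `K`). -/
noncomputable def scan {V : Type*} (G : SimpleGraph V) (K : List V) : List V → List V
  | [] => K
  | x :: l => if ∀ y ∈ K, G.Adj y x then scan G (x :: K) l else scan G K l

open Classical in
/-- The result of scanning the vertex set `S` by increasing number. -/
noncomputable def scanClique {V : Type*} [Fintype V] (G : SimpleGraph V)
    (σ : Fin (Fintype.card V) ≃ V) (S : Set V) : Finset V :=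
  (scan G [] (((List.finRange (Fintype.card V)).map σ).filter (fun w => w ∈ S))).toFinset

/-- The clique obtained from `v` and its neighbours, that is, from the layers `0` and `1`
around `v`, scanned along the ordering `σ` of the second sweep. -/
noncomputable def cliqueA {V : Type*} [Fintype V] (G : SimpleGraph V)
    (σ : Fin (Fintype.card V) ≃ V) (v : V) : Finset V :=
  scanClique G σ {w | G.edist v w ≤ 1}

/-- The clique obtained from the last layer but one around `v`, scanned along the ordering `τ`
of the third sweep. -/
noncomputable def cliqueB {V : Type*} [Fintype V] (G : SimpleGraph V)
    (τ : Fin (Fintype.card V) ≃ V) (v : V) : Finset V :=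
  scanClique G τ {w | G.edist v w + 1 = G.eccent v}

/-- The clique obtained from the last layer around `v`, scanned along the ordering `τ` of the
third sweep. -/
noncomputable def cliqueC {V : Type*} [Fintype V] (G : SimpleGraph V)
    (τ : Fin (Fintype.card V) ≃ V) (v : V) : Finset V :=
  scanClique G τ {w | G.edist v w = G.eccent v}

/-- The outcome of three consecutive sweeps: an arbitrary LexBFS, then `σ = LexBFS(u)` from its
last vertex `u`, then `τ = LexBFS(v)` from the last vertex `v` of `σ`. -/
def ThreeSweep {V : Type*} [Fintype V] (G : SimpleGraph V)
    (σ τ : Fin (Fintype.card V) ≃ V) (v : V) : Prop :=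
  ∃ (r u : V) (ρ : Fin (Fintype.card V) ≃ V),
    IsLexBFS G r ρ ∧ IsLast ρ u ∧ IsLexBFS G u σ ∧ IsLast σ v ∧ IsLexBFS G v τ

end ATGraph

/-! The three cliques. The last vertex `v` of a LexBFS of an AT-free graph is admissible: no two
vertices have walks to `v` that each miss the closed neighbourhood of the other
(`IsLexBFS.admissible_last`). Two such vertices that are joined outside of `N[v]` would form an
asteroidal triple with `v`. If they lie in different components outside of `N[v]`, the lexicographic
rule (`IsLexBFS.exists_in_component`) gives each component a vertex visited no later than the first
visited vertex of the other one, which is absurd. By the same rule, in a search from an admissible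
vertex every walk from the start to a vertex visited after `y` meets `N[y]` (`IsLexBFS.separates`).

Now let `y` be farthest from `w`, at distance at least 3, and suppose that the scan of its layer
removes `y`. Then the clique contains a non-neighbour `x` of `y` that is visited after `y`. If `x`
were closer to `w` than `y`, a shortest walk from `w` to `x` would miss `y`; together with a walk
from the start to `w` that misses `y`, it would contradict separation. So `x` is as far from `w` as
`y`, once a walk from the start to `w` that misses `y` is found. This is done for the layers next to
`v` with the second sweep (`far_in_first_clique`), and for a layer of the third sweep if `y` is
visited after `w` (`far_in_layer_clique`). In the remaining cases separation bounds the distance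
from `w` to `y` by the distance to `v` or to any vertex of the last layer. Eccentricities below 3
are settled by testing whether `w` is adjacent to all other vertices. A clique with `k` vertices has
`k (k - 1) / 2` edges, whence the bound on its size.

The algorithm. LexBFS runs in linear time by partition refinement: the unvisited vertices form
intervals of equal labels, and a visit splits each interval into neighbours and non-neighbours.
Three sweeps, three scans and one search from each of the at most `6 √(m + 1)` listed vertices give
all eccentricities. As `n ≤ m + 1` in a connected graph, each search takes `O(m + 1)` steps. In the
verification, loop-free programs are evaluated symbolically, and loops have invariants with a time
budget. -/

namespace ATGraph

/-! ### LexBFS labels compared through their first difference -/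

section Labels

/-- Both filtered lists begin with the same entries above `j`. Then `q` keeps `j`, while `p`
continues with a smaller entry or ends, because the list is decreasing. -/
theorem filter_lt_filter_of_first_diff {α : Type*} [LinearOrder α] {p q : α → Bool} {j : α} :
    ∀ {l : List α}, l.Pairwise (· > ·) → j ∈ l → q j = true → p j = false →
      (∀ k ∈ l, j < k → p k = q k) → l.filter p < l.filter q
  | [], _, hj, _, _, _ => by simp at hj
  | a :: l, hl, hj, hq, hp, hk => by
    rw [List.pairwise_cons] at hl
    rcases List.mem_cons.1 hj with rfl | hj'
    · rw [List.filter_cons_of_pos (p := q) hq, List.filter_cons_of_neg (p := p) (by simp [hp])]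
      cases h : l.filter p with
      | nil => exact List.nil_lt_cons _ _
      | cons b t =>
        have hb : b ∈ l := (List.mem_filter.1 (h ▸ List.mem_cons_self : b ∈ l.filter p)).1
        exact List.cons_lt_cons_iff.2 (Or.inl (hl.1 b hb))
    · have ih := filter_lt_filter_of_first_diff hl.2 hj' hq hp
        (fun k hkl => hk k (List.mem_cons_of_mem _ hkl))
      have ha := hk a List.mem_cons_self (hl.1 j hj')
      cases hqa : q a with
      | true =>
        rw [List.filter_cons_of_pos (p := q) hqa, List.filter_cons_of_pos (p := p) (ha.trans hqa)]
        exact List.cons_lt_cons_iff.2 (Or.inr ⟨rfl, ih⟩)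
      | false =>
        rw [List.filter_cons_of_neg (p := q) (by simp [hqa]),
          List.filter_cons_of_neg (p := p) (by simp [ha, hqa])]
        exact ih

variable {V : Type*} [Fintype V] {G : SimpleGraph V} {σ : Fin (Fintype.card V) ≃ V}

theorem label_lt_of_first_diff {i j : Fin (Fintype.card V)} {a b : V} (hij : i < j)
    (hb : G.Adj (σ j) b) (ha : ¬ G.Adj (σ j) a)
    (h : ∀ k, j < k → (G.Adj (σ k) a ↔ G.Adj (σ k) b)) : label G σ i a < label G σ i b := by
  classical
  unfold label
  apply filter_lt_filter_of_first_diff (j := j)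
  · rw [List.pairwise_reverse]
    exact List.pairwise_lt_finRange _
  · simp
  · simp [hij, hb]
  · simp [ha]
  · intro k _ hk
    simp [h k hk]

/-- Lexicographic comparison of the neighbourhoods of `a` and `b` among the vertices with
numbers above `i`: they agree, or `b` wins at the largest number where they differ. -/
def NbrLE (G : SimpleGraph V) (σ : Fin (Fintype.card V) ≃ V) (i : Fin (Fintype.card V))
    (a b : V) : Prop :=
  (∀ j, i < j → (G.Adj (σ j) a ↔ G.Adj (σ j) b)) ∨
    ∃ j, i < j ∧ G.Adj (σ j) b ∧ ¬ G.Adj (σ j) a ∧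
      ∀ k, j < k → (G.Adj (σ k) a ↔ G.Adj (σ k) b)

theorem nbrLE_total (G : SimpleGraph V) (σ : Fin (Fintype.card V) ≃ V)
    (i : Fin (Fintype.card V)) (a b : V) :
    NbrLE G σ i a b ∨ ∃ j, i < j ∧ G.Adj (σ j) a ∧ ¬ G.Adj (σ j) b ∧
      ∀ k, j < k → (G.Adj (σ k) b ↔ G.Adj (σ k) a) := by
  classical
  by_cases h : ∀ j, i < j → (G.Adj (σ j) a ↔ G.Adj (σ j) b)
  · exact Or.inl (Or.inl h)
  · push Not at h
    obtain ⟨j₀, hj₀, hd⟩ := h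
    let D := Finset.univ.filter fun j => i < j ∧ ¬ (G.Adj (σ j) a ↔ G.Adj (σ j) b)
    have hD : D.Nonempty := ⟨j₀, by simp only [D, Finset.mem_filter]; exact ⟨by simp, hj₀, by tauto⟩⟩
    obtain ⟨j, hjD, hmax⟩ := D.exists_max_image id hD
    simp only [D, Finset.mem_filter, Finset.mem_univ, true_and, id] at hjD hmax
    have hk : ∀ k, j < k → (G.Adj (σ k) a ↔ G.Adj (σ k) b) := by
      intro k hk
      by_contra hne
      exact absurd (hmax k ⟨hjD.1.trans hk, hne⟩) (not_le.2 hk)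
    by_cases ha : G.Adj (σ j) a
    · exact Or.inr ⟨j, hjD.1, ha, by tauto, fun k h => (hk k h).symm⟩
    · exact Or.inl (Or.inr ⟨j, hjD.1, by tauto, ha, hk⟩)

theorem nbrLE_of_label_le {i : Fin (Fintype.card V)} {a b : V}
    (h : label G σ i a ≤ label G σ i b) : NbrLE G σ i a b := by
  rcases nbrLE_total G σ i a b with h' | ⟨j, hij, ha, hb, hk⟩
  · exact h'
  · exact absurd (label_lt_of_first_diff hij ha hb hk) (not_lt.2 h)

theorem label_le_of_nbrLE {i : Fin (Fintype.card V)} {a b : V}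
    (h : NbrLE G σ i a b) : label G σ i a ≤ label G σ i b := by
  classical
  rcases h with h | ⟨j, hij, hb, ha, hk⟩
  · apply le_of_eq
    unfold label
    apply List.filter_congr
    intro k _
    by_cases hik : i < k
    · simp [hik, h k hik]
    · simp [hik]
  · exact le_of_lt (label_lt_of_first_diff hij hb ha hk)

/-- A higher threshold forgets the lower numbers: the first difference either survives or drops out,
and then the neighbourhoods agree. -/
theorem NbrLE.mono {i i' : Fin (Fintype.card V)} {a b : V} (hi : i ≤ i')
    (h : NbrLE G σ i a b) : NbrLE G σ i' a b := by
  rcases h with h | ⟨j, hij, hb, ha, hk⟩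
  · exact Or.inl fun j hj => h j (hi.trans_lt hj)
  · rcases lt_or_ge i' j with hj | hj
    · exact Or.inr ⟨j, hj, hb, ha, hk⟩
    · exact Or.inl fun k hik => hk k (hj.trans_lt hik)

/-- Antisymmetry: two first differences would occur at the same number, with opposite winners. -/
theorem NbrLE.agree {i : Fin (Fintype.card V)} {a b : V} (h : NbrLE G σ i a b)
    (h' : NbrLE G σ i b a) : ∀ j, i < j → (G.Adj (σ j) a ↔ G.Adj (σ j) b) := by
  rcases h with h | ⟨j, hij, hb, ha, hk⟩
  · exact h
  rcases h' with h' | ⟨j', hij', ha', hb', hk'⟩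
  · exact fun k hk => (h' k hk).symm
  rcases lt_trichotomy j j' with hlt | rfl | hlt
  · exact absurd ((hk j' hlt).1 ha') hb'
  · exact absurd ha' ha
  · exact absurd ((hk' j hlt).1 hb) ha

end Labels

/-! ### Consequences of the search rule for earlier neighbours -/

section Search

variable {V : Type*} [Fintype V] {G : SimpleGraph V} {σ : Fin (Fintype.card V) ≃ V} {u : V}

theorem IsLexBFS.nbrLE (h : IsLexBFS G u σ) {a b : V} (hab : σ.symm a ≤ σ.symm b) :
    NbrLE G σ (σ.symm b) a b := by
  have := nbrLE_of_label_le (h.2 (σ.symm b) a hab)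
  simpa using this

theorem IsLexBFS.le_first (h : IsLexBFS G u σ) (a : V) : σ.symm a ≤ σ.symm u := by
  have := h.1
  have := (σ.symm a).isLt
  rw [Fin.le_def]; omega

theorem IsLexBFS.eq_first (h : IsLexBFS G u σ) {a : V} (ha : σ.symm u ≤ σ.symm a) : a = u :=
  σ.symm.injective (le_antisymm (h.le_first a) ha)

/-- If the visited neighbours of `z`, at its turn, are neighbours of the later vertex `x`, then
all vertices from `z` to `x` have the same neighbours before `z`. -/
theorem IsLexBFS.agree_between (h : IsLexBFS G u σ) {z x b : V} (hxz : σ.symm x ≤ σ.symm z)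
    (hsub : ∀ a, σ.symm z < σ.symm a → G.Adj a z → G.Adj a x)
    (hxb : σ.symm x ≤ σ.symm b) (hbz : σ.symm b ≤ σ.symm z) {a : V}
    (ha : σ.symm z < σ.symm a) : G.Adj a b ↔ G.Adj a x := by
  -- At the turn of `z` the vertex `x` does not beat `z`, and `hsub` excludes that `z` wins at a
  -- first difference.
  have hxz' : ∀ j, σ.symm z < j → (G.Adj (σ j) x ↔ G.Adj (σ j) z) := by
    rcases h.nbrLE hxz with h1 | ⟨j, hij, hz, hx, -⟩
    · exact h1
    · exact absurd (hsub (σ j) (by simpa using hij) hz) hx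
  -- Above the number of `z`, the vertex `b` is squeezed between `x` and `z` in the lexicographic
  -- order.
  have h1 : NbrLE G σ (σ.symm z) x b := (h.nbrLE hxb).mono hbz
  have h2 : NbrLE G σ (σ.symm z) b x := by
    rcases h.nbrLE hbz with h1 | ⟨j, hij, hz, hx, hk⟩
    · exact Or.inl fun j hj => (h1 j hj).trans (hxz' j hj).symm
    · exact Or.inr ⟨j, hij, (hxz' j hij).2 hz, hx,
        fun k hjk => (hk k hjk).trans (hxz' k (hij.trans hjk)).symm⟩
  simpa using h2.agree h1 (σ.symm a) ha

end Search

/-! ### Walks inside a set and walks that miss a closed neighbourhood -/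

section Joined

variable {V : Type*} {G : SimpleGraph V}

/-- There is a walk from `x` to `y` all of whose vertices satisfy `S`. -/
def Joined (G : SimpleGraph V) (S : V → Prop) (x y : V) : Prop :=
  ∃ p : G.Walk x y, ∀ a ∈ p.support, S a

/-- The vertex `a` is outside of the closed neighbourhood of `z`. -/
def Misses (G : SimpleGraph V) (z a : V) : Prop := a ≠ z ∧ ¬ G.Adj z a

theorem Misses.symm {z a : V} (h : Misses G z a) : Misses G a z :=
  ⟨h.1.symm, fun h' => h.2 h'.symm⟩

theorem avoidingPath_iff {x y z : V} : AvoidingPath G x y z ↔ Joined G (Misses G z) x y := by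
  classical
  constructor
  · rintro ⟨p, -, hp⟩
    exact ⟨p, hp⟩
  · rintro ⟨p, hp⟩
    exact ⟨p.bypass, p.bypass_isPath, fun a ha => hp a (p.support_bypass_subset_support ha)⟩

namespace Joined

variable {S T : V → Prop} {x y z : V}

theorem refl (h : S x) : Joined G S x x := ⟨.nil, by simpa using h⟩

theorem left (h : Joined G S x y) : S x := h.elim fun p hp => hp x p.start_mem_support

theorem right (h : Joined G S x y) : S y := h.elim fun p hp => hp y p.end_mem_support

theorem symm (h : Joined G S x y) : Joined G S y x := by
  obtain ⟨p, hp⟩ := h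
  exact ⟨p.reverse, by simpa using hp⟩

theorem trans (h : Joined G S x y) (h' : Joined G S y z) : Joined G S x z := by
  obtain ⟨p, hp⟩ := h
  obtain ⟨q, hq⟩ := h'
  refine ⟨p.append q, fun a ha => ?_⟩
  rcases (SimpleGraph.Walk.mem_support_append_iff p q).1 ha with h | h
  exacts [hp a h, hq a h]

theorem step (h : Joined G S x y) (hyz : G.Adj y z) (hz : S z) : Joined G S x z :=
  h.trans ⟨.cons hyz .nil, by simp [h.right, hz]⟩

/-- The property `T` may depend on being reached from `x` inside `S`; this serves to show that a
whole component misses a vertex. -/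
theorem imp (h : Joined G S x y) (hST : ∀ a, Joined G S x a → T a) : Joined G T x y := by
  classical
  obtain ⟨p, hp⟩ := h
  exact ⟨p, fun a ha => hST a ⟨p.takeUntil a ha, fun b hb =>
    hp b (p.support_takeUntil_subset_support ha hb)⟩⟩

theorem mono (h : Joined G S x y) (hST : ∀ a, S a → T a) : Joined G T x y :=
  h.imp fun _ h => hST _ h.right

theorem exists_crossing (h : Joined G S x y) {P : V → Prop} (hx : P x) (hy : ¬ P y) :
    ∃ a b, S a ∧ S b ∧ G.Adj a b ∧ P a ∧ ¬ P b := by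
  obtain ⟨p, hp⟩ := h
  obtain ⟨d, hd, h1, h2⟩ := p.exists_boundary_dart {a | P a} hx hy
  exact ⟨d.fst, d.snd, hp _ (p.dart_fst_mem_support_of_mem_darts hd),
    hp _ (p.dart_snd_mem_support_of_mem_darts hd), d.adj, h1, h2⟩

/-- The initial segment of a walk up to its first vertex outside of `P`. -/
theorem exists_first (h : Joined G S x y) {P : V → Prop} (hx : P x) (hy : ¬ P y) :
    ∃ b, ¬ P b ∧ Joined G (fun a => S a ∧ (P a ∨ a = b)) x b := by
  obtain ⟨p, hp⟩ := h
  induction p with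
  | nil => exact absurd hx hy
  | @cons a b c hab p ih =>
    have ha : S a := hp a (by simp)
    have hb : S b := hp b (by simp)
    by_cases hPb : P b
    · obtain ⟨b', hb', h'⟩ := ih hPb hy (fun a' ha' => hp a' (by simp [ha']))
      refine ⟨b', hb', Joined.trans ?_ h'⟩
      exact (Joined.refl ⟨ha, Or.inl hx⟩).step hab ⟨hb, Or.inl hPb⟩
    · exact ⟨b, hPb, (Joined.refl ⟨ha, Or.inl hx⟩).step hab ⟨hb, Or.inr rfl⟩⟩

end Joined

/-- A vertex of a shortest walk from `x` to `z`, other than `z`, is at distance less than `G.dist x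
z` from `x`. If it were `y` or a neighbour of `y`, then `y` would be no farther from `x` than `z`.
-/
theorem joined_of_dist_lt (hG : G.Connected) {x y z : V} (h : G.dist x z < G.dist x y)
    (hz : Misses G y z) : Joined G (Misses G y) x z := by
  classical
  obtain ⟨p, hp⟩ := hG.exists_walk_length_eq_dist x z
  refine ⟨p, fun a ha => ?_⟩
  by_cases haz : a = z
  · exact haz ▸ hz
  have h1 : G.dist x a + G.dist a z ≤ G.dist x z := by
    rw [← hp, ← congrArg SimpleGraph.Walk.length (p.take_spec ha), SimpleGraph.Walk.length_append]
    exact add_le_add (SimpleGraph.dist_le _) (SimpleGraph.dist_le _)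
  have h2 := hG.pos_dist_of_ne haz
  constructor
  · rintro rfl; omega
  · intro hya
    have h3 := SimpleGraph.dist_eq_one_iff_adj.2 hya.symm
    have h4 := hG.dist_triangle (u := x) (v := a) (w := y)
    omega

theorem misses_of_dist {z a : V} (h : 2 ≤ G.dist z a) : Misses G z a := by
  constructor
  · rintro rfl; simp at h
  · intro h'
    rw [SimpleGraph.dist_eq_one_iff_adj.2 h'] at h; omega

theorem coe_dist_edist (hG : G.Connected) (x y : V) : (G.dist x y : ℕ∞) = G.edist x y :=
  (hG x y).coe_dist_eq_edist

end Joined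

/-! ### Admissible vertices, separation by closed neighbourhoods, and layers -/

section Admissible

variable {V : Type*} [Fintype V] {G : SimpleGraph V} {σ : Fin (Fintype.card V) ≃ V} {u : V}

/-- The component of `y` among the vertices not after `x` and outside of `N[x]` contains a vertex
visited no later than the start of any walk to `x` that misses `y`. -/
theorem IsLexBFS.exists_in_component (h : IsLexBFS G u σ) {x y s : V}
    (hxy : σ.symm x ≤ σ.symm y) (hm : Misses G x y)
    (hs : Joined G (fun a => Misses G y a ∧ σ.symm x ≤ σ.symm a) s x) :
    ∃ z, Joined G (fun a => Misses G x a ∧ σ.symm x ≤ σ.symm a) y z ∧ σ.symm s ≤ σ.symm z := by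
  classical
  by_contra! hcon
  let S : V → Prop := fun a => Misses G x a ∧ σ.symm x ≤ σ.symm a
  let D := Finset.univ.filter fun z => Joined G S y z
  have hyD : y ∈ D := by simpa [D] using Joined.refl (G := G) (S := S) ⟨hm, hxy⟩
  -- Let `z` be the first visited vertex of the component of `y`.
  obtain ⟨z, hzD, hmax⟩ := D.exists_max_image σ.symm ⟨y, hyD⟩
  simp only [D, Finset.mem_filter, Finset.mem_univ, true_and] at hzD hmax
  have hzs : σ.symm z < σ.symm s := hcon z hzD
  have hxz : σ.symm x ≤ σ.symm z := hzD.right.2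
  -- A neighbour of `z` visited before `z` and outside of `N[x]` would belong to the component,
  -- against the choice of `z`.
  have hsub : ∀ a, σ.symm z < σ.symm a → G.Adj a z → G.Adj a x := by
    intro a ha haz
    by_contra hax
    have hne : a ≠ x := by rintro rfl; exact absurd ha (not_lt.2 hxz)
    have := hmax a (hzD.step haz.symm ⟨⟨hne, fun h' => hax h'.symm⟩, hxz.trans ha.le⟩)
    exact absurd ha (not_lt.2 this)
  -- The walk from `s` to `x` has an edge `a b` with `a` visited before `z` and `b` not. All
  -- vertices from `z` to `x` have the same neighbours before `z`, so `a` is adjacent to `x` and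
  -- hence to `y`, although the walk misses `y`.
  obtain ⟨a, b, ha, hb, hab, hza, hzb⟩ :=
    hs.exists_crossing (P := fun a => σ.symm z < σ.symm a) hzs (not_lt.2 hxz)
  have hax := (h.agree_between hxz hsub hb.2 (not_lt.1 hzb) hza).1 hab
  have hay := (h.agree_between hxz hsub hxy (hmax y (by simpa [D] using hyD)) hza).2 hax
  exact ha.1.2 hay.symm

/-- No two vertices have paths to `v` that each miss the other one. -/
def Admissible (G : SimpleGraph V) (v : V) : Prop :=
  ∀ x y, Joined G (Misses G y) x v → Joined G (Misses G x) y v → False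

/-- If `x` and `y` are joined outside of `N[v]`, they form an asteroidal triple with `v`. Otherwise
the first visited vertices of their components outside of `N[v]` are compared. -/
theorem IsLexBFS.admissible_last (hAT : ATFree G) (h : IsLexBFS G u σ) {v : V}
    (hv : IsLast σ v) : Admissible G v := by
  classical
  have hv0 : ∀ a, σ.symm v ≤ σ.symm a := fun a => by
    rw [Fin.le_def, show (σ.symm v).val = 0 from hv]; exact Nat.zero_le _
  have key : ∀ x y, Joined G (Misses G y) x v → Joined G (Misses G x) y v →
      ¬ Joined G (Misses G v) x y →
      ∀ z, Joined G (Misses G v) x z → ∃ z', Joined G (Misses G v) y z' ∧ σ.symm z ≤ σ.symm z' := by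
    intro x y hx hy hxy z hz
    -- A neighbour of `y` in the component of `x` would join `x` to `y`; so this whole component
    -- misses `y`, and `z` reaches `v` through `x` without meeting `N[y]`.
    have hzx : Joined G (Misses G y) z x := by
      refine hz.symm.imp fun a ha => ?_
      have hxa := hz.trans ha
      constructor
      · rintro rfl; exact hxy hxa
      · intro hya
        exact hxy (hxa.step hya.symm hx.right.symm)
    obtain ⟨z', h1, h2⟩ := h.exists_in_component (hv0 y) hx.right.symm
      ((hzx.trans hx).mono fun a ha => ⟨ha, hv0 a⟩)
    exact ⟨z', h1.mono fun a ha => ha.1, h2⟩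
  intro x y hx hy
  by_cases hxy : Joined G (Misses G v) x y
  · exact hAT ⟨x, y, v, avoidingPath_iff.2 hxy, avoidingPath_iff.2 hy, avoidingPath_iff.2 hx⟩
  let D := Finset.univ.filter fun z => Joined G (Misses G v) x z
  have hxD : x ∈ D := by
    simpa [D] using Joined.refl (G := G) (S := Misses G v) (x := x) hy.right.symm
  obtain ⟨z, hzD, hmax⟩ := D.exists_max_image σ.symm ⟨x, hxD⟩
  simp only [D, Finset.mem_filter, Finset.mem_univ, true_and] at hzD hmax
  obtain ⟨z', h1, h2⟩ := key x y hx hy hxy z hzD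
  -- From the component of `x` to that of `y` and back the numbers do not decrease. As `z` has the
  -- largest number in its component, `z = z'` lies in both.
  obtain ⟨z'', h3, h4⟩ := key y x hy hx (fun h => hxy h.symm) z' h1
  have h5 := hmax z'' h3
  have h6 : z = z' := σ.symm.injective (le_antisymm h2 (h4.trans h5))
  subst h6
  exact hxy (hzD.trans h1.symm)

/-- Each closed neighbourhood separates an admissible starting vertex of the search from the
vertices visited later. -/
theorem IsLexBFS.separates (hu : Admissible G u) (h : IsLexBFS G u σ) {x y : V}
    (hxy : σ.symm x < σ.symm y) : ¬ Joined G (Misses G y) u x := by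
  intro hux
  -- Let `x'` be the first vertex of the walk visited after `y`. The walk up to `x'` uses only
  -- vertices visited no later than `x'`.
  obtain ⟨x', hx', hj⟩ := hux.exists_first (P := fun a => σ.symm y ≤ σ.symm a) (h.le_first y)
    (not_le.2 hxy)
  rw [not_le] at hx'
  have hm : Misses G x' y := hj.right.1.symm
  obtain ⟨z, hz, hz'⟩ := h.exists_in_component hx'.le hm (s := u) (hj.mono fun a ha =>
    ⟨ha.1, ha.2.elim (fun h => hx'.le.trans h) (fun h => h ▸ le_rfl)⟩)
  -- Nothing is visited before `u`, so the component of `y` contains `u`; this gives a walk from `y`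
  -- to `u` that misses `x'`, against admissibility.
  obtain rfl := h.eq_first hz'
  exact hu x' y (hj.symm.mono fun a ha => ha.1) (hz.mono fun a ha => ha.1)

theorem exists_adj_dist {V : Type*} {G : SimpleGraph V} (hG : G.Connected) {u x : V}
    (hx : x ≠ u) : ∃ c, G.Adj c x ∧ G.dist u c + 1 = G.dist u x := by
  have hpos := hG.pos_dist_of_ne hx.symm
  obtain ⟨p, hp⟩ := hG.exists_walk_length_eq_dist u x
  have hnn : ¬ p.Nil := by
    intro hn
    have := SimpleGraph.Walk.length_eq_zero_iff.2 hn
    omega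
  have h1 := p.adj_penultimate hnn
  have h2 := SimpleGraph.dist_le p.dropLast
  have h3 : p.dropLast.length + 1 = p.length := by
    simp [SimpleGraph.Walk.length_dropLast]; omega
  have h4 := hG.dist_triangle (u := u) (v := p.penultimate) (w := x)
  rw [SimpleGraph.dist_eq_one_iff_adj.2 h1] at h4
  exact ⟨p.penultimate, h1, by omega⟩

/-- Induction on the distance of `b`. Let `c` be a neighbour of `b` one layer closer. If `a` is
visited no later than `c`, induction applies to `c`. Otherwise `a` is adjacent to `c`, or it beats
`b` through a neighbour visited no later than `c`. -/
theorem IsLexBFS.dist_mono (hG : G.Connected) (h : IsLexBFS G u σ) :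
    ∀ (k : ℕ) {a b : V}, G.dist u b = k → σ.symm b ≤ σ.symm a → G.dist u a ≤ k := by
  intro k
  induction k with
  | zero =>
    intro a b hb hab
    obtain rfl := (hG.dist_eq_zero_iff).1 hb
    rw [h.eq_first hab]; simp
  | succ k ih =>
    intro a b hb hab
    obtain ⟨c, hcb, hc⟩ := exists_adj_dist hG (u := u) (x := b) (by rintro rfl; simp at hb)
    replace hc : G.dist u c = k := by omega
    have hadj : ∀ d, G.Adj d a → G.dist u d ≤ k → G.dist u a ≤ k + 1 := by
      intro d hda hd
      have h4 := hG.dist_triangle (u := u) (v := d) (w := a)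
      rw [SimpleGraph.dist_eq_one_iff_adj.2 hda] at h4
      omega
    rcases le_or_gt (σ.symm c) (σ.symm a) with hca | hca
    · exact (ih hc hca).trans (Nat.le_succ k)
    rcases h.nbrLE hab with h1 | ⟨j, hij, hj, hjb, hk⟩
    · have := (h1 _ hca).1 (by simpa using hcb)
      exact hadj c (by simpa using this) hc.le
    · rcases lt_or_ge j (σ.symm c) with hjc | hjc
      · have := (hk _ hjc).1 (by simpa using hcb)
        exact hadj c (by simpa using this) hc.le
      · exact hadj (σ j) hj (ih hc (by simpa using hjc))

theorem IsLexBFS.dist_le (hG : G.Connected) (h : IsLexBFS G u σ) {a b : V}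
    (hab : σ.symm b ≤ σ.symm a) : G.dist u a ≤ G.dist u b :=
  h.dist_mono hG _ rfl hab

end Admissible

/-! ### The scan and the cliques that it keeps -/

section Scan

variable {V : Type*} {G : SimpleGraph V}

/-- The relation `r` stands for "scanned earlier". It records that a removed vertex has a
non-neighbour that was kept before it. -/
theorem scan_spec (r : V → V → Prop) : ∀ (l K : List V), (∀ x ∈ K, ∀ y ∈ l, r x y) →
    l.Pairwise r → (K.Pairwise fun a b => G.Adj a b) →
    (scan G K l).Pairwise (fun a b => G.Adj a b) ∧ (∀ x ∈ scan G K l, x ∈ K ∨ x ∈ l) ∧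
      (∀ x ∈ K, x ∈ scan G K l) ∧
      ∀ y ∈ l, y ∉ scan G K l → ∃ x ∈ scan G K l, r x y ∧ ¬ G.Adj x y
  | [], K, _, _, hK => by simp [scan, hK]
  | a :: l, K, hr, hl, hK => by
    rw [List.pairwise_cons] at hl
    unfold scan
    split_ifs with ha
    · obtain ⟨h1, h2, h3, h4⟩ := scan_spec r l (a :: K)
        (by
          intro x hx y hy
          rcases List.mem_cons.1 hx with rfl | hx
          exacts [hl.1 y hy, hr x hx y (List.mem_cons_of_mem _ hy)]) hl.2
        (List.pairwise_cons.2 ⟨fun b hb => (ha b hb).symm, hK⟩)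
      refine ⟨h1, fun x hx => ?_, fun x hx => h3 x (List.mem_cons_of_mem _ hx), fun y hy hy' => ?_⟩
      · have := h2 x hx
        simp only [List.mem_cons] at this ⊢
        tauto
      · rcases List.mem_cons.1 hy with rfl | hy
        · exact absurd (h3 y List.mem_cons_self) hy'
        · exact h4 y hy hy'
    · obtain ⟨h1, h2, h3, h4⟩ := scan_spec r l K
        (fun x hx y hy => hr x hx y (List.mem_cons_of_mem _ hy)) hl.2 hK
      refine ⟨h1, fun x hx => (h2 x hx).imp_right (List.mem_cons_of_mem _), h3, fun y hy hy' => ?_⟩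
      rcases List.mem_cons.1 hy with rfl | hy
      · push Not at ha
        obtain ⟨x, hx, hxy⟩ := ha
        exact ⟨x, h3 x hx, hr x hx y List.mem_cons_self, hxy⟩
      · exact h4 y hy hy'

variable [Fintype V]

/-- The last clause is in the form needed for separation: the vertex that removes `y` has a smaller
number, so it is visited later in the search. -/
theorem scanClique_spec (G : SimpleGraph V) (σ : Fin (Fintype.card V) ≃ V) (S : Set V) :
    G.IsClique (scanClique G σ S : Set V) ∧ (∀ x ∈ scanClique G σ S, x ∈ S) ∧
      ∀ y ∈ S, y ∉ scanClique G σ S →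
        ∃ x ∈ scanClique G σ S, σ.symm x < σ.symm y ∧ ¬ G.Adj x y := by
  classical
  set l := ((List.finRange (Fintype.card V)).map σ).filter (fun w => decide (w ∈ S)) with hl
  have hmem : ∀ x, x ∈ l ↔ x ∈ S := by
    intro x
    simp only [hl, List.mem_filter, List.mem_map, List.mem_finRange, true_and, decide_eq_true_eq,
      and_iff_right_iff_imp]
    exact fun _ => ⟨σ.symm x, by simp⟩
  have hpw : l.Pairwise fun a b => σ.symm a < σ.symm b := by
    apply List.Pairwise.filter
    rw [List.pairwise_map]
    simpa using List.pairwise_lt_finRange (Fintype.card V)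
  obtain ⟨h1, h2, -, h4⟩ := scan_spec (G := G) (fun a b => σ.symm a < σ.symm b) l [] (by simp) hpw
    List.Pairwise.nil
  have heq : scanClique G σ S = (scan G [] l).toFinset := by
    unfold scanClique
    congr!
  simp only [heq, List.mem_toFinset, List.coe_toFinset]
  refine ⟨?_, fun x hx => ?_, fun y hy hy' => h4 y ((hmem y).2 hy) hy'⟩
  · have : Std.Symm fun a b => G.Adj a b := ⟨fun _ _ h => h.symm⟩
    exact fun a ha b hb hab => h1.forall ha hb hab
  · simpa [hmem] using h2 x hx

end Scan

/-! ### Farthest vertices in the three cliques -/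

section Cliques

variable {V : Type*} [Fintype V] {G : SimpleGraph V} {σ τ : Fin (Fintype.card V) ≃ V} {u v : V}

/-- A walk to a farthest vertex `y` from `w` forces walks from `w` to closer vertices to
miss `y`, and so does a walk from the start of the search. -/
theorem IsLexBFS.dist_le_dist_of_later (hG : G.Connected) (hu : Admissible G u)
    (h : IsLexBFS G u σ) {w x y : V} (hxy : σ.symm x < σ.symm y) (hadj : ¬ G.Adj x y)
    (hw : Joined G (Misses G y) u w) : G.dist w y ≤ G.dist w x := by
  by_contra hlt
  have hne : x ≠ y := by rintro rfl; exact lt_irrefl _ hxy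
  -- If `x` is closer to `w` than `y`, a shortest walk from `w` to `x` misses `y` and prolongs the
  -- walk from `u` to `w`.
  exact h.separates hu hxy (hw.trans
    (joined_of_dist_lt hG (not_le.1 hlt) ⟨hne, fun h => hadj h.symm⟩))

/-- If no walk from `u` to `x` misses `y`, a shortest one has a vertex near `y`. -/
theorem exists_near (hG : G.Connected) {u x y : V} (h : ¬ Joined G (Misses G y) u x) :
    ∃ b, G.dist u b + G.dist b x = G.dist u x ∧ G.dist b y ≤ 1 := by
  classical
  by_contra! hcon
  obtain ⟨p, hp⟩ := hG.exists_walk_length_eq_dist u x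
  refine h ⟨p, fun a ha => misses_of_dist ?_⟩
  rw [SimpleGraph.dist_comm]
  refine hcon a (le_antisymm ?_ hG.dist_triangle)
  rw [← hp, ← congrArg SimpleGraph.Walk.length (p.take_spec ha), SimpleGraph.Walk.length_append]
  exact add_le_add (SimpleGraph.dist_le _) (SimpleGraph.dist_le _)

/-- A shortest walk misses `y` if it ends early or far enough from `y`. -/
theorem joined_of_far (hG : G.Connected) {u w y : V}
    (h : ∀ b, G.dist u b + G.dist b w = G.dist u w → 2 ≤ G.dist b y) :
    Joined G (Misses G y) u w := by
  by_contra hcon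
  obtain ⟨b, hb, hby⟩ := exists_near hG hcon
  have := h b hb
  omega

/-- Since `v` is visited last, every walk from `u` to `v` meets `N[w]`. Hence a shortest walk from
`u` to `y` meets `N[w]` too, and its beginning leads to `w` while missing `y`. -/
theorem far_in_first_clique (hG : G.Connected) (hu : Admissible G u)
    (h : IsLexBFS G u σ) (hv : IsLast σ v) {w y : V} (hy : G.dist v y ≤ 1) (hwy : 3 ≤ G.dist w y) :
    ∃ x ∈ cliqueA G σ v, G.dist w y ≤ G.dist w x := by
  have hmem : ∀ x : V, x ∈ {w | G.edist v w ≤ 1} ↔ G.dist v x ≤ 1 := fun x => by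
    rw [Set.mem_ofPred_eq, ← (hG v x).coe_dist_eq_edist]; norm_cast
  obtain ⟨-, h2, h3⟩ := scanClique_spec G σ {w | G.edist v w ≤ 1}
  by_cases hyA : y ∈ cliqueA G σ v
  · exact ⟨y, hyA, le_rfl⟩
  obtain ⟨x, hxA, hxy, hadj⟩ := h3 y ((hmem y).2 hy) hyA
  refine ⟨x, hxA, h.dist_le_dist_of_later hG hu hxy hadj ?_⟩
  have hvw := hG.dist_triangle (u := w) (v := v) (w := y)
  have hlast : ∀ a, σ.symm v ≤ σ.symm a := fun a => by
    rw [Fin.le_def, show (σ.symm v).val = 0 from hv]; exact Nat.zero_le _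
  have hwv : σ.symm v < σ.symm w := by
    refine lt_of_le_of_ne (hlast w) fun he => ?_
    have := σ.symm.injective he
    subst this
    omega
  -- the shortest walks from `u` to `y`, followed by the edge `y v`, meet `N[w]`
  have hnot : ¬ Joined G (Misses G w) u y := by
    intro hj
    have hvm : Misses G w v := misses_of_dist (by omega)
    refine h.separates hu hwv ?_
    rcases eq_or_ne y v with rfl | hne
    · exact hj
    · have := hG.pos_dist_of_ne hne
      rw [SimpleGraph.dist_comm] at this
      exact hj.step (SimpleGraph.dist_eq_one_iff_adj.1 (by omega : G.dist v y = 1)).symm hvm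
  obtain ⟨b, hb, hbw⟩ := exists_near hG hnot
  have hby : 2 ≤ G.dist b y := by
    have := hG.dist_triangle (u := w) (v := b) (w := y)
    rw [SimpleGraph.dist_comm (u := w) (v := b)] at this
    omega
  -- As `b` is on a shortest walk from `u` to `y`, every vertex of a shortest walk from `u` to `b`
  -- is at least as far from `y` as `b`.
  have hub : Joined G (Misses G y) u b := joined_of_far hG fun c hc => by
    have h1 := hG.dist_triangle (u := u) (v := c) (w := y)
    have h2 := hG.dist_triangle (u := c) (v := b) (w := y)
    omega
  have hwm : Misses G y w := (misses_of_dist (by omega : 2 ≤ G.dist w y)).symm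
  rcases eq_or_ne b w with rfl | hne
  · exact hub
  · have := hG.pos_dist_of_ne hne
    exact hub.step (SimpleGraph.dist_eq_one_iff_adj.1 (by omega)) hwm

/-- Since `y` is visited after `w`, it is at least as far from `v`. A vertex of a shortest walk from
`v` to `w` within distance 1 of `y` would thus be within distance 1 of `w`, and `w` within distance
2 of `y`. -/
theorem far_in_layer_clique (hG : G.Connected) (hv : Admissible G v) (h : IsLexBFS G v τ)
    {S : Set V} {i : ℕ} (hS : ∀ x, x ∈ S ↔ G.dist v x = i) {w y : V} (hy : G.dist v y = i)
    (hwy : 3 ≤ G.dist w y) (hlt : τ.symm y < τ.symm w) :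
    ∃ x ∈ scanClique G τ S, G.dist w y ≤ G.dist w x := by
  obtain ⟨-, h2, h3⟩ := scanClique_spec G τ S
  by_cases hyS : y ∈ scanClique G τ S
  · exact ⟨y, hyS, le_rfl⟩
  obtain ⟨x, hx, hxy, hadj⟩ := h3 y ((hS y).2 hy) hyS
  refine ⟨x, hx, h.dist_le_dist_of_later hG hv hxy hadj (joined_of_far hG fun b hb => ?_)⟩
  have h1 := h.dist_le hG hlt.le
  have h4 := hG.dist_triangle (u := v) (v := b) (w := y)
  have h5 := hG.dist_triangle (u := w) (v := b) (w := y)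
  rw [SimpleGraph.dist_comm (u := w) (v := b)] at h5
  omega

theorem scanClique_nonempty {S : Set V} {y : V} (hy : y ∈ S) : (scanClique G σ S).Nonempty := by
  obtain ⟨-, -, h3⟩ := scanClique_spec G σ S
  by_cases h : y ∈ scanClique G σ S
  · exact ⟨y, h⟩
  · obtain ⟨x, hx, -⟩ := h3 y hy h
    exact ⟨x, hx⟩

/-- The vertex `v` has the number 0 and is scanned first, so nothing removes it. -/
theorem last_mem_cliqueA (hv : IsLast σ v) : v ∈ cliqueA G σ v := by
  obtain ⟨-, -, h3⟩ := scanClique_spec G σ {w | G.edist v w ≤ 1}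
  by_contra h
  obtain ⟨x, -, hx, -⟩ := h3 v (by simp) h
  rw [Fin.lt_def, show (σ.symm v).val = 0 from hv] at hx
  omega

/-- The three cliques contain a vertex farthest from `w`. -/
theorem exists_far_in_cliques [DecidableEq V] (hG : G.Connected) (hAT : ATFree G)
    (h : ThreeSweep G σ τ v) {w : V} (hw : 3 ≤ G.eccent w) :
    ∃ x ∈ cliqueA G σ v ∪ cliqueB G τ v ∪ cliqueC G τ v, G.edist w x = G.eccent w := by
  classical
  obtain ⟨r, u, ρ, hρ, hul, hσ, hvl, hτ⟩ := h
  have hu := hρ.admissible_last hAT hul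
  have hv := hσ.admissible_last hAT hvl
  have := hG.nonempty
  obtain ⟨y, hy⟩ := SimpleGraph.exists_edist_eq_eccent_of_finite (G := G) w
  suffices hs : ∃ x ∈ cliqueA G σ v ∪ cliqueB G τ v ∪ cliqueC G τ v, G.dist w y ≤ G.dist w x by
    obtain ⟨x, hx, hle⟩ := hs
    refine ⟨x, hx, le_antisymm SimpleGraph.edist_le_eccent ?_⟩
    rw [← hy, ← coe_dist_edist hG, ← coe_dist_edist hG]
    exact_mod_cast hle
  have hwy : 3 ≤ G.dist w y := by
    rw [← hy, ← coe_dist_edist hG] at hw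
    exact_mod_cast hw
  obtain ⟨t, ht⟩ := SimpleGraph.exists_edist_eq_eccent_of_finite (G := G) v
  have hd : ∀ a, G.dist v a ≤ G.dist v t := fun a => by
    have : G.edist v a ≤ G.edist v t := ht ▸ SimpleGraph.edist_le_eccent
    rw [← coe_dist_edist hG, ← coe_dist_edist hG] at this
    exact_mod_cast this
  have hC : ∀ x : V, x ∈ {w | G.edist v w = G.eccent v} ↔ G.dist v x = G.dist v t := fun x => by
    rw [Set.mem_ofPred_eq, ← ht, ← coe_dist_edist hG, ← coe_dist_edist hG]; norm_cast
  have hB : ∀ x : V, x ∈ {w | G.edist v w + 1 = G.eccent v} ↔ G.dist v x + 1 = G.dist v t :=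
    fun x => by rw [Set.mem_ofPred_eq, ← ht, ← coe_dist_edist hG, ← coe_dist_edist hG]; norm_cast
  simp only [Finset.mem_union]
  by_cases hi : G.dist v y ≤ 1
  · obtain ⟨x, hx, hle⟩ := far_in_first_clique hG hu hσ hvl hi hwy
    exact ⟨x, by tauto, hle⟩
  rcases lt_trichotomy (τ.symm y) (τ.symm w) with hlt | heq | hlt
  · by_cases hyC : G.dist v y = G.dist v t
    · obtain ⟨x, hx, hle⟩ := far_in_layer_clique hG hv hτ hC hyC hwy hlt
      exact ⟨x, Or.inr hx, hle⟩
    by_cases hyB : G.dist v y + 1 = G.dist v t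
    · obtain ⟨x, hx, hle⟩ := far_in_layer_clique hG hv hτ (i := G.dist v t - 1)
        (fun x => (hB x).trans (by omega)) (by omega) hwy hlt
      exact ⟨x, Or.inl (Or.inr hx), hle⟩
    -- Now `y` is at least two layers before the last one. By separation a shortest walk from `v` to
    -- `y` passes within distance 1 of `w`. So the distance from `w` to `y` is at most the
    -- difference of their layers plus 2, which no vertex of the last layer undercuts.
    obtain ⟨c, hc⟩ := scanClique_nonempty (G := G) (σ := τ) ((hC t).2 rfl)
    have hcd := (hC c).1 ((scanClique_spec G τ _).2.1 c hc)
    refine ⟨c, Or.inr hc, ?_⟩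
    obtain ⟨b, hb, hbw⟩ := exists_near hG (hτ.separates hv hlt)
    have h1 := hd y
    have h2 := hG.dist_triangle (u := v) (v := w) (w := c)
    have h3 := hG.dist_triangle (u := v) (v := b) (w := w)
    have h4 := hG.dist_triangle (u := w) (v := b) (w := y)
    have h5 := hG.dist_triangle (u := v) (v := w) (w := b)
    rw [SimpleGraph.dist_comm (u := w) (v := b)] at *
    omega
  · have := τ.symm.injective heq
    subst this
    simp at hwy
  -- Here `y` is visited before `w`, so a shortest walk from `v` to `w` has a vertex `b` within
  -- distance 1 of `y`. As `y` is at distance at least 2 from `v`, `b` is not `v`, and the detour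
  -- over `b` shows that `y` is no farther from `w` than `v`.
  · refine ⟨v, Or.inl (Or.inl (last_mem_cliqueA hvl)), ?_⟩
    obtain ⟨b, hb, hby⟩ := exists_near hG (hτ.separates hv hlt)
    have h3 := hG.dist_triangle (u := v) (v := b) (w := y)
    have h4 := hG.dist_triangle (u := w) (v := b) (w := y)
    rw [SimpleGraph.dist_comm (u := w) (v := b)] at h4
    rw [SimpleGraph.dist_comm (u := w) (v := v)]
    omega

/-- Each of the `k` vertices has degree at least `k - 1`, so `k (k - 1) ≤ 2 m`, which gives `k ^ 2 ≤
4 (m + 1)`. -/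
theorem isClique_card_le (K : Finset V) (hK : G.IsClique (K : Set V)) :
    (K.card : ℝ) ≤ 2 * √((G.edgeSet.ncard : ℝ) + 1) := by
  classical
  have h1 : K.card * (K.card - 1) ≤ 2 * G.edgeSet.ncard := by
    have h2 := G.sum_degrees_eq_twice_card_edges
    rw [Set.ncard_eq_toFinset_card', ← SimpleGraph.edgeFinset, ← h2]
    calc K.card * (K.card - 1) = ∑ x ∈ K, (K.card - 1) := by simp
      _ ≤ ∑ x ∈ K, G.degree x := by
        refine Finset.sum_le_sum fun x hx => ?_
        rw [← Finset.card_erase_of_mem hx]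
        refine Finset.card_le_card fun y hy => ?_
        rw [Finset.mem_erase] at hy
        simpa using hK (by simpa using hx) (by simpa using hy.2) hy.1.symm
      _ ≤ _ := Finset.sum_le_sum_of_subset (Finset.subset_univ _)
  have h3 : K.card ^ 2 ≤ 4 * (G.edgeSet.ncard + 1) := by
    rcases Nat.eq_zero_or_pos K.card with h0 | h0
    · simp [h0]
    · obtain ⟨k, hk⟩ : ∃ k, K.card = k + 1 := ⟨K.card - 1, by omega⟩
      rw [hk] at h1 ⊢
      simp only [Nat.add_sub_cancel] at h1
      nlinarith
  rw [← Real.sqrt_sq (Nat.cast_nonneg K.card), show (2 : ℝ) = √(2 ^ 2) by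
    rw [Real.sqrt_sq (by norm_num)], ← Real.sqrt_mul (by norm_num)]
  apply Real.sqrt_le_sqrt
  have : ((K.card ^ 2 : ℕ) : ℝ) ≤ ((4 * (G.edgeSet.ncard + 1) : ℕ) : ℝ) := by exact_mod_cast h3
  push_cast at this
  linarith

theorem eccent_eq_max [DecidableEq V] (hG : G.Connected) (hAT : ATFree G) (h : ThreeSweep G σ τ v)
    {w : V} (hw : ¬ ∀ x, x ≠ w → G.Adj w x) :
    G.eccent w = max 2 ((cliqueA G σ v ∪ cliqueB G τ v ∪ cliqueC G τ v).sup
      (fun x => G.edist w x)) := by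
  have h1 : ¬ G.eccent w ≤ 1 := by
    rw [SimpleGraph.eccent_le_one_iff]
    exact fun h => hw fun x hx => h x hx.symm
  have h2 : 2 ≤ G.eccent w := by
    have := Order.add_one_le_of_lt (not_le.1 h1)
    rwa [one_add_one_eq_two] at this
  refine le_antisymm ?_ (max_le h2 (Finset.sup_le fun x _ => SimpleGraph.edist_le_eccent))
  rcases h2.eq_or_lt with h3 | h3
  · exact h3 ▸ le_max_left _ _
  · have h4 : 3 ≤ G.eccent w := by
      have := Order.add_one_le_of_lt h3
      rwa [two_add_one_eq_three] at this
    obtain ⟨x, hx, hxe⟩ := exists_far_in_cliques hG hAT h h4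
    rw [← hxe]
    exact le_max_of_le_right (Finset.le_sup (f := fun x => G.edist w x) hx)

theorem cliques_of_three_sweeps [DecidableEq V] (hG : G.Connected) (hAT : ATFree G)
    (h : ThreeSweep G σ τ v) (A B C : Finset V)
    (hA : A = cliqueA G σ v) (hB : B = cliqueB G τ v) (hC : C = cliqueC G τ v) :
    (G.IsClique (A : Set V) ∧ G.IsClique (B : Set V) ∧ G.IsClique (C : Set V)) ∧
      ((A.card : ℝ) ≤ 2 * √((G.edgeSet.ncard : ℝ) + 1) ∧
        (B.card : ℝ) ≤ 2 * √((G.edgeSet.ncard : ℝ) + 1) ∧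
        (C.card : ℝ) ≤ 2 * √((G.edgeSet.ncard : ℝ) + 1)) ∧
      (∀ w : V, 3 ≤ G.eccent w → ∃ x ∈ A ∪ B ∪ C, G.edist w x = G.eccent w) ∧
      (∀ w : V, Nontrivial V → (∀ x, x ≠ w → G.Adj w x) → G.eccent w = 1) ∧
      (∀ w : V, ¬ (∀ x, x ≠ w → G.Adj w x) →
        G.eccent w = max 2 ((A ∪ B ∪ C).sup (fun x => G.edist w x))) := by
  subst hA hB hC
  have h1 := (scanClique_spec G σ {w | G.edist v w ≤ 1}).1
  have h2 := (scanClique_spec G τ {w | G.edist v w + 1 = G.eccent v}).1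
  have h3 := (scanClique_spec G τ {w | G.edist v w = G.eccent v}).1
  refine ⟨⟨h1, h2, h3⟩, ⟨isClique_card_le _ h1, isClique_card_le _ h2, isClique_card_le _ h3⟩,
    fun w hw => exists_far_in_cliques hG hAT h hw, fun w _ hw => ?_,
    fun w hw => eccent_eq_max hG hAT h hw⟩
  exact (SimpleGraph.eccent_eq_one_iff w).2 fun x hx => hw x hx.symm

end Cliques
end ATGraph

/-! ### Reasoning about programs: frames, time bounds and loops -/

namespace WordRAM

/-- The registers that a program may write. -/
def Prog.wr : Prog → List ℕ
  | .skip => []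
  | .set r _ => [r]
  | .put _ _ _ => []
  | .seq p q => p.wr ++ q.wr
  | .ite _ p q => p.wr ++ q.wr
  | .loop _ p => p.wr

/-- The arrays that a program may write. -/
def Prog.wa : Prog → List ℕ
  | .skip => []
  | .set _ _ => []
  | .put a _ _ => [a]
  | .seq p q => p.wa ++ q.wa
  | .ite _ p q => p.wa ++ q.wa
  | .loop _ p => p.wa

/-- The states `s` and `s'` agree on everything that `p` does not write. -/
structure Prog.Frame (p : Prog) (s s' : State) : Prop where
  reg : ∀ r, r ∉ p.wr → s'.reg r = s.reg r
  arr : ∀ a, a ∉ p.wa → s'.arr a = s.arr a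

theorem Prog.Frame.refl (p : Prog) (s : State) : p.Frame s s := ⟨fun _ _ => rfl, fun _ _ => rfl⟩

theorem Prog.Frame.trans {p q r : Prog} {s₁ s₂ s₃ : State} (h₁ : p.Frame s₁ s₂)
    (h₂ : q.Frame s₂ s₃) (hr : p.wr ++ q.wr ⊆ r.wr) (ha : p.wa ++ q.wa ⊆ r.wa) :
    r.Frame s₁ s₃ := by
  constructor
  · intro x hx
    rw [h₂.reg x fun h => hx (hr (List.mem_append_right _ h)),
      h₁.reg x fun h => hx (hr (List.mem_append_left _ h))]
  · intro x hx
    rw [h₂.arr x fun h => hx (ha (List.mem_append_right _ h)),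
      h₁.arr x fun h => hx (ha (List.mem_append_left _ h))]

/-- What is unchanged can be read off the program text, so for concrete programs the side conditions
are settled by `decide` or `simp`. -/
theorem Exec.frame {w : ℕ} {p : Prog} {s s' : State} {t : ℕ} (h : Exec w p s t s') :
    p.Frame s s' := by
  induction h with
  | skip s => exact .refl _ _
  | set r x s =>
    refine ⟨fun r' hr' => ?_, fun a _ => rfl⟩
    simp only [Prog.wr, List.mem_singleton] at hr'
    simp [State.setReg, Function.update_of_ne hr']
  | put a i x s =>
    refine ⟨fun r' _ => rfl, fun a' ha' => ?_⟩
    simp only [Prog.wa, List.mem_singleton] at ha'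
    simp [State.setArr, Function.update_of_ne ha']
  | seq _ _ ih₁ ih₂ => exact ih₁.trans ih₂ (by simp [Prog.wr]) (by simp [Prog.wa])
  | iteTrue _ _ ih => exact ih.trans (.refl .skip _) (by simp [Prog.wr]) (by simp [Prog.wa])
  | iteFalse _ _ ih => exact ih.trans (.refl .skip _) (by simp [Prog.wr]) (by simp [Prog.wa])
  | loopTrue _ _ _ ih₁ ih₂ => exact ih₁.trans ih₂ (by simp [Prog.wr]) (by simp [Prog.wa])
  | loopFalse _ => exact .refl _ _

/-- The program `p` halts within `T` steps in a state that satisfies `Q`. -/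
def Runs (w : ℕ) (p : Prog) (s : State) (T : ℕ) (Q : State → Prop) : Prop :=
  ∃ t s', Exec w p s t s' ∧ t ≤ T ∧ Q s'

variable {w : ℕ}

theorem Runs.mono {p : Prog} {s : State} {T T' : ℕ} {Q Q' : State → Prop} (h : Runs w p s T Q)
    (hT : T ≤ T') (hQ : ∀ s', p.Frame s s' → Q s' → Q' s') : Runs w p s T' Q' := by
  obtain ⟨t, s', h1, h2, h3⟩ := h
  exact ⟨t, s', h1, h2.trans hT, hQ s' h1.frame h3⟩

theorem Runs.seq {p q : Prog} {s : State} {T T₁ T₂ : ℕ} {R Q : State → Prop}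
    (h : Runs w p s T₁ R) (hq : ∀ s', p.Frame s s' → R s' → Runs w q s' T₂ Q)
    (hT : T₁ + T₂ ≤ T) : Runs w (.seq p q) s T Q := by
  obtain ⟨t, s', h1, h2, h3⟩ := h
  obtain ⟨t', s'', h4, h5, h6⟩ := hq s' h1.frame h3
  exact ⟨t + t', s'', h1.seq h4, by omega, h6⟩

theorem Runs.ite {b : Expr} {p q : Prog} {s : State} {T T' : ℕ} {Q : State → Prop}
    (hp : b.eval w s ≠ 0 → Runs w p s T' Q) (hq : b.eval w s = 0 → Runs w q s T' Q)
    (hT : b.cost + 1 + T' ≤ T) : Runs w (.ite b p q) s T Q := by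
  by_cases h : b.eval w s = 0
  · obtain ⟨t, s', h1, h2, h3⟩ := hq h
    exact ⟨_, s', .iteFalse h h1, by omega, h3⟩
  · obtain ⟨t, s', h1, h2, h3⟩ := hp h
    exact ⟨_, s', .iteTrue h h1, by omega, h3⟩

/-- Programs without loops. -/
def Prog.flat : Prog → Bool
  | .skip => true
  | .set _ _ => true
  | .put _ _ _ => true
  | .seq p q => p.flat && q.flat
  | .ite _ p q => p.flat && q.flat
  | .loop _ _ => false

/-- The effect of a program without loops. -/
def Prog.den (w : ℕ) : Prog → State → State
  | .skip, s => s
  | .set r x, s => s.setReg r (x.eval w s)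
  | .put a i x, s => s.setArr a (i.eval w s) (x.eval w s)
  | .seq p q, s => q.den w (p.den w s)
  | .ite b p q, s => if b.eval w s = 0 then q.den w s else p.den w s
  | .loop _ _, s => s

/-- A bound for the time of a program without loops. -/
def Prog.cost : Prog → ℕ
  | .skip => 1
  | .set _ x => x.cost + 1
  | .put _ i x => i.cost + x.cost + 1
  | .seq p q => p.cost + q.cost
  | .ite b p q => b.cost + 1 + max p.cost q.cost
  | .loop _ _ => 0

theorem Prog.exec_flat (p : Prog) (hp : p.flat = true) (s : State) :
    ∃ t, Exec w p s t (p.den w s) ∧ t ≤ p.cost := by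
  induction p generalizing s with
  | skip => exact ⟨_, .skip s, le_rfl⟩
  | set r x => exact ⟨_, .set r x s, le_rfl⟩
  | put a i x => exact ⟨_, .put a i x s, le_rfl⟩
  | seq p q ihp ihq =>
    simp only [Prog.flat, Bool.and_eq_true] at hp
    obtain ⟨t, h1, h2⟩ := ihp hp.1 s
    obtain ⟨t', h3, h4⟩ := ihq hp.2 (p.den w s)
    exact ⟨_, h1.seq h3, Nat.add_le_add h2 h4⟩
  | ite b p q ihp ihq =>
    simp only [Prog.flat, Bool.and_eq_true] at hp
    simp only [Prog.den, Prog.cost]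
    split_ifs with hb
    · obtain ⟨t, h1, h2⟩ := ihq hp.2 s
      exact ⟨_, .iteFalse hb h1, by omega⟩
    · obtain ⟨t, h1, h2⟩ := ihp hp.1 s
      exact ⟨_, .iteTrue hb h1, by omega⟩
  | loop b p _ => simp [Prog.flat] at hp

/-- For a loop-free program only an evaluation of `den` and a comparison of numerals are left. -/
theorem Runs.flat {p : Prog} {s : State} {T : ℕ} {Q : State → Prop} (hp : p.flat = true)
    (hT : p.cost ≤ T) (hQ : Q (p.den w s)) : Runs w p s T Q := by
  obtain ⟨t, h1, h2⟩ := p.exec_flat (w := w) hp s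
  exact ⟨t, _, h1, h2.trans hT, hQ⟩

/-- Run `body` for the values of register `r` from its current value up to, but excluding, the
value of register `B`. -/
def forUp (r B : ℕ) (body : Prog) : Prog :=
  .loop (.lt (.reg r) (.reg B)) (.seq body (.set r (.add (.reg r) (.const 1))))

/-- Run `body` for the values of register `r` from below its current value down to `0`. -/
def forDown (r : ℕ) (body : Prog) : Prog :=
  .loop (.reg r) (.seq (.set r (.sub (.reg r) (.const 1))) body)

/-- The rule for ascending loops. The invariant `I i β` mentions the time budget `β` left when
`i` is the next value. -/
theorem Runs.forUp_budget {r B : ℕ} {body : Prog} {s₀ : State} {I : ℕ → ℕ → State → Prop}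
    {a b β₀ : ℕ} (ha : s₀.reg r = a) (hb : s₀.reg B = b) (hab : a ≤ b) (hw : b < 2 ^ w)
    (hr : r ∉ body.wr) (hB : B ∉ body.wr) (hrB : r ≠ B) (h0 : I a β₀ s₀)
    (step : ∀ i β s, a ≤ i → i < b → (forUp r B body).Frame s₀ s → s.reg r = i → s.reg B = b →
      I i β s → ∃ T β', T + 8 + β' ≤ β ∧
        Runs w body s T (fun s' => I (i + 1) β' (s'.setReg r (i + 1)))) :
    Runs w (forUp r B body) s₀ (β₀ + 4) (fun s' => ∃ β, I b β s' ∧ s'.reg r = b) := by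
  have key : ∀ k i β s, b - i = k → a ≤ i → i ≤ b → (forUp r B body).Frame s₀ s → s.reg r = i →
      s.reg B = b → I i β s →
      Runs w (forUp r B body) s (β + 4) (fun s' => ∃ β, I b β s' ∧ s'.reg r = b) := by
    intro k
    induction k with
    | zero =>
      intro i β s hk hai hib _ hri hBi hI
      obtain rfl : i = b := by omega
      refine ⟨_, s, Exec.loopFalse (by simp [Expr.eval, hri, hBi]), ?_, β, hI, hri⟩
      simp [Expr.cost]
    | succ k ih =>
      intro i β s hk hai hib hf hri hBi hI
      have hib' : i < b := by omega
      obtain ⟨T, β', hT, t, s', h1, h2, h3⟩ := step i β s hai hib' hf hri hBi hI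
      have hr' : s'.reg r = i := by rw [h1.frame.reg r hr, hri]
      have hB' : s'.reg B = b := by rw [h1.frame.reg B hB, hBi]
      have hset : Exec w (.set r (.add (.reg r) (.const 1))) s' 4 (s'.setReg r (i + 1)) := by
        have h := Exec.set (w := w) r (.add (.reg r) (.const 1)) s'
        -- The counter does not wrap around, because `i + 1 ≤ b < 2 ^ w`.
        have he : (Expr.add (.reg r) (.const 1)).eval w s' = i + 1 := by
          have h1w : 1 % 2 ^ w = 1 := Nat.mod_eq_of_lt (by omega)
          simp only [Expr.eval, hr', h1w]
          exact Nat.mod_eq_of_lt (by omega)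
        rw [he] at h
        exact h
      obtain ⟨t'', s'', h4, h5, h6⟩ := ih (i + 1) β' (s'.setReg r (i + 1)) (by omega) (by omega)
        (by omega) (hf.trans (h1.frame.trans hset.frame (r := forUp r B body)
          (by simp [forUp, Prog.wr]) (by simp [forUp, Prog.wa])) (by simp) (by simp))
        (by simp [State.setReg]) (by simp [State.setReg, Function.update_of_ne hrB.symm, hB']) h3
      refine ⟨_, s'', Exec.loopTrue (by simp [Expr.eval, hri, hBi, hib']) (h1.seq hset) h4, ?_, h6⟩
      -- A round costs 4 for the test and 4 for the increment besides the body; the final failing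
      -- test costs 4.
      simp only [Expr.cost]
      omega
  exact key _ a β₀ s₀ rfl le_rfl hab (.refl _ _) ha hb h0

/-- The rule for ascending loops with a fixed bound for each round. -/
theorem Runs.forUp {r B : ℕ} {body : Prog} {s₀ : State} {I : ℕ → State → Prop} {T : ℕ → ℕ}
    {a b Ttot : ℕ} (ha : s₀.reg r = a) (hb : s₀.reg B = b) (hab : a ≤ b) (hw : b < 2 ^ w)
    (hr : r ∉ body.wr) (hB : B ∉ body.wr) (hrB : r ≠ B) (h0 : I a s₀)
    (hT : ∑ i ∈ Finset.Ico a b, (T i + 8) + 4 ≤ Ttot)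
    (step : ∀ i s, a ≤ i → i < b → (forUp r B body).Frame s₀ s → s.reg r = i → s.reg B = b →
      I i s → Runs w body s (T i) (fun s' => I (i + 1) (s'.setReg r (i + 1)))) :
    Runs w (forUp r B body) s₀ Ttot (fun s' => I b s' ∧ s'.reg r = b) := by
  refine (Runs.forUp_budget (I := fun i β s => I i s ∧ β = ∑ j ∈ Finset.Ico i b, (T j + 8))
    ha hb hab hw hr hB hrB ⟨h0, rfl⟩ ?_).mono hT ?_
  · rintro i β s hai hib hf hri hBi ⟨hI, rfl⟩
    refine ⟨T i, _, ?_, (step i s hai hib hf hri hBi hI).mono le_rfl fun s' _ h => ⟨h, rfl⟩⟩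
    rw [Finset.sum_eq_sum_Ico_succ_bot hib]
  · rintro s' - ⟨β, ⟨h, -⟩, h'⟩
    exact ⟨h, h'⟩

/-- The rule for descending loops. The invariant `I i β` mentions the time budget `β` left when
`i` is the value of the register. -/
theorem Runs.forDown_budget {r : ℕ} {body : Prog} {s₀ : State} {I : ℕ → ℕ → State → Prop}
    {n β₀ : ℕ} (hn : s₀.reg r = n) (hw : 1 < 2 ^ w) (hr : r ∉ body.wr) (h0 : I n β₀ s₀)
    (step : ∀ i β s, i < n → (forDown r body).Frame s₀ s → s.reg r = i →
      I (i + 1) β (s.setReg r (i + 1)) → ∃ T β', T + 6 + β' ≤ β ∧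
        Runs w body s T (fun s' => I i β' s')) :
    Runs w (forDown r body) s₀ (β₀ + 2) (fun s' => ∃ β, I 0 β s' ∧ s'.reg r = 0) := by
  have key : ∀ i β s, i ≤ n → (forDown r body).Frame s₀ s → s.reg r = i → I i β s →
      Runs w (forDown r body) s (β + 2) (fun s' => ∃ β, I 0 β s' ∧ s'.reg r = 0) := by
    intro i
    induction i with
    | zero =>
      intro β s _ _ hri hI
      refine ⟨_, s, Exec.loopFalse (by simp [Expr.eval, hri]), ?_, β, hI, hri⟩
      simp [Expr.cost]
    | succ i ih =>
      intro β s hin hf hri hI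
      have hset : Exec w (.set r (.sub (.reg r) (.const 1))) s 4 (s.setReg r i) := by
        have h := Exec.set (w := w) r (.sub (.reg r) (.const 1)) s
        have he : (Expr.sub (.reg r) (.const 1)).eval w s = i := by
          simp [Expr.eval, hri, Nat.mod_eq_of_lt hw]
        rw [he] at h
        exact h
      -- The invariant speaks of the counter before its decrement, so the state before the round is
      -- recovered by restoring the counter.
      have hsame : (s.setReg r i).setReg r (i + 1) = s := by
        cases s with
        | mk reg arr =>
          simp only [State.setReg, Function.update_idem, State.mk.injEq, and_true]
          simp only at hri
          rw [← hri, Function.update_eq_self]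
      have hf' : (forDown r body).Frame s₀ (s.setReg r i) :=
        hf.trans hset.frame (by simp [forDown, Prog.wr]) (by simp [forDown, Prog.wa])
      obtain ⟨T, β', hT, t, s', h1, h2, h3⟩ := step i β (s.setReg r i) (by omega)
        hf' (by simp [State.setReg])
        (by rw [hsame]; exact hI)
      have hr' : s'.reg r = i := by rw [h1.frame.reg r hr]; simp [State.setReg]
      obtain ⟨t'', s'', h4, h5, h6⟩ := ih β' s' (by omega)
        (hf'.trans h1.frame (by simp [forDown, Prog.wr]) (by simp [forDown, Prog.wa])) hr' h3
      refine ⟨_, s'', Exec.loopTrue (by simp [Expr.eval, hri]) (hset.seq h1) h4, ?_, h6⟩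
      simp only [Expr.cost]
      omega
  exact key n β₀ s₀ le_rfl (.refl _ _) hn h0

/-! ### Adjacency lists in memory -/

variable {w n : ℕ}

/-- Run `body` for all entries of the list of the vertex in register `4`, with the address of the
entry in register `5`. -/
def forEdges (body : Prog) : Prog :=
  .seq (.set 5 (.get 0 (.reg 4))) (.seq (.set 6 (.get 0 (.add (.reg 4) (.const 1))))
    (forUp 5 6 body))

/-- The state stores the number of vertices and the adjacency lists at their places. -/
structure HasInput (adj : Fin n → List (Fin n)) (M : ℕ) (s : State) : Prop where
  num : s.reg 0 = n
  len : ∀ u : Fin n, s.arr 0 (u + 1) = s.arr 0 u + (adj u).length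
  get : ∀ (u : Fin n) (k : ℕ) (h : k < (adj u).length), s.arr 1 (s.arr 0 u + k) = (adj u)[k]
  bound : ∀ u : Fin n, s.arr 0 (u + 1) ≤ M

theorem HasInput.congr {adj : Fin n → List (Fin n)} {M : ℕ} {s s' : State}
    (h : HasInput adj M s) (h0 : s'.reg 0 = s.reg 0) (ha0 : s'.arr 0 = s.arr 0)
    (ha1 : s'.arr 1 = s.arr 1) : HasInput adj M s' := by
  constructor
  · rw [h0, h.num]
  · rw [ha0]; exact h.len
  · rw [ha0, ha1]; exact h.get
  · rw [ha0]; exact h.bound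

theorem HasInput.frame {adj : Fin n → List (Fin n)} {M : ℕ} {s s' : State} {p : Prog}
    (h : HasInput adj M s) (hf : p.Frame s s') (h0 : 0 ∉ p.wr) (h1 : 0 ∉ p.wa) (h2 : 1 ∉ p.wa) :
    HasInput adj M s' :=
  h.congr (hf.reg _ h0) (hf.arr _ h1) (hf.arr _ h2)

/-- The invariant is indexed by the set of neighbours already treated, and must not depend on the
address in register `5`. Of the 12 extra steps, 8 load the two addresses and 4 are the final test.
-/
theorem Runs.forEdges {adj : Fin n → List (Fin n)} {M : ℕ} {body : Prog} {s₀ : State}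
    {u : Fin n} {I : Finset (Fin n) → State → Prop} {T Ttot : ℕ}
    (hin : HasInput adj M s₀) (hnd : (adj u).Nodup) (hu : s₀.reg 4 = u) (hw : n + M + 1 < 2 ^ w)
    (hr : ∀ r ∈ [0, 4, 5, 6], r ∉ body.wr) (ha : ∀ a ∈ [0, 1], a ∉ body.wa)
    (h0 : ∀ s, s.arr = s₀.arr → (∀ r, r ≠ 5 → r ≠ 6 → s.reg r = s₀.reg r) → I ∅ s)
    (hT : (adj u).length * (T + 8) + 12 ≤ Ttot)
    (step : ∀ (D : Finset (Fin n)) (v : Fin n) s, v ∉ D → v ∈ adj u →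
      (WordRAM.forEdges body).Frame s₀ s → s.arr 1 (s.reg 5) = v → s.reg 4 = u →
      I D s → Runs w body s T (fun s' => ∀ e, I (insert v D) (s'.setReg 5 e))) :
    Runs w (WordRAM.forEdges body) s₀ Ttot (fun s' => I (adj u).toFinset s') := by
  have hwr : ∀ {r}, r ≠ 5 → r ≠ 6 → r ∉ body.wr → r ∉ (WordRAM.forUp 5 6 body).wr := by
    intro r h5 h6 hb
    simp [WordRAM.forUp, Prog.wr, h5, hb]
  have hun := u.isLt
  have hu1 : ((u : ℕ) + 1 % 2 ^ w) % 2 ^ w = u + 1 := by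
    rw [Nat.mod_eq_of_lt (a := 1) (by omega), Nat.mod_eq_of_lt (by omega)]
  let s₁ : State := (s₀.setReg 5 (s₀.arr 0 u)).setReg 6 (s₀.arr 0 (u + 1))
  have hs₁ : Runs w (.seq (.set 5 (.get 0 (.reg 4))) (.set 6 (.get 0 (.add (.reg 4) (.const 1)))))
      s₀ 8 (fun s' => s' = s₁) := by
    refine Runs.flat rfl (by simp [Prog.cost, Expr.cost]) ?_
    simp only [Prog.den, Expr.eval, State.setReg, s₁,
      Function.update_of_ne (show (4 : ℕ) ≠ 5 by decide), hu, hu1]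
  have h5 : s₁.reg 5 = s₀.arr 0 u := by simp [s₁, State.setReg]
  have h6 : s₁.reg 6 = s₀.arr 0 (u + 1) := by simp [s₁, State.setReg]
  have h4 : s₁.reg 4 = u := by simp [s₁, State.setReg, hu]
  have harr : s₁.arr = s₀.arr := rfl
  have hreg : ∀ r, r ≠ 5 → r ≠ 6 → s₁.reg r = s₀.reg r := by
    intro r h5 h6
    simp [s₁, State.setReg, h5, h6]
  have hrun : Runs w (WordRAM.forUp 5 6 body) s₁ ((adj u).length * (T + 8) + 4)
      (fun s' => I (adj u).toFinset s') := by
    refine (Runs.forUp (a := s₀.arr 0 u) (b := s₀.arr 0 (u + 1)) (T := fun _ => T)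
      (I := fun e s => ∃ k, e = s₀.arr 0 u + k ∧ I ((adj u).take k).toFinset s)
      (Ttot := (adj u).length * (T + 8) + 4) h5 h6 ?_ ?_
      (hr 5 (by simp)) (hr 6 (by simp)) (by decide) ⟨0, rfl, by simpa using h0 s₁ harr hreg⟩
      ?_ ?_).mono le_rfl ?_
    · rw [hin.len]; omega
    · have := hin.bound u; omega
    · rw [hin.len]; simp
    · rintro e s he1 he2 hf hs5 hs6 ⟨k, rfl, hI⟩
      have hk : k < (adj u).length := by rw [hin.len] at he2; omega
      have hfr : (WordRAM.forEdges body).Frame s₀ s := by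
        constructor
        · intro r hr'
          simp only [WordRAM.forEdges, Prog.wr, List.singleton_append, List.mem_cons, not_or] at hr'
          rw [hf.reg r hr'.2.2, hreg r hr'.1 hr'.2.1]
        · intro a ha'
          simp only [WordRAM.forEdges, Prog.wa, List.nil_append] at ha'
          rw [hf.arr a ha', harr]
      have hwa : ∀ a ∈ [0, 1], s.arr a = s₀.arr a := by
        intro a ha'
        rw [hf.arr a (by simpa [WordRAM.forUp, Prog.wa] using ha a ha'), harr]
      have hs4 : s.reg 4 = u := by
        rw [hf.reg 4 (hwr (by decide) (by decide) (hr 4 (by simp))), h4]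
      have hv : s.arr 1 (s.reg 5) = (adj u)[k] := by
        rw [hs5, hwa 1 (by simp), hin.get u k hk]
      refine (step _ (adj u)[k] s ?_ (List.getElem_mem hk) hfr hv hs4 hI).mono le_rfl ?_
      · rw [List.mem_toFinset, List.mem_take_iff_getElem]
        rintro ⟨j, hj, hjk⟩
        have := (List.Nodup.getElem_inj_iff hnd).1 hjk
        omega
      · intro s' _ h'
        refine ⟨k + 1, by omega, ?_⟩
        have := h' (s₀.arr 0 u + k + 1)
        rwa [List.take_succ_eq_append_getElem hk, List.toFinset_append, List.toFinset_cons,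
          List.toFinset_nil, Finset.union_comm, insert_empty_eq, ← Finset.insert_eq]
    · rintro s' - ⟨⟨k, hk, hI⟩, -⟩
      have : k = (adj u).length := by rw [hin.len] at hk; omega
      rwa [this, List.take_length] at hI
  obtain ⟨t₁, s', e₁, b₁, rfl⟩ := hs₁
  obtain ⟨t₂, s'', e₂, b₂, hQ⟩ := hrun
  cases e₁ with
  | seq k₁ k₂ => exact ⟨_, s'', k₁.seq (k₂.seq e₂), by omega, hQ⟩

/-- Array `0` holds the prefix sums of the degrees, with total `2 m`. The last clause lets the
program recognise a vertex adjacent to all others by the length of its list. -/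
theorem hasInput_input {G : SimpleGraph (Fin n)} {adj : Fin n → List (Fin n)}
    (h : Represents adj G) : HasInput adj (2 * G.edgeSet.ncard) (input adj) ∧
      ∑ u, (adj u).length = 2 * G.edgeSet.ncard ∧
      ∀ u, (adj u).length + 1 = n ↔ ∀ x, x ≠ u → G.Adj u x := by
  classical
  have hdeg : ∀ u, (adj u).toFinset = G.neighborFinset u := by
    intro u; ext v; simp [(h u).2]
  have hlen : ∀ u, (adj u).length = G.degree u := by
    intro u
    rw [← List.toFinset_card_of_nodup (h u).1, hdeg, SimpleGraph.card_neighborFinset_eq_degree]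
  have hsum : ∑ u, (adj u).length = 2 * G.edgeSet.ncard := by
    rw [Set.ncard_eq_toFinset_card', ← SimpleGraph.edgeFinset, ← G.sum_degrees_eq_twice_card_edges]
    exact Finset.sum_congr rfl fun u _ => hlen u
  have htake : ∀ u : Fin n, (List.finRange n).take (u + 1) = (List.finRange n).take u ++ [u] := by
    intro u
    rw [List.take_succ_eq_append_getElem (by simp)]
    simp
  have hoff : ∀ i ≤ n, (input adj).arr 0 i = (((List.finRange n).take i).flatMap adj).length := by
    intro i hi
    simp [input, hi]
  have hl : ∀ u : Fin n, (input adj).arr 0 (u + 1) = (input adj).arr 0 u + (adj u).length := by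
    intro u
    rw [hoff _ u.isLt, hoff _ u.isLt.le, htake]
    simp
  refine ⟨⟨by simp [input], hl, ?_, ?_⟩, hsum, ?_⟩
  · intro u k hk
    have hsplit : (List.finRange n).flatMap adj = ((List.finRange n).take u).flatMap adj ++
        (adj u ++ ((List.finRange n).drop (u + 1)).flatMap adj) := by
      conv_lhs => rw [← List.take_append_drop (u + 1) (List.finRange n), htake]
      simp
    rw [hoff _ u.isLt.le]
    simp only [input, one_ne_zero, if_false, if_true]
    rw [hsplit, List.map_append, List.getD_append_right _ _ _ _ (by simp), List.map_append,
      List.getD_append _ _ _ _ (by simpa using hk)]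
    simp [hk]
  · intro u
    rw [hoff _ u.isLt, ← hsum, List.length_flatMap]
    calc _ ≤ ((List.finRange n).map fun x => (adj x).length).sum :=
          List.Sublist.sum_le_sum ((List.take_sublist _ _).map _) (by simp)
      _ = _ := by rw [← List.ofFn_eq_map, List.sum_ofFn]
  · intro u
    rw [hlen, ← SimpleGraph.card_neighborFinset_eq_degree]
    constructor
    · intro hc x hx
      have : G.neighborFinset u = Finset.univ.erase u := by
        apply Finset.eq_of_subset_of_card_le
        · intro y hy
          simp only [SimpleGraph.mem_neighborFinset] at hy
          simp [hy.ne']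
        · rw [Finset.card_erase_of_mem (Finset.mem_univ _), Finset.card_univ, Fintype.card_fin]
          omega
      have hx' : x ∈ G.neighborFinset u := by rw [this]; simp [hx]
      simpa using hx'
    · intro hx
      have : G.neighborFinset u = Finset.univ.erase u := by
        ext y
        simp only [SimpleGraph.mem_neighborFinset, Finset.mem_erase, Finset.mem_univ, and_true]
        exact ⟨fun h => h.ne', hx y⟩
      rw [this, Finset.card_erase_of_mem (Finset.mem_univ _), Finset.card_univ, Fintype.card_fin]
      have := u.isLt
      omega

/-! ### Partition refinement -/

/-- A partition of the vertices with numbers below `i` in an ordering `σ` into classes: intervals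
that are sorted by increasing keys. `fin c` is the end of the class `c`, and `K` bounds the names
of the classes. -/
structure Classes {n : ℕ} (i : ℕ) (σ : Equiv.Perm (Fin n)) (key : Fin n → ℕ)
    (ord pos cls fin nw : ℕ → ℕ) (K : ℕ) : Prop where
  ord_eq : ∀ t : Fin n, ord t = σ t
  pos_eq : ∀ v : Fin n, pos v = σ.symm v
  cls_lt : ∀ v : Fin n, (σ.symm v : ℕ) < i → cls v < K
  cls_iff : ∀ v v' : Fin n, (σ.symm v : ℕ) < i → (σ.symm v' : ℕ) < i →
    (cls v = cls v' ↔ key v = key v')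
  fin_iff : ∀ v v' : Fin n, (σ.symm v : ℕ) < i → (σ.symm v' : ℕ) < i →
    ((σ.symm v' : ℕ) < fin (cls v) ↔ key v' ≤ key v)
  fin_le : ∀ v : Fin n, (σ.symm v : ℕ) < i → fin (cls v) ≤ i
  nw_lt : ∀ c < K, nw c < K

/-- The classes in the course of a refinement step: the keys of the vertices that have been moved
are odd, and `nw c` is the class of the moved vertices of the class `c`, if it is at least `K₀`. -/
structure Refining {n : ℕ} (i : ℕ) (σ : Equiv.Perm (Fin n)) (key : Fin n → ℕ)
    (ord pos cls fin nw : ℕ → ℕ) (K K₀ : ℕ) : Prop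
    extends Classes i σ key ord pos cls fin nw K where
  le : K₀ ≤ K
  cls_old : ∀ v : Fin n, (σ.symm v : ℕ) < i → key v % 2 = 0 → cls v < K₀
  nw_none : ∀ v v' : Fin n, (σ.symm v : ℕ) < i → (σ.symm v' : ℕ) < i → key v % 2 = 0 →
    nw (cls v) < K₀ → key v' ≠ key v + 1
  nw_cls : ∀ v v' : Fin n, (σ.symm v : ℕ) < i → (σ.symm v' : ℕ) < i → key v % 2 = 0 →
    K₀ ≤ nw (cls v) → (cls v' = nw (cls v) ↔ key v' = key v + 1)
  nw_fin : ∀ v v' : Fin n, (σ.symm v : ℕ) < i → (σ.symm v' : ℕ) < i → key v % 2 = 0 →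
    K₀ ≤ nw (cls v) → ((σ.symm v' : ℕ) < fin (nw (cls v)) ↔ key v' ≤ key v + 1)
  nw_fin_le : ∀ v : Fin n, (σ.symm v : ℕ) < i → key v % 2 = 0 → K₀ ≤ nw (cls v) →
    fin (nw (cls v)) ≤ i
  nw_inj : ∀ v v' : Fin n, (σ.symm v : ℕ) < i → (σ.symm v' : ℕ) < i → key v % 2 = 0 →
    key v' % 2 = 0 → K₀ ≤ nw (cls v) → nw (cls v) = nw (cls v') → cls v = cls v'

variable {n i : ℕ} {σ : Equiv.Perm (Fin n)} {key : Fin n → ℕ} {ord pos cls fin nw : ℕ → ℕ}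
  {K K₀ : ℕ}

/-- The class of the vertex with number `i` ends beyond `i`, so every vertex of the prefix lies
before that end and has no larger key. -/
theorem Classes.key_le_last (h : Classes (i + 1) σ key ord pos cls fin nw K) (hi : i < n)
    (v : Fin n) (hv : (σ.symm v : ℕ) ≤ i) : key v ≤ key (σ ⟨i, hi⟩) := by
  have hp : (σ.symm (σ ⟨i, hi⟩) : ℕ) < i + 1 := by simp
  refine (h.fin_iff _ v hp (by omega)).1 ?_
  have := (h.fin_iff _ _ hp hp).2 le_rfl
  simp only [Equiv.symm_apply_apply] at this
  omega

/-- The vertex with number `i` is visited; the refinement with its neighbours begins. -/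
theorem Classes.visit (h : Classes (i + 1) σ key ord pos cls fin nw K) (hi : i < n) :
    Refining i σ (fun v => 2 * key v) ord pos cls
      (Function.update fin (cls (σ ⟨i, hi⟩)) i) nw K K := by
  have hp : (σ.symm (σ ⟨i, hi⟩) : ℕ) < i + 1 := by simp
  have hlast := h.key_le_last hi
  have hnw : ∀ v : Fin n, (σ.symm v : ℕ) < i → nw (cls v) < K := fun v hv =>
    h.nw_lt _ (h.cls_lt v (by omega))
  refine ⟨⟨h.ord_eq, h.pos_eq, fun v hv => h.cls_lt v (by omega), fun v v' hv hv' => ?_,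
    fun v v' hv hv' => ?_, fun v hv => ?_, h.nw_lt⟩, le_rfl, fun v hv _ => h.cls_lt v (by omega),
    fun v v' _ _ _ _ => by omega, fun v v' hv _ _ hk => absurd (hnw v hv) (by omega),
    fun v v' hv _ _ hk => absurd (hnw v hv) (by omega),
    fun v hv _ hk => absurd (hnw v hv) (by omega),
    fun v v' hv _ _ _ hk => absurd (hnw v hv) (by omega)⟩
  · rw [h.cls_iff v v' (by omega) (by omega)]; omega
  -- Only the class of the visited vertex reached up to `i + 1`; its end becomes `i`. Doubling the
  -- keys leaves room for odd ones.
  · by_cases hc : cls v = cls (σ ⟨i, hi⟩)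
    · rw [hc, Function.update_self]
      have h1 := (h.cls_iff v _ (by omega) hp).1 hc
      have h2 := hlast v' (by omega)
      omega
    · rw [Function.update_of_ne hc, h.fin_iff v v' (by omega) (by omega)]
      omega
  · by_cases hc : cls v = cls (σ ⟨i, hi⟩)
    · rw [hc, Function.update_self]
    · rw [Function.update_of_ne hc]
      have h1 := (h.cls_iff v _ (by omega) hp).not.1 hc
      have h2 := hlast v (by omega)
      have h3 := h.fin_iff v _ (by omega) hp
      simp only [Equiv.symm_apply_apply] at h3
      omega

/-- A new class for the moved vertices of the class of `x` is created. -/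
theorem Refining.create (h : Refining i σ key ord pos cls fin nw K K₀) {x : Fin n}
    (hx : (σ.symm x : ℕ) < i) (hk : key x % 2 = 0) (hnw : nw (cls x) < K₀) :
    Refining i σ key ord pos cls (Function.update fin K (fin (cls x)))
      (Function.update (Function.update nw K 0) (cls x) K) (K + 1) K₀ := by
  have hne : ∀ v : Fin n, (σ.symm v : ℕ) < i → cls v ≠ K := fun v hv => (h.cls_lt v hv).ne
  have hle := h.le
  have hnw' : ∀ v : Fin n, (σ.symm v : ℕ) < i →
      (cls v = cls x ∧ Function.update (Function.update nw K 0) (cls x) K (cls v) = K) ∨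
      (cls v ≠ cls x ∧
        Function.update (Function.update nw K 0) (cls x) K (cls v) = nw (cls v)) := by
    intro v hv
    by_cases hc : cls v = cls x
    · exact Or.inl ⟨hc, by rw [hc, Function.update_self]⟩
    · exact Or.inr ⟨hc, by rw [Function.update_of_ne hc, Function.update_of_ne (hne v hv)]⟩
  have hfin : ∀ c, c ≠ K → Function.update fin K (fin (cls x)) c = fin c := fun c hc =>
    Function.update_of_ne hc _ _
  have hnK : ∀ v : Fin n, (σ.symm v : ℕ) < i → nw (cls v) < K := fun v hv =>
    h.nw_lt _ (h.cls_lt v hv)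
  -- No vertex has the key of the new class yet. The class is empty, so it may share the end of the
  -- old one.
  have hkx : ∀ v : Fin n, (σ.symm v : ℕ) < i → key v ≠ key x + 1 := fun v hv =>
    h.nw_none x v hx hv hk hnw
  refine ⟨⟨h.ord_eq, h.pos_eq, fun v hv => (h.cls_lt v hv).trans (Nat.lt_succ_self K), h.cls_iff,
    fun v v' hv hv' => ?_, fun v hv => ?_, fun c hc => ?_⟩, by omega, h.cls_old,
    fun v v' hv hv' he hn => ?_, fun v v' hv hv' he hn => ?_, fun v v' hv hv' he hn => ?_,
    fun v hv he hn => ?_, fun v v' hv hv' he he' hn heq => ?_⟩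
  · rw [hfin _ (hne v hv)]; exact h.fin_iff v v' hv hv'
  · rw [hfin _ (hne v hv)]; exact h.fin_le v hv
  -- The entry `nw K` is initialised, so that in the next refinement step all entries lie below its
  -- threshold and count as unset.
  · simp only [Function.update_apply]
    split_ifs with h1 h2
    · omega
    · omega
    · have := h.nw_lt c (by omega)
      omega
  · rcases hnw' v hv with ⟨-, h2⟩ | ⟨-, h2⟩
    · omega
    · exact h.nw_none v v' hv hv' he (h2 ▸ hn)
  · rcases hnw' v hv with ⟨h1, h2⟩ | ⟨-, h2⟩
    · rw [h2, (h.cls_iff v x hv hx).1 h1]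
      exact iff_of_false (hne v' hv') (hkx v' hv')
    · rw [h2]
      exact h.nw_cls v v' hv hv' he (h2 ▸ hn)
  · rcases hnw' v hv with ⟨h1, h2⟩ | ⟨-, h2⟩
    · rw [h2, Function.update_self, (h.cls_iff v x hv hx).1 h1, h.fin_iff x v' hx hv']
      have := hkx v' hv'
      omega
    · rw [h2, hfin _ (hnK v hv).ne]
      exact h.nw_fin v v' hv hv' he (h2 ▸ hn)
  · rcases hnw' v hv with ⟨h1, h2⟩ | ⟨-, h2⟩
    · rw [h2, Function.update_self]
      exact h.fin_le x hx
    · rw [h2, hfin _ (hnK v hv).ne]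
      exact h.nw_fin_le v hv he (h2 ▸ hn)
  · have := hnK v hv
    have := hnK v' hv'
    rcases hnw' v hv with ⟨h1, h2⟩ | ⟨h1, h2⟩ <;> rcases hnw' v' hv' with ⟨h3, h4⟩ | ⟨h3, h4⟩
    · rw [h1, h3]
    · omega
    · omega
    · rw [h2, h4] at heq
      exact h.nw_inj v v' hv hv' he he' (h2 ▸ hn) heq

theorem Refining.last_lt (h : Refining i σ key ord pos cls fin nw K K₀) {x : Fin n}
    (hx : (σ.symm x : ℕ) < i) : 0 < fin (cls x) ∧ fin (cls x) ≤ i ∧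
      (σ.symm x : ℕ) ≤ fin (cls x) - 1 := by
  have h1 := (h.fin_iff x x hx hx).2 le_rfl
  have h2 := h.fin_le x hx
  omega

/-- The vertex `x` is exchanged with the last vertex `y` of its class, and moved to the new
class. -/
theorem Refining.move (h : Refining i σ key ord pos cls fin nw K K₀) {x y : Fin n}
    (hx : (σ.symm x : ℕ) < i) (hk : key x % 2 = 0) (hnw : K₀ ≤ nw (cls x))
    (hy : (σ.symm y : ℕ) = fin (cls x) - 1) :
    Refining i (σ.trans (Equiv.swap x y)) (Function.update key x (key x + 1))
      (Function.update (Function.update ord (fin (cls x) - 1) x) (pos x) y)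
      (Function.update (Function.update pos x (fin (cls x) - 1)) y (pos x))
      (Function.update cls x (nw (cls x)))
      (Function.update fin (cls x) (fin (cls x) - 1)) nw K K₀ := by
  obtain ⟨hf0, hfi, hxy⟩ := h.last_lt hx
  have hyi : (σ.symm y : ℕ) < i := by omega
  -- The last place before the end of a class is occupied by a vertex of that class.
  have hyx : key y = key x := by
    have h1 := (h.fin_iff x y hx hyi).1 (by omega)
    have h2 := (h.fin_iff y x hyi hx).1 (by have := (h.fin_iff y y hyi hyi).2 le_rfl; omega)
    omega
  have hcy : cls y = cls x := (h.cls_iff y x hyi hx).2 hyx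
  have hinj : ∀ a b : Fin n, (σ.symm a : ℕ) = σ.symm b → a = b := fun a b hab =>
    σ.symm.injective (Fin.ext hab)
  have hsx : (σ.trans (Equiv.swap x y)).symm x = σ.symm y := by simp
  have hsy : (σ.trans (Equiv.swap x y)).symm y = σ.symm x := by simp
  have hso : ∀ v, v ≠ x → v ≠ y → (σ.trans (Equiv.swap x y)).symm v = σ.symm v := by
    intro v h1 h2
    simp [Equiv.swap_apply_of_ne_of_ne h1 h2]
  have hvi : ∀ v, ((σ.trans (Equiv.swap x y)).symm v : ℕ) < i → (σ.symm v : ℕ) < i := by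
    intro v hv
    by_cases h1 : v = x
    · rwa [h1]
    by_cases h2 : v = y
    · rwa [h2]
    rwa [hso v h1 h2] at hv
  have hkne : ∀ v, v ≠ x → Function.update key x (key x + 1) v = key v := fun v hv =>
    Function.update_of_ne hv _ _
  have hcne : ∀ v : Fin n, v ≠ x → Function.update cls x (nw (cls x)) v = cls v := fun v hv =>
    Function.update_of_ne (by simpa [Fin.val_inj] using hv) _ _
  have hkx : Function.update key x (key x + 1) x = key x + 1 := Function.update_self ..
  have hcx : Function.update cls x (nw (cls x)) x = nw (cls x) := Function.update_self ..
  have hodd : ∀ v, Function.update key x (key x + 1) v % 2 = 0 → v ≠ x ∧ key v % 2 = 0 := by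
    intro v hv
    by_cases h1 : v = x
    · subst h1; rw [hkx] at hv; omega
    · rw [hkne v h1] at hv; exact ⟨h1, hv⟩
  have hN : nw (cls x) ≠ cls x := by
    have := h.cls_old x hx hk
    omega
  have hnwc : ∀ v : Fin n, K₀ ≤ nw (cls v) → nw (cls v) ≠ cls x := by
    intro v hv
    have := h.cls_old x hx hk
    omega
  have hfne : ∀ c, c ≠ cls x → Function.update fin (cls x) (fin (cls x) - 1) c = fin c :=
    fun c hc => Function.update_of_ne hc _ _
  have hfx : Function.update fin (cls x) (fin (cls x) - 1) (cls x) = fin (cls x) - 1 :=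
    Function.update_self ..
  -- a bound that does not separate the class of `x` is not affected by the exchange
  have hpos : ∀ (f b : ℕ), (∀ v', (σ.symm v' : ℕ) < i → ((σ.symm v' : ℕ) < f ↔ key v' ≤ b)) →
      (key x ≤ b ↔ key x + 1 ≤ b) → ∀ v', (σ.symm v' : ℕ) < i →
      (((σ.trans (Equiv.swap x y)).symm v' : ℕ) < f ↔
        Function.update key x (key x + 1) v' ≤ b) := by
    intro f b hfb hb v' hv'
    by_cases h1 : v' = x
    · subst h1
      rw [hsx, hkx, hfb y hyi, hyx, hb]
    by_cases h2 : v' = y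
    · subst h2
      rw [hsy, hkne _ h1, hfb x hx, hyx]
    rw [hso v' h1 h2, hkne v' h1, hfb v' hv']
  refine ⟨⟨fun t => ?_, fun v => ?_, fun v hv => ?_, fun v v' hv hv' => ?_,
    fun v v' hv hv' => ?_, fun v hv => ?_, h.nw_lt⟩, h.le, fun v hv he => ?_,
    fun v v' hv hv' he hn => ?_, fun v v' hv hv' he hn => ?_, fun v v' hv hv' he hn => ?_,
    fun v hv he hn => ?_, fun v v' hv hv' he he' hn heq => ?_⟩
  · rw [Equiv.trans_apply, Equiv.swap_apply_def]
    by_cases h1 : σ t = x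
    · have : (t : ℕ) = pos x := by rw [h.pos_eq, ← h1]; simp
      rw [if_pos h1, this, Function.update_self]
    have h1' : (t : ℕ) ≠ pos x := by
      intro ht
      apply h1
      rw [h.pos_eq] at ht
      rw [Fin.ext ht]; simp
    rw [if_neg h1, Function.update_of_ne h1']
    by_cases h2 : σ t = y
    · have : (t : ℕ) = fin (cls x) - 1 := by rw [← hy, ← h2]; simp
      rw [if_pos h2, this, Function.update_self]
    · have h2' : (t : ℕ) ≠ fin (cls x) - 1 := by
        intro ht
        apply h2
        rw [← hy] at ht
        rw [Fin.ext ht]; simp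
      rw [if_neg h2, Function.update_of_ne h2', h.ord_eq]
  · by_cases h2 : v = y
    · subst h2
      rw [hsy, Function.update_self, h.pos_eq]
    rw [Function.update_of_ne (by simpa [Fin.val_inj] using h2)]
    by_cases h1 : v = x
    · subst h1
      rw [hsx, Function.update_self, hy]
    rw [Function.update_of_ne (by simpa [Fin.val_inj] using h1), hso v h1 h2, h.pos_eq]
  · by_cases h1 : v = x
    · subst h1
      rw [hcx]; exact h.nw_lt _ (h.cls_lt _ hx)
    · rw [hcne v h1]; exact h.cls_lt v (hvi v hv)
  · replace hv := hvi v hv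
    replace hv' := hvi v' hv'
    by_cases h1 : v = x <;> by_cases h2 : v' = x
    · rw [h1, h2]; simp
    · subst h1
      rw [hcx, hkx, hcne v' h2, hkne v' h2, eq_comm, h.nw_cls v v' hv hv' hk hnw, eq_comm]
    · subst h2
      rw [hcx, hkx, hcne v h1, hkne v h1, h.nw_cls v' v hv' hv hk hnw]
    · rw [hcne v h1, hcne v' h2, hkne v h1, hkne v' h2, h.cls_iff v v' hv hv']
  · replace hv := hvi v hv
    replace hv' := hvi v' hv'
    by_cases h1 : v = x
    · subst h1
      rw [hcx, hkx, hfne _ hN]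
      exact hpos _ _ (fun v'' hv'' => h.nw_fin v v'' hv hv'' hk hnw) (by omega) v' hv'
    rw [hcne v h1, hkne v h1]
    -- The class of `x` loses its last place, now taken by `x` with the larger key. The bounds of
    -- the other classes do not separate `x` from `y`.
    by_cases hc : cls v = cls x
    · rw [hc, hfx, (h.cls_iff v x hv hx).1 hc]
      by_cases h2 : v' = x
      · subst h2
        rw [hsx, hkx]; omega
      by_cases h3 : v' = y
      · subst h3
        have : (σ.symm x : ℕ) ≠ σ.symm v' := fun he => h2 (hinj _ _ he).symm
        rw [hsy, hkne _ h2]; omega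
      have : (σ.symm v' : ℕ) ≠ σ.symm y := fun he => h3 (hinj _ _ he)
      rw [hso v' h2 h3, hkne v' h2, ← h.fin_iff x v' hx hv']
      omega
    · rw [hfne _ hc]
      have := (h.cls_iff v x hv hx).not.1 hc
      exact hpos _ _ (fun v'' hv'' => h.fin_iff v v'' hv hv'') (by omega) v' hv'
  · replace hv := hvi v hv
    by_cases h1 : v = x
    · subst h1
      rw [hcx, hfne _ hN]; exact h.nw_fin_le v hv hk hnw
    rw [hcne v h1]
    by_cases hc : cls v = cls x
    · rw [hc, hfx]; omega
    · rw [hfne _ hc]; exact h.fin_le v hv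
  · obtain ⟨h1, h2⟩ := hodd v he
    rw [hcne v h1]
    exact h.cls_old v (hvi v hv) h2
  · obtain ⟨h1, h2⟩ := hodd v he
    replace hv := hvi v hv
    replace hv' := hvi v' hv'
    rw [hcne v h1] at hn
    rw [hkne v h1]
    by_cases h3 : v' = x
    · subst h3
      rw [hkx]
      intro heq
      rw [(h.cls_iff v v' hv hv').2 (by omega)] at hn
      omega
    · rw [hkne v' h3]
      exact h.nw_none v v' hv hv' h2 hn
  · obtain ⟨h1, h2⟩ := hodd v he
    replace hv := hvi v hv
    replace hv' := hvi v' hv'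
    rw [hcne v h1] at hn ⊢
    rw [hkne v h1]
    by_cases h3 : v' = x
    · subst h3
      rw [hkx, hcx]
      constructor
      · intro heq
        rw [(h.cls_iff v' v hv' hv).1 (h.nw_inj v' v hv' hv hk h2 hnw heq)]
      · intro heq
        rw [(h.cls_iff v v' hv hv').2 (by omega)]
    · rw [hkne v' h3, hcne v' h3]
      exact h.nw_cls v v' hv hv' h2 hn
  · obtain ⟨h1, h2⟩ := hodd v he
    replace hv := hvi v hv
    replace hv' := hvi v' hv'
    rw [hcne v h1] at hn ⊢
    rw [hkne v h1, hfne _ (hnwc v hn)]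
    exact hpos _ _ (fun v'' hv'' => h.nw_fin v v'' hv hv'' h2 hn) (by omega) v' hv'
  · obtain ⟨h1, h2⟩ := hodd v he
    replace hv := hvi v hv
    rw [hcne v h1] at hn ⊢
    rw [hfne _ (hnwc v hn)]
    exact h.nw_fin_le v hv h2 hn
  · obtain ⟨h1, h2⟩ := hodd v he
    obtain ⟨h3, h4⟩ := hodd v' he'
    rw [hcne v h1] at hn heq ⊢
    rw [hcne v' h3] at heq ⊢
    exact h.nw_inj v v' (hvi v hv) (hvi v' hv') h2 h4 hn heq

/-! ### The program for a refinement step -/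

/-- Sequential composition of a list of programs. -/
def Prog.seqs : List Prog → Prog
  | [] => .skip
  | [p] => p
  | p :: q :: l => .seq p (Prog.seqs (q :: l))

/-- Create a new class, named by register `7`, for the moved vertices of the class in
register `10`, unless there is one. -/
def createClass : Prog :=
  .ite (.lt (.get 7 (.reg 10)) (.reg 8))
    (.seqs [.put 7 (.reg 7) (.const 0), .put 7 (.reg 10) (.reg 7),
      .put 6 (.reg 7) (.get 6 (.reg 10)), .set 7 (.add (.reg 7) (.const 1))])
    .skip

/-- Move the vertex in register `9` to the end of its class and to the new class. -/
def moveVertex : Prog :=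
  .seqs [.set 11 (.sub (.get 6 (.reg 10)) (.const 1)), .set 13 (.get 3 (.reg 11)),
    .put 3 (.reg 11) (.reg 9), .put 3 (.reg 12) (.reg 13),
    .put 4 (.reg 9) (.reg 11), .put 4 (.reg 13) (.reg 12),
    .put 5 (.reg 9) (.get 7 (.reg 10)), .put 6 (.reg 10) (.reg 11)]

/-- Treat the neighbour at the address in register `5`. -/
def refineStep : Prog :=
  .seq (.seqs [.set 9 (.get 1 (.reg 5)), .set 12 (.get 4 (.reg 9)), .set 10 (.get 5 (.reg 9))])
    (.ite (.lt (.reg 12) (.reg 3)) (.seq createClass moveVertex) .skip)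

variable {w n i : ℕ} {σ : Equiv.Perm (Fin n)} {key : Fin n → ℕ}

/-- The classes in the course of a refinement step, as they are stored. -/
def RefiningAt (i : ℕ) (σ : Equiv.Perm (Fin n)) (key : Fin n → ℕ) (s : State) : Prop :=
  Refining i σ key (s.arr 3) (s.arr 4) (s.arr 5) (s.arr 6) (s.arr 7) (s.reg 7) (s.reg 8)

theorem runs_createClass {s : State} {x : Fin n} (h : RefiningAt i σ key s)
    (hx : (σ.symm x : ℕ) < i) (hk : key x % 2 = 0) (h10 : s.reg 10 = s.arr 5 x)
    (hw : s.reg 7 + 1 < 2 ^ w) :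
    Runs w createClass s 19 (fun s' => RefiningAt i σ key s' ∧
      s'.reg 8 ≤ s'.arr 7 (s'.arr 5 x) ∧ s'.reg 7 ≤ s.reg 7 + 1 ∧ s.reg 7 ≤ s'.reg 7) := by
  refine Runs.flat rfl (by decide) ?_
  have h1 : 1 % 2 ^ w = 1 := Nat.mod_eq_of_lt (by omega)
  by_cases hc : s.arr 7 (s.arr 5 x) < s.reg 8
  · have := h.create hx hk hc
    simp [createClass, Prog.seqs, Prog.den, Expr.eval, State.setReg, State.setArr, h10, hc, h1,
      RefiningAt, Nat.mod_eq_of_lt hw, this, h.le]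
  · simp [createClass, Prog.den, Expr.eval, h10, hc, h]
    omega

theorem runs_moveVertex {s : State} {x : Fin n} (h : RefiningAt i σ key s) (hi : i ≤ n)
    (hx : (σ.symm x : ℕ) < i) (hk : key x % 2 = 0) (hnw : s.reg 8 ≤ s.arr 7 (s.arr 5 x))
    (h9 : s.reg 9 = x) (h10 : s.reg 10 = s.arr 5 x) (h12 : s.reg 12 = s.arr 4 x)
    (hw : 1 < 2 ^ w) :
    Runs w moveVertex s 40 (fun s' => ∃ y : Fin n, (σ.symm y : ℕ) < i ∧
      RefiningAt i (σ.trans (Equiv.swap x y)) (Function.update key x (key x + 1)) s') := by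
  refine Runs.flat rfl (by decide) ?_
  obtain ⟨hf0, hfi, hxy⟩ := h.last_lt hx
  let t : Fin n := ⟨s.arr 6 (s.arr 5 x) - 1, by omega⟩
  have ht : s.arr 3 (s.arr 6 (s.arr 5 x) - 1) = σ t := h.ord_eq t
  have hy : (σ.symm (σ t) : ℕ) = s.arr 6 (s.arr 5 x) - 1 := by simp [t]
  refine ⟨σ t, by omega, ?_⟩
  have := h.move hx hk hnw hy
  simpa [moveVertex, Prog.seqs, Prog.den, Expr.eval, State.setReg, State.setArr, h9, h10, h12,
    Nat.mod_eq_of_lt hw, RefiningAt, ht] using this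

/-- A neighbour with number at least `i` has been visited and is left alone. Each list entry creates
at most one class, which keeps the names of the classes within a word. -/
theorem runs_refineStep {s : State} {x : Fin n} (h : RefiningAt i σ key s) (hi : i ≤ n)
    (h3 : s.reg 3 = i) (h5 : s.arr 1 (s.reg 5) = x)
    (hk : (σ.symm x : ℕ) < i → key x % 2 = 0) (hw : s.reg 7 + 1 < 2 ^ w) :
    Runs w refineStep s 80 (fun s' => (∃ σ' key', RefiningAt i σ' key' s' ∧
      (∀ t : Fin n, i ≤ t → σ' t = σ t) ∧
      (∀ v, (σ.symm v : ℕ) < i → key' v = if v = x then key v + 1 else key v)) ∧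
      s'.reg 7 ≤ s.reg 7 + 1 ∧ s.reg 7 ≤ s'.reg 7) := by
  refine Runs.seq (T₁ := 10) (T₂ := 70)
    (R := fun s' => RefiningAt i σ key s' ∧ s'.reg 3 = i ∧ s'.reg 9 = x ∧
      s'.reg 12 = s'.arr 4 x ∧ s'.reg 10 = s'.arr 5 x ∧ s'.reg 7 = s.reg 7)
    (Runs.flat rfl (by decide) ?_) ?_ le_rfl
  · simp [Prog.seqs, Prog.den, Expr.eval, State.setReg, h3, h5]
    exact h
  rintro s₁ - ⟨h, h3, h9, h12, h10, h7⟩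
  refine Runs.ite (T' := 60) (fun hb => ?_) (fun hb => ?_) (by decide)
  · have hx : (σ.symm x : ℕ) < i := by
      simpa [Expr.eval, h3, h12, h.pos_eq] using hb
    refine Runs.seq (runs_createClass h hx (hk hx) h10 (by omega)) ?_ (by decide : 19 + 40 ≤ 60)
    rintro s₂ hf ⟨h', hnw, h7', h7''⟩
    have h54 : s₂.arr 5 = s₁.arr 5 := hf.arr 5 (by decide)
    have h44 : s₂.arr 4 = s₁.arr 4 := hf.arr 4 (by decide)
    refine (runs_moveVertex h' hi hx (hk hx) hnw (by rw [hf.reg 9 (by decide), h9])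
      (by rw [hf.reg 10 (by decide), h10, h54]) (by rw [hf.reg 12 (by decide), h12, h44])
      (by omega)).mono le_rfl ?_
    rintro s₃ hf' ⟨y, hy, h''⟩
    have h73 : s₃.reg 7 = s₂.reg 7 := hf'.reg 7 (by decide)
    refine ⟨⟨_, _, h'', fun t ht => ?_, fun v hv => ?_⟩, by omega, by omega⟩
    · have h1 : σ t ≠ x := by rintro rfl; simp at hx; omega
      have h2 : σ t ≠ y := by rintro rfl; simp at hy; omega
      simp [Equiv.swap_apply_of_ne_of_ne h1 h2]
    · rw [Function.update_apply]
      split_ifs with hvx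
      · rw [hvx]
      · rfl
  · have hx : ¬ (σ.symm x : ℕ) < i := by
      simpa [Expr.eval, h3, h12, h.pos_eq] using hb
    refine Runs.flat rfl (by decide) ⟨⟨σ, key, h, fun _ _ => rfl, fun v hv => ?_⟩, ?_⟩
    · rw [if_neg]
      rintro rfl
      exact hx hv
    · simp only [Prog.den]
      omega

/-- Visit the vertex with the number in register `3`, and refine the classes with its
neighbours. -/
def visitStep : Prog :=
  .seq (.seqs [.set 4 (.get 3 (.reg 3)), .put 6 (.get 5 (.reg 4)) (.reg 3), .set 8 (.reg 7)])
    (forEdges refineStep)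

/-- Permutations that agree from position `i` on have the same vertices there, and therefore also
below `i`. -/
theorem symm_eq_of_agree {σ σ' : Equiv.Perm (Fin n)}
    (h : ∀ t : Fin n, i ≤ t → σ' t = σ t) (v : Fin n) :
    (i ≤ (σ.symm v : ℕ) → σ'.symm v = σ.symm v) ∧
      ((σ'.symm v : ℕ) < i ↔ (σ.symm v : ℕ) < i) := by
  have h1 : i ≤ (σ.symm v : ℕ) → σ'.symm v = σ.symm v := by
    intro hv
    rw [Equiv.symm_apply_eq, h _ hv, Equiv.apply_symm_apply]
  have h2 : i ≤ (σ'.symm v : ℕ) → σ.symm v = σ'.symm v := by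
    intro hv
    rw [Equiv.symm_apply_eq, ← h _ hv, Equiv.apply_symm_apply]
  refine ⟨h1, ?_⟩
  by_contra hne
  rcases Nat.lt_or_ge (σ.symm v : ℕ) i with h3 | h3 <;>
    rcases Nat.lt_or_ge (σ'.symm v : ℕ) i with h4 | h4
  · exact hne (by simp [h3, h4])
  · have := congrArg Fin.val (h2 h4); omega
  · have := congrArg Fin.val (h1 h3); omega
  · exact hne (by omega)

variable {adj : Fin n → List (Fin n)} {M : ℕ}

/-- The classes between two refinement steps, as they are stored. -/
def ClassesAt (i : ℕ) (σ : Equiv.Perm (Fin n)) (key : Fin n → ℕ) (s : State) : Prop :=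
  Classes i σ key (s.arr 3) (s.arr 4) (s.arr 5) (s.arr 6) (s.arr 7) (s.reg 7)

/-- A visit appends one binary digit to each key, namely the adjacency to the visited vertex. The
keys occur only in the proof and are never stored, so their size does not matter. -/
theorem runs_visitStep {s : State} (hin : HasInput adj M s)
    (hnd : ∀ u, (adj u).Nodup) (hi : i < n) (h : ClassesAt (i + 1) σ key s) (h3 : s.reg 3 = i)
    (hw : s.reg 7 + (adj (σ ⟨i, hi⟩)).length + n + M + 2 < 2 ^ w) :
    Runs w visitStep s ((adj (σ ⟨i, hi⟩)).length * 88 + 30) (fun s' =>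
      ∃ σ' key', ClassesAt i σ' key' s' ∧ (∀ t : Fin n, i ≤ t → σ' t = σ t) ∧
        (∀ v, (σ.symm v : ℕ) < i →
          key' v = 2 * key v + if v ∈ adj (σ ⟨i, hi⟩) then 1 else 0) ∧
        s'.reg 7 ≤ s.reg 7 + (adj (σ ⟨i, hi⟩)).length ∧ s.reg 7 ≤ s'.reg 7) := by
  set p := σ ⟨i, hi⟩ with hp
  have hord : s.arr 3 i = p := h.ord_eq ⟨i, hi⟩
  refine Runs.seq (T₁ := 18) (T₂ := (adj p).length * 88 + 12)
    (R := fun s' => RefiningAt i σ (fun v => 2 * key v) s' ∧ s'.reg 4 = p ∧ s'.reg 3 = i ∧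
      s'.reg 7 = s.reg 7)
    (Runs.flat rfl (by decide) ?_) ?_ (by omega)
  · have := h.visit hi
    simpa [Prog.seqs, Prog.den, Expr.eval, State.setReg, State.setArr, h3, hord, RefiningAt]
      using this
  rintro s₁ hf ⟨h1, h4, h3, h7⟩
  have hin₁ := hin.frame hf (by decide) (by decide) (by decide)
  refine (Runs.forEdges (T := 80)
    (I := fun D s' => (∃ σ' key', RefiningAt i σ' key' s' ∧ (∀ t : Fin n, i ≤ t → σ' t = σ t) ∧
        (∀ v, (σ.symm v : ℕ) < i → key' v = 2 * key v + if v ∈ D then 1 else 0)) ∧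
        s'.reg 7 ≤ s.reg 7 + D.card ∧ s.reg 7 ≤ s'.reg 7)
    hin₁ (hnd p) h4 (by omega) (by decide) (by decide) ?_ le_rfl ?_).mono le_rfl ?_
  · intro s' ha hr
    have e7 := hr 7 (by decide) (by decide)
    have e8 := hr 8 (by decide) (by decide)
    refine ⟨⟨σ, fun v => 2 * key v, ?_, fun _ _ => rfl, by simp⟩, by omega, by omega⟩
    unfold RefiningAt at h1 ⊢
    rw [ha, e7, e8]
    exact h1
  · rintro D v s' hvD hvu hf' hv h4' ⟨⟨σ', key', h', hσ', hkey'⟩, h7', h7''⟩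
    have hcard : D.card + 1 ≤ n := by
      rw [← Finset.card_insert_of_notMem hvD]
      simpa using Finset.card_le_univ (insert v D)
    have h3' : s'.reg 3 = i := by rw [hf'.reg 3 (by decide), h3]
    refine (runs_refineStep h' hi.le h3' hv (fun hx => ?_) (by omega)).mono le_rfl ?_
    · rw [hkey' v ((symm_eq_of_agree hσ' v).2.1 hx), if_neg hvD]
      omega
    · rintro s'' hf'' ⟨⟨σ'', key'', h2, hσ2, hkey2⟩, h72, h73⟩ e
      have e7 : (s''.setReg 5 e).reg 7 = s''.reg 7 := by simp [State.setReg]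
      rw [e7]
      refine ⟨⟨σ'', key'', ?_, fun t ht => (hσ2 t ht).trans (hσ' t ht), fun x hx => ?_⟩, ?_, ?_⟩
      · unfold RefiningAt at h2 ⊢
        simpa [State.setReg] using h2
      · rw [hkey2 x ((symm_eq_of_agree hσ' x).2.2 hx), hkey' x hx]
        by_cases hxv : x = v
        · subst hxv
          simp [hvD]
        · simp [hxv]
      · rw [Finset.card_insert_of_notMem hvD]; omega
      · omega
  · rintro s' - ⟨⟨σ', key', h', hσ', hkey'⟩, h7', h7''⟩
    refine ⟨σ', key', h'.toClasses, hσ', fun v hv => ?_, ?_, h7''⟩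
    · rw [hkey' v hv]; simp
    · have := List.toFinset_card_le (adj p)
      omega

/-! ### Correctness and running time of the search order -/

variable {w n : ℕ} {G : SimpleGraph (Fin n)} {adj : Fin n → List (Fin n)} {M : ℕ}

/-- Lexicographic comparison of the neighbourhoods of `a` and `b` among the vertices with numbers
at least `i`. -/
def FirstDiff (G : SimpleGraph (Fin n)) (σ : Equiv.Perm (Fin n)) (i : ℕ) (a b : Fin n) : Prop :=
  ∃ j : Fin n, i ≤ j ∧ G.Adj (σ j) b ∧ ¬ G.Adj (σ j) a ∧
    ∀ k : Fin n, j < k → (G.Adj (σ k) a ↔ G.Adj (σ k) b)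

/-- The keys of the vertices with numbers below `i` compare like their labels. -/
def KeysCompare (G : SimpleGraph (Fin n)) (i : ℕ) (σ : Equiv.Perm (Fin n)) (key : Fin n → ℕ) :
    Prop :=
  ∀ v v' : Fin n, (σ.symm v : ℕ) < i → (σ.symm v' : ℕ) < i →
    (key v = key v' → ∀ j : Fin n, i ≤ j → (G.Adj (σ j) v ↔ G.Adj (σ j) v')) ∧
    (key v < key v' → FirstDiff G σ i v v')

/-- The vertices with numbers from `i` on have been chosen as required. -/
def ChosenFrom (G : SimpleGraph (Fin n)) (i : ℕ) (σ : Equiv.Perm (Fin n)) : Prop :=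
  ∀ j : Fin n, i ≤ j → ∀ v, σ.symm v ≤ j →
    (∀ k : Fin n, j < k → (G.Adj (σ k) v ↔ G.Adj (σ k) (σ j))) ∨ FirstDiff G σ (j + 1) v (σ j)

theorem FirstDiff.congr {σ σ' : Equiv.Perm (Fin n)} {i i' : ℕ} (hii : i' ≤ i)
    (h : ∀ t : Fin n, i' ≤ t → σ' t = σ t) {a b : Fin n} (hd : FirstDiff G σ i a b) :
    FirstDiff G σ' i a b := by
  obtain ⟨j, hj, h1, h2, h3⟩ := hd
  refine ⟨j, hj, ?_, ?_, fun k hk => ?_⟩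
  · rwa [h j (by omega)]
  · rwa [h j (by omega)]
  · have : (j : ℕ) < k := hk
    rw [h k (by omega)]
    exact h3 k hk

/-- The new digit is the least significant one and belongs to the smallest number given so far. It
decides only between equal keys, just as in the lexicographic order of labels. -/
theorem KeysCompare.step {i : ℕ} {σ σ' : Equiv.Perm (Fin n)} {key key' : Fin n → ℕ} (hi : i < n)
    (h : KeysCompare G (i + 1) σ key) (hσ : ∀ t : Fin n, i ≤ t → σ' t = σ t)
    (hkey : ∀ v, (σ.symm v : ℕ) < i →
      (G.Adj (σ ⟨i, hi⟩) v → key' v = 2 * key v + 1) ∧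
      (¬ G.Adj (σ ⟨i, hi⟩) v → key' v = 2 * key v)) :
    KeysCompare G i σ' key' := by
  intro v v' hv hv'
  rw [(symm_eq_of_agree hσ v).2] at hv
  rw [(symm_eq_of_agree hσ v').2] at hv'
  obtain ⟨h1, h2⟩ := h v v' (by omega) (by omega)
  have hv1 := hkey v hv
  have hv2 := hkey v' hv'
  constructor
  · intro heq j hj
    rw [hσ j hj]
    have hk : key v = key v' ∧ (G.Adj (σ ⟨i, hi⟩) v ↔ G.Adj (σ ⟨i, hi⟩) v') := by
      by_cases ha : G.Adj (σ ⟨i, hi⟩) v <;> by_cases hb : G.Adj (σ ⟨i, hi⟩) v' <;>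
        simp only [ha, hb, true_imp_iff, not_true_eq_false, false_imp_iff, not_false_eq_true,
          and_true, true_and, iff_true, iff_false] at hv1 hv2 ⊢ <;> omega
    rcases hj.eq_or_lt with h3 | h3
    · obtain rfl : j = ⟨i, hi⟩ := Fin.ext h3.symm
      exact hk.2
    · exact h1 hk.1 j h3
  · intro hlt
    refine FirstDiff.congr le_rfl hσ ?_
    have hk : key v < key v' ∨ (key v = key v' ∧ ¬ G.Adj (σ ⟨i, hi⟩) v ∧
        G.Adj (σ ⟨i, hi⟩) v') := by
      by_cases ha : G.Adj (σ ⟨i, hi⟩) v <;> by_cases hb : G.Adj (σ ⟨i, hi⟩) v' <;>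
        simp only [ha, hb, true_imp_iff, not_true_eq_false, false_imp_iff, not_false_eq_true,
          and_true, true_and, and_false, or_false] at hv1 hv2 ⊢ <;> omega
    rcases hk with hk | ⟨hk, ha, hb⟩
    · obtain ⟨j, hj, h3⟩ := h2 hk
      exact ⟨j, by omega, h3⟩
    · exact ⟨⟨i, hi⟩, le_rfl, hb, ha, fun k hk' => h1 hk k hk'⟩

/-- The vertex at position `i` has the largest key among the unvisited ones. Earlier choices remain
valid, because refinement permutes only positions below `i`. -/
theorem ChosenFrom.step {i : ℕ} {σ σ' : Equiv.Perm (Fin n)} {key : Fin n → ℕ} (hi : i < n)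
    (h : ChosenFrom G (i + 1) σ) (hσ : ∀ t : Fin n, i ≤ t → σ' t = σ t)
    (hk : KeysCompare G (i + 1) σ key) (hmax : ∀ v, (σ.symm v : ℕ) ≤ i → key v ≤ key (σ ⟨i, hi⟩)) :
    ChosenFrom G i σ' := by
  intro j hj v hv
  have hvσ : σ.symm v ≤ j := by
    have h1 := symm_eq_of_agree hσ v
    by_contra hcon
    have h2 : (j : ℕ) < σ.symm v := not_le.1 hcon
    rw [h1.1 (by omega)] at hv
    exact hcon hv
  rw [hσ j hj]
  have key' : (∀ k : Fin n, j < k → (G.Adj (σ k) v ↔ G.Adj (σ k) (σ j))) ∨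
      FirstDiff G σ (j + 1) v (σ j) := by
    rcases hj.eq_or_lt with h3 | h3
    · obtain rfl : j = ⟨i, hi⟩ := Fin.ext h3.symm
      have hv' : (σ.symm v : ℕ) ≤ i := hvσ
      obtain ⟨h4, h5⟩ := hk v (σ ⟨i, hi⟩) (by omega) (by simp)
      rcases (hmax v hv').eq_or_lt with h6 | h6
      · exact Or.inl fun k hk' => h4 h6 k hk'
      · exact Or.inr (h5 h6)
    · exact h j h3 v hvσ
  rcases key' with h4 | h4
  · refine Or.inl fun k hk' => ?_
    have : (j : ℕ) < k := hk'
    rw [hσ k (by omega)]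
    exact h4 k hk'
  · exact Or.inr (h4.congr (Nat.le_succ_of_le hj) hσ)

/-- Start the search from the vertex in register `2`: all vertices form a single class. -/
def startOrder : Prog :=
  .seq (.set 3 (.const 0)) (.seq
    (forUp 3 0 (.seqs [.put 3 (.reg 3) (.reg 3), .put 4 (.reg 3) (.reg 3),
      .put 5 (.reg 3) (.const 0)]))
    (.seqs [.set 7 (.const 1), .put 6 (.const 0) (.reg 0), .put 7 (.const 0) (.const 0),
      .set 12 (.sub (.reg 0) (.const 1)), .put 3 (.reg 12) (.reg 2), .put 3 (.reg 2) (.reg 12),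
      .put 4 (.reg 2) (.reg 12), .put 4 (.reg 12) (.reg 2)]))

theorem runs_startOrder {s : State} (hn : s.reg 0 = n) {u : Fin n} (hu : s.reg 2 = u)
    (hw : n + 1 < 2 ^ w) :
    Runs w startOrder s (n * 20 + 40) (fun s' => ∃ σ : Equiv.Perm (Fin n),
      ClassesAt n σ (fun _ => 0) s' ∧ (σ.symm u : ℕ) + 1 = n ∧ s'.reg 7 = 1) := by
  have hun := u.isLt
  have h1w : 1 % 2 ^ w = 1 := Nat.mod_eq_of_lt (by omega)
  refine Runs.seq (T₁ := 2) (T₂ := n * 20 + 38) (R := fun s' => s'.reg 3 = 0)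
    (Runs.flat rfl (by decide) (by simp [Prog.den, Expr.eval, State.setReg])) ?_ (by omega)
  intro s₁ hf₁ h3
  have h0 : s₁.reg 0 = n := by rw [hf₁.reg 0 (by decide), hn]
  refine Runs.seq (T₁ := n * 20 + 4) (T₂ := 34) (Runs.forUp (T := fun _ => 12)
    (I := fun i s' => ∀ t < i, s'.arr 3 t = t ∧ s'.arr 4 t = t ∧ s'.arr 5 t = 0)
    h3 h0 (Nat.zero_le _) (by omega) (by decide) (by decide) (by decide) (by simp)
    (by simp) ?_) ?_ (by omega)
  · intro i s' _ hi hf h3 h0 hI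
    refine Runs.flat rfl (by decide) ?_
    intro t ht
    simp only [Prog.seqs, Prog.den, Expr.eval, State.setReg, State.setArr, h3, Function.update_self,
      Nat.zero_mod]
    by_cases hti : t = i
    · subst hti
      simp
    · have := hI t (by omega)
      simp [hti, this]
  · rintro s₂ hf₂ ⟨hI, -⟩
    have h0' : s₂.reg 0 = n := by rw [hf₂.reg 0 (by decide), h0]
    have h2' : s₂.reg 2 = u := by rw [hf₂.reg 2 (by decide), hf₁.reg 2 (by decide), hu]
    refine Runs.flat rfl (by decide) ?_
    let l : Fin n := ⟨n - 1, by omega⟩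
    -- The start is exchanged with the last vertex, since the largest number is given first.
    refine ⟨Equiv.swap l u, ?_, by simp [l]; omega, ?_⟩
    · simp only [Prog.seqs, Prog.den, Expr.eval, State.setReg, State.setArr, ClassesAt]
      simp [h0', h2', h1w]
      have hl : ∀ t : Fin n, (t : ℕ) = n - 1 ↔ t = l := fun t => by simp [Fin.ext_iff, l]
      constructor
      · intro t
        rw [Equiv.swap_apply_def]
        by_cases h1 : t = u
        · subst h1
          by_cases h2 : t = l
          · simp [h2, l]
          · simp [h2, l]
        · by_cases h2 : t = l
          · subst h2
            simp [Function.update_of_ne (show (l : ℕ) ≠ u from fun h => h1 (Fin.ext h)), l]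
          · have h4 : (t : ℕ) ≠ n - 1 := fun h => h2 ((hl t).1 h)
            have h5 : (t : ℕ) ≠ u := fun h => h1 (Fin.ext h)
            simp [h1, h2, h4, h5, (hI t t.isLt).1]
      · intro t
        rw [Equiv.symm_swap, Equiv.swap_apply_def]
        by_cases h2 : t = l
        · subst h2
          simp [l]
        · have h4 : (t : ℕ) ≠ n - 1 := fun h => h2 ((hl t).1 h)
          by_cases h1 : t = u
          · subst h1
            simp [h2, h4, l]
          · have h5 : (t : ℕ) ≠ u := fun h => h1 (Fin.ext h)
            simp [h1, h2, h4, h5, (hI t t.isLt).2.1]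
      · intro v _
        simp [(hI v v.isLt).2.2]
      · intro v v' _ _
        simp [(hI v v.isLt).2.2, (hI v' v'.isLt).2.2]
      · intro v v' _ _
        simp [(hI v v.isLt).2.2]
      · intro v _
        simp [(hI v v.isLt).2.2]
      · intro c hc
        obtain rfl : c = 0 := by omega
        simp
    · simp [Prog.seqs, Prog.den, Expr.eval, State.setReg, State.setArr, h1w]

/-- The order of a lexicographic breadth-first search from the vertex in register `2`. -/
def orderProg : Prog :=
  .seq startOrder (.seq (.set 3 (.reg 0)) (forDown 3 visitStep))

theorem sum_below_succ {i : ℕ} (hi : i < n) (σ : Equiv.Perm (Fin n)) (f : Fin n → ℕ) :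
    ∑ v ∈ Finset.univ.filter (fun v => (σ.symm v : ℕ) < i + 1), f v =
      f (σ ⟨i, hi⟩) + ∑ v ∈ Finset.univ.filter (fun v => (σ.symm v : ℕ) < i), f v := by
  have : Finset.univ.filter (fun v => (σ.symm v : ℕ) < i + 1) =
      insert (σ ⟨i, hi⟩) (Finset.univ.filter (fun v => (σ.symm v : ℕ) < i)) := by
    ext v
    simp only [Finset.mem_filter, Finset.mem_univ, true_and, Finset.mem_insert]
    constructor
    · intro h
      by_cases h' : (σ.symm v : ℕ) = i
      · left
        rw [← Equiv.symm_apply_eq]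
        exact Fin.ext h'
      · right; omega
    · rintro (rfl | h)
      · simp
      · omega
  rw [this, Finset.sum_insert (by simp)]

theorem runs_orderProg {s : State} (hin : HasInput adj M s) (hrep : Represents adj G)
    (hsum : ∑ u, (adj u).length = M) {u : Fin n} (hu : s.reg 2 = u)
    (hw : 2 * (n + M + 2) < 2 ^ w) :
    Runs w orderProg s (n * 60 + M * 88 + 60) (fun s' => ∃ σ : Equiv.Perm (Fin n),
      (∀ t : Fin n, s'.arr 3 t = σ t) ∧ (σ.symm u : ℕ) + 1 = n ∧ ChosenFrom G 0 σ) := by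
  have hun := u.isLt
  refine Runs.seq (runs_startOrder hin.num hu (by omega)) ?_
    (by omega : n * 20 + 40 + (n * 36 + M * 88 + 10) ≤ _)
  rintro s₁ hf₁ ⟨σ₁, hσ₁, hu₁, h7⟩
  refine Runs.seq (T₁ := 2) (T₂ := n * 36 + M * 88 + 2)
    (R := fun s' => ClassesAt n σ₁ (fun _ => 0) s' ∧ s'.reg 7 = 1 ∧ s'.reg 3 = n)
    (Runs.flat rfl (by decide) ?_) ?_ (by omega)
  · have : s₁.reg 0 = n := by rw [hf₁.reg 0 (by decide), hin.num]
    simp [Prog.den, Expr.eval, State.setReg, h7, this]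
    exact hσ₁
  rintro s₂ hf₂ ⟨hσ₂, h7₂, h3₂⟩
  have hin₂ := (hin.frame hf₁ (by decide) (by decide) (by decide)).frame hf₂ (by decide)
    (by decide) (by decide)
  -- The number `E` of list entries of unvisited vertices controls both the time left and the names
  -- of classes: each entry creates at most one class, so the names stay within `M + 1`.
  refine (Runs.forDown_budget (β₀ := n * 36 + M * 88) (I := fun i β s' =>
    ∃ σ key, ClassesAt i σ key s' ∧ KeysCompare G i σ key ∧ ChosenFrom G i σ ∧
      (σ.symm u : ℕ) + 1 = n ∧ 0 < s'.reg 7 ∧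
      ∃ E, E = ∑ v ∈ Finset.univ.filter (fun v => (σ.symm v : ℕ) < i), (adj v).length ∧
        β = i * 36 + E * 88 ∧ s'.reg 7 + E ≤ M + 1) h3₂ (by omega) (by decide) ?_ ?_).mono
    le_rfl ?_
  · refine ⟨σ₁, fun _ => 0, hσ₂, ?_, ?_, hu₁, by omega, M, ?_, rfl, by omega⟩
    · intro v v' _ _
      refine ⟨fun _ j hj => ?_, fun h => absurd h (by simp)⟩
      have := j.isLt
      omega
    · intro j hj
      have := j.isLt
      omega
    · rw [← hsum]
      refine (Finset.sum_congr ?_ fun _ _ => rfl)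
      ext v; simp
  · rintro i β s' hi hf h3 ⟨σ, key, hcls, hkey, hch, huσ, h7', E, hE, rfl, hEK⟩
    have hin' := hin₂.frame hf (by decide) (by decide) (by decide)
    have hcls' : ClassesAt (i + 1) σ key s' := by
      simpa [ClassesAt, State.setReg] using hcls
    have e7 : (s'.setReg 3 (i + 1)).reg 7 = s'.reg 7 := by simp [State.setReg]
    rw [e7] at h7' hEK
    rw [sum_below_succ hi] at hE
    refine ⟨_, i * 36 + (∑ v ∈ Finset.univ.filter (fun v => (σ.symm v : ℕ) < i),
      (adj v).length) * 88, ?_, (runs_visitStep hin' (fun v => (hrep v).1) hi hcls' h3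
      (by omega)).mono le_rfl ?_⟩
    · rw [hE, add_mul]; omega
    · rintro s'' - ⟨σ', key', hc, hσ', hkey', hle, hge⟩
      have hadj : ∀ v, v ∈ adj (σ ⟨i, hi⟩) ↔ G.Adj (σ ⟨i, hi⟩) v := fun v => (hrep _).2 v
      have hsymm := fun v => symm_eq_of_agree hσ' v
      refine ⟨σ', key', hc, hkey.step hi hσ' fun v hv => ?_, hch.step hi hσ' hkey
        (hcls'.key_le_last hi), ?_, by omega, _, rfl, ?_, ?_⟩
      · rw [hkey' v hv, ← hadj]
        exact ⟨fun h => by rw [if_pos h], fun h => by rw [if_neg h, Nat.add_zero]⟩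
      · rw [(hsymm u).1 (by omega), huσ]
      · simp only [(hsymm _).2]
      · simp only [(hsymm _).2]
        omega
  · rintro s' - ⟨β, ⟨σ, key, hcls, -, hch, huσ, -⟩, -⟩
    exact ⟨σ, hcls.ord_eq, huσ, hch⟩

/-- A permutation as a numbering. -/
def numbering (σ : Equiv.Perm (Fin n)) : Fin (Fintype.card (Fin n)) ≃ Fin n :=
  (finCongr (Fintype.card_fin n)).trans σ

theorem numbering_symm_val (σ : Equiv.Perm (Fin n)) (v : Fin n) :
    ((numbering σ).symm v : ℕ) = σ.symm v := by
  simp [numbering]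

theorem ChosenFrom.isLexBFS {σ : Equiv.Perm (Fin n)} {u : Fin n} (hu : (σ.symm u : ℕ) + 1 = n)
    (h : ChosenFrom G 0 σ) : ATGraph.IsLexBFS G u (numbering σ) := by
  have hval : ∀ j, numbering σ j = σ (finCongr (Fintype.card_fin n) j) := fun j => rfl
  refine ⟨by rw [numbering_symm_val, hu, Fintype.card_fin], fun i v hv => ?_⟩
  refine ATGraph.label_le_of_nbrLE ?_
  rcases h (finCongr (Fintype.card_fin n) i) (Nat.zero_le _) v
    (by rw [Fin.le_def, ← numbering_symm_val]; exact hv) with h1 | ⟨j, hj, h1, h2, h3⟩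
  · exact Or.inl fun j hj => h1 _ hj
  · refine Or.inr ⟨(finCongr (Fintype.card_fin n)).symm j, ?_, by simpa [hval] using h1,
      by simpa [hval] using h2, fun k hk => h3 _ ?_⟩
    · rw [Fin.lt_def]; simpa using hj
    · rw [Fin.lt_def] at hk ⊢; simpa using hk

/-! ### Distances from the first visited vertex -/

variable {w n : ℕ} {G : SimpleGraph (Fin n)} {adj : Fin n → List (Fin n)} {M : ℕ}

theorem dist_lt_card (hG : G.Connected) (u v : Fin n) : G.dist u v < n := by
  obtain ⟨p, hp, hl⟩ := hG.exists_path_of_dist u v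
  have := hp.length_lt
  rw [Fintype.card_fin] at this
  omega

/-- The first visited neighbour of each vertex. -/
def parentProg : Prog :=
  .seq (.set 3 (.const 0)) (forUp 3 0 (.seq (.set 4 (.get 3 (.reg 3)))
    (forEdges (.put 8 (.get 1 (.reg 5)) (.reg 4)))))

/-- The vertices are treated by increasing number and overwrite the entries of their neighbours, so
the largest number, that is, the first visited neighbour, remains. -/
theorem runs_parentProg {s : State} (hin : HasInput adj M s) (hrep : Represents adj G)
    (hsum : ∑ u, (adj u).length = M) {σ : Equiv.Perm (Fin n)}
    (hσ : ∀ t : Fin n, s.arr 3 t = σ t) (hw : n + M + 1 < 2 ^ w) :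
    Runs w parentProg s (n * 40 + M * 12 + 10) (fun s' => ∀ v t : Fin n, G.Adj (σ t) v →
      (∀ t' : Fin n, t < t' → ¬ G.Adj (σ t') v) → s'.arr 8 v = σ t) := by
  refine Runs.seq (T₁ := 2) (T₂ := n * 40 + M * 12 + 4) (R := fun s' => s'.reg 3 = 0)
    (Runs.flat rfl (by decide) (by simp [Prog.den, Expr.eval, State.setReg])) ?_ (by omega)
  intro s₁ hf₁ h3
  have hin₁ := hin.frame hf₁ (by decide) (by decide) (by decide)
  refine (Runs.forUp (T := fun i => (if h : i < n then (adj (σ ⟨i, h⟩)).length * 12 else 0) + 15)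
    (I := fun i s' => ∀ v t : Fin n, (t : ℕ) < i → G.Adj (σ t) v →
      (∀ t' : Fin n, t < t' → (t' : ℕ) < i → ¬ G.Adj (σ t') v) → s'.arr 8 v = σ t)
    h3 hin₁.num (Nat.zero_le _) (by omega) (by decide) (by decide) (by decide)
    (fun v t ht => absurd ht (Nat.not_lt_zero _)) ?_ ?_).mono le_rfl ?_
  · have h1 : ∑ i ∈ Finset.range n, (if h : i < n then (adj (σ ⟨i, h⟩)).length * 12 else 0) =
        M * 12 := by
      rw [← Fin.sum_univ_eq_sum_range (fun i => if h : i < n then (adj (σ ⟨i, h⟩)).length * 12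
        else 0)]
      simp only [Fin.is_lt, dite_true, Fin.eta]
      rw [Equiv.sum_comp σ fun v => (adj v).length * 12, ← Finset.sum_mul, hsum]
    rw [Nat.Ico_zero_eq_range, Finset.sum_add_distrib, Finset.sum_add_distrib, h1]
    simp
    omega
  · intro i s₂ _ hi hf₂ h3₂ h0₂ hI
    have hin₂ := hin₁.frame hf₂ (by decide) (by decide) (by decide)
    have hσ₂ : s₂.arr 3 i = σ ⟨i, hi⟩ := by
      rw [hf₂.arr 3 (by decide), hf₁.arr 3 (by decide)]; exact hσ ⟨i, hi⟩
    refine Runs.seq (T₁ := 3) (T₂ := (adj (σ ⟨i, hi⟩)).length * 12 + 12)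
      (R := fun s' => s'.reg 4 = σ ⟨i, hi⟩)
      (Runs.flat rfl (by decide) ?_) ?_ (by simp only [hi, dite_true]; omega)
    · simp [Prog.den, Expr.eval, State.setReg, h3₂, hσ₂]
    intro s₃ hf₃ h4
    have h8 : s₃.arr 8 = s₂.arr 8 := hf₃.arr 8 (by decide)
    refine (Runs.forEdges (T := 4) (I := fun D s' => ∀ v : Fin n, s'.arr 8 v =
        if v ∈ D then (σ ⟨i, hi⟩ : ℕ) else s₂.arr 8 v)
      (hin₂.frame hf₃ (by decide) (by decide) (by decide)) (hrep _).1 h4 (by omega) (by decide)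
      (by decide) (fun s' ha _ v => by rw [ha, h8]; simp) le_rfl ?_).mono le_rfl ?_
    · intro D v s₄ _ _ _ hv h4' hI'
      refine Runs.flat rfl (by decide) fun e x => ?_
      simp only [Prog.den, Expr.eval, State.setArr, State.setReg, hv, h4', Function.update_self]
      by_cases hx : x = v
      · subst hx
        simp
      · rw [Function.update_of_ne (by simpa [Fin.val_inj] using hx), hI' x]
        simp [hx]
    · intro s₅ _ h5 v t ht hadj hlast
      have e8 : (s₅.setReg 3 (i + 1)).arr 8 = s₅.arr 8 := rfl
      rw [e8, h5 v]
      have hmem : v ∈ (adj (σ ⟨i, hi⟩)).toFinset ↔ G.Adj (σ ⟨i, hi⟩) v := by simp [(hrep _).2]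
      rcases Nat.lt_succ_iff_lt_or_eq.1 ht with hti | hti
      · rw [if_neg, hI v t hti hadj fun t' h1 h2 => hlast t' h1 (by omega)]
        rw [hmem]
        exact hlast ⟨i, hi⟩ hti (Nat.lt_succ_self i)
      · obtain rfl : t = ⟨i, hi⟩ := Fin.ext hti
        rw [if_pos (hmem.2 hadj)]
  · rintro s' - ⟨h, -⟩ v t hadj hlast
    exact h v t t.isLt hadj fun t' h1 _ => hlast t' h1

/-- The distances from the first visited vertex. -/
def distProg : Prog :=
  .seq (.set 3 (.reg 0)) (forDown 3 (.seq (.set 4 (.get 3 (.reg 3)))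
    (.ite (.lt (.add (.reg 3) (.const 1)) (.reg 0))
      (.put 9 (.reg 4) (.add (.get 9 (.get 8 (.reg 4))) (.const 1)))
      (.put 9 (.reg 4) (.const 0)))))

/-- The distance of a vertex exceeds that of its first visited neighbour by one. -/
theorem exists_parent (hG : G.Connected) {σ : Equiv.Perm (Fin n)} {u p : Fin n}
    (hu : (σ.symm u : ℕ) + 1 = n) (hσ : ChosenFrom G 0 σ) (hp : p ≠ u) :
    ∃ t : Fin n, σ.symm p < t ∧ G.Adj (σ t) p ∧ (∀ t', t < t' → ¬ G.Adj (σ t') p) ∧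
      G.dist u p = G.dist u (σ t) + 1 := by
  classical
  have hlex := hσ.isLexBFS hu
  have hmono : ∀ a b : Fin n, σ.symm b ≤ σ.symm a → G.dist u a ≤ G.dist u b := fun a b hab =>
    hlex.dist_le hG (by rw [Fin.le_def, numbering_symm_val, numbering_symm_val]; exact hab)
  obtain ⟨c, hcp, hc⟩ := ATGraph.exists_adj_dist hG hp
  obtain ⟨t, ht, hmax⟩ := (Finset.univ.filter fun t => G.Adj (σ t) p).exists_max_image id
    ⟨σ.symm c, by simpa using hcp⟩
  simp only [Finset.mem_filter, Finset.mem_univ, true_and, id] at ht hmax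
  have hct : σ.symm c ≤ t := hmax _ (by simpa using hcp)
  have hpc : σ.symm p < σ.symm c := by
    by_contra hcon
    have := hmono p c (not_lt.1 hcon)
    omega
  refine ⟨t, hpc.trans_le hct, ht, fun t' h1 h2 => absurd (hmax t' h2) (not_le.2 h1), ?_⟩
  -- The neighbour `σ t` is visited no later than `c`, hence is no farther from `u`; the triangle
  -- inequality gives the converse.
  have h1 := hmono (σ t) c (by simpa using hct)
  have h2 := hG.dist_triangle (u := u) (v := σ t) (w := p)
  rw [SimpleGraph.dist_eq_one_iff_adj.2 ht] at h2
  omega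

theorem runs_distProg (hG : G.Connected) {s : State} (hn : s.reg 0 = n)
    {σ : Equiv.Perm (Fin n)} {u : Fin n} (hu : (σ.symm u : ℕ) + 1 = n) (hch : ChosenFrom G 0 σ)
    (hσ : ∀ t : Fin n, s.arr 3 t = σ t)
    (hpar : ∀ v t : Fin n, G.Adj (σ t) v → (∀ t' : Fin n, t < t' → ¬ G.Adj (σ t') v) →
      s.arr 8 v = σ t) (hw : n + 1 < 2 ^ w) :
    Runs w distProg s (n * 30 + 10) (fun s' => ∀ v : Fin n, s'.arr 9 v = G.dist u v) := by
  have h1w : 1 % 2 ^ w = 1 := Nat.mod_eq_of_lt (by omega)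
  refine Runs.seq (T₁ := 2) (T₂ := n * 30 + 2) (R := fun s' => s'.reg 3 = n)
    (Runs.flat rfl (by decide) (by simp [Prog.den, Expr.eval, State.setReg, hn])) ?_ (by omega)
  intro s₁ hf₁ h3
  refine (Runs.forDown_budget (β₀ := n * 30) (I := fun i β s' => β = i * 30 ∧
    ∀ v : Fin n, i ≤ (σ.symm v : ℕ) → s'.arr 9 v = G.dist u v) h3 (by omega) (by decide)
    ⟨rfl, fun v hv => absurd (σ.symm v).isLt (by omega)⟩ ?_).mono le_rfl ?_
  · rintro i _ s₂ hi hf₂ h3₂ ⟨rfl, hI⟩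
    refine ⟨22, i * 30, by omega, ?_⟩
    have h0₂ : s₂.reg 0 = n := by rw [hf₂.reg 0 (by decide), hf₁.reg 0 (by decide), hn]
    have hσ₂ : s₂.arr 3 i = σ ⟨i, hi⟩ := by
      rw [hf₂.arr 3 (by decide), hf₁.arr 3 (by decide)]; exact hσ ⟨i, hi⟩
    have h8 : s₂.arr 8 = s.arr 8 := by rw [hf₂.arr 8 (by decide), hf₁.arr 8 (by decide)]
    set p := σ ⟨i, hi⟩ with hp
    refine Runs.flat rfl (by decide) ⟨rfl, fun v hv => ?_⟩
    have hi1 : (i + 1) % 2 ^ w = i + 1 := Nat.mod_eq_of_lt (by omega)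
    -- Only the start has the number `n - 1`. Any other vertex has a first visited neighbour with a
    -- larger number, whose distance is already stored.
    by_cases hlast : i + 1 < n
    · have hpu : p ≠ u := by
        intro h
        have : (σ.symm p : ℕ) = i := by simp [hp]
        rw [h] at this
        omega
      obtain ⟨t, h1, h2, h3, h4⟩ := exists_parent hG hu hch hpu
      have h5 := hpar p t h2 h3
      have h6 := hI (σ t) (by
        have : (σ.symm p : ℕ) = i := by simp [hp]
        have h7 : (σ.symm p : ℕ) < t := h1
        simp; omega)
      have e9 : (s₂.setReg 3 (i + 1)).arr 9 = s₂.arr 9 := rfl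
      rw [e9] at h6
      have h7 := dist_lt_card hG u p
      have h8' : (G.dist u (σ t) + 1) % 2 ^ w = G.dist u p := by
        rw [Nat.mod_eq_of_lt (by omega), h4]
      simp only [Prog.den, Expr.eval, State.setArr, State.setReg, h3₂, hσ₂]
      simp only [ne_eq, Nat.reduceEqDiff, not_false_eq_true,
        Function.update_of_ne, Function.update_self, h3₂, h1w, hi1, h0₂, hlast, if_true,
        one_ne_zero, if_false, h8, h5, h6, h8', OfNat.zero_ne_ofNat]
      by_cases hvp : v = p
      · rw [hvp, Function.update_self]
      · rw [Function.update_of_ne (by simpa [Fin.val_inj] using hvp)]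
        refine hI v ?_
        rcases hv.eq_or_lt with h | h
        · exact absurd (by rw [hp, ← Equiv.symm_apply_eq]; exact Fin.ext h.symm) hvp
        · exact h
    · have hpu : p = u := by
        rw [hp, ← Equiv.eq_symm_apply]
        apply Fin.ext
        simp only
        omega
      simp only [Prog.den, Expr.eval, State.setArr, State.setReg, h3₂, hσ₂]
      simp only [ne_eq, Nat.reduceEqDiff, not_false_eq_true,
        Function.update_of_ne, Function.update_self, h3₂, h1w, hi1, h0₂, hlast, if_true,
        if_false, Nat.zero_mod, OfNat.zero_ne_ofNat]
      by_cases hvp : v = p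
      · rw [hvp, Function.update_self, hpu, SimpleGraph.dist_self]
      · rw [Function.update_of_ne (by simpa [Fin.val_inj] using hvp)]
        refine hI v ?_
        rcases hv.eq_or_lt with h | h
        · exact absurd (by rw [hp, ← Equiv.symm_apply_eq]; exact Fin.ext h.symm) hvp
        · exact h
  · rintro s' - ⟨β, ⟨-, h⟩, -⟩ v
    exact h v (Nat.zero_le _)

/-- Lexicographic breadth-first search from the vertex in register `2`: array `3` receives the
order and array `9` the distances. -/
def searchProg : Prog := .seq orderProg (.seq parentProg distProg)

theorem runs_searchProg (hG : G.Connected) {s : State} (hin : HasInput adj M s)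
    (hrep : Represents adj G) (hsum : ∑ u, (adj u).length = M) {u : Fin n} (hu : s.reg 2 = u)
    (hw : 2 * (n + M + 2) < 2 ^ w) :
    Runs w searchProg s (n * 130 + M * 100 + 80) (fun s' => ∃ σ : Equiv.Perm (Fin n),
      (∀ t : Fin n, s'.arr 3 t = σ t) ∧ ATGraph.IsLexBFS G u (numbering σ) ∧
        ∀ v : Fin n, s'.arr 9 v = G.dist u v) := by
  refine Runs.seq (T₂ := n * 70 + M * 12 + 20) (runs_orderProg hin hrep hsum hu hw) ?_ (by omega)
  rintro s₁ hf₁ ⟨σ, hσ, huσ, hch⟩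
  have hin₁ := hin.frame hf₁ (by decide) (by decide) (by decide)
  refine Runs.seq (T₂ := n * 30 + 10) (runs_parentProg hin₁ hrep hsum hσ (by omega)) ?_ (by omega)
  intro s₂ hf₂ hpar
  have hσ₂ : ∀ t : Fin n, s₂.arr 3 t = σ t := by
    rw [hf₂.arr 3 (by decide)]; exact hσ
  refine (runs_distProg hG (by rw [hf₂.reg 0 (by decide), hin₁.num]) huσ hch hσ₂ hpar
    (by omega)).mono le_rfl ?_
  intro s₃ hf₃ hd
  refine ⟨σ, ?_, hch.isLexBFS huσ, hd⟩
  rw [hf₃.arr 3 (by decide)]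
  exact hσ₂

/-! ### The scan by counting kept neighbours -/

variable {w n : ℕ} {G : SimpleGraph (Fin n)} {adj : Fin n → List (Fin n)} {M : ℕ}

/-- Append the vertex in register `4` to the list in array `11`, and count it at its
neighbours. -/
def keepVertex : Prog :=
  .seq (.seqs [.put 11 (.reg 16) (.reg 4), .set 16 (.add (.reg 16) (.const 1)),
    .set 15 (.add (.reg 15) (.const 1))])
    (forEdges (.put 12 (.get 1 (.reg 5)) (.add (.get 12 (.get 1 (.reg 5))) (.const 1))))

/-- Scan the vertices that satisfy `b` by increasing number in the order in array `o`. -/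
def scanProg (o : ℕ) (b : Expr) : Prog :=
  .seq (.seqs [.set 15 (.const 0), .set 3 (.const 0)]) (.seq
    (forUp 3 0 (.put 12 (.reg 3) (.const 0))) (.seq (.set 3 (.const 0))
      (forUp 3 0 (.seq (.set 4 (.get o (.reg 3)))
        (.ite b (.ite (.eq (.get 12 (.reg 4)) (.reg 15)) keepVertex .skip) .skip)))))

/-- The list in array `11`, of the length in register `16`, consists of the elements of `X`. -/
def Listed (X : Finset (Fin n)) (s : State) : Prop :=
  (∀ q < s.reg 16, ∃ x ∈ X, s.arr 11 q = x) ∧ ∀ x ∈ X, ∃ q < s.reg 16, s.arr 11 q = x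

open Classical in
/-- The vertices of `S` that remain to be scanned from number `i` on. -/
noncomputable def toScan (σ : Equiv.Perm (Fin n)) (S : Set (Fin n)) (i : ℕ) : List (Fin n) :=
  (((List.finRange n).drop i).map σ).filter (fun v => v ∈ S)

theorem toScan_step (σ : Equiv.Perm (Fin n)) (S : Set (Fin n)) {i : ℕ} (hi : i < n) :
    (σ ⟨i, hi⟩ ∈ S → toScan σ S i = σ ⟨i, hi⟩ :: toScan σ S (i + 1)) ∧
      (σ ⟨i, hi⟩ ∉ S → toScan σ S i = toScan σ S (i + 1)) := by
  have : (List.finRange n).drop i = ⟨i, hi⟩ :: (List.finRange n).drop (i + 1) := by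
    rw [List.drop_eq_getElem_cons (by simpa using hi)]
    simp
  unfold toScan
  rw [this, List.map_cons]
  exact ⟨fun h => by rw [List.filter_cons_of_pos (by simpa using h)],
    fun h => by rw [List.filter_cons_of_neg (by simpa using h)]⟩

theorem map_finCongr_finRange {N n : ℕ} (h : N = n) :
    (List.finRange N).map (finCongr h) = List.finRange n := by
  subst h
  simp

theorem scanClique_numbering (G : SimpleGraph (Fin n)) (σ : Equiv.Perm (Fin n))
    (S : Set (Fin n)) :
    ATGraph.scanClique G (numbering σ) S = (ATGraph.scan G [] (toScan σ S 0)).toFinset := by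
  have : (List.finRange (Fintype.card (Fin n))).map (numbering σ) = (List.finRange n).map σ := by
    rw [← map_finCongr_finRange (Fintype.card_fin n), List.map_map]
    rfl
  unfold ATGraph.scanClique toScan
  rw [this, List.drop_zero]
  congr!

theorem scan_nodup (G : SimpleGraph (Fin n)) (l : List (Fin n)) : (ATGraph.scan G [] l).Nodup := by
  have h := (ATGraph.scan_spec (G := G) (fun _ _ => True) l [] (by simp)
    (List.pairwise_of_forall (by simp)) List.Pairwise.nil).1
  exact h.imp fun h => h.ne

open Classical in
theorem runs_keepVertex {s : State} (hin : HasInput adj M s) (hrep : Represents adj G)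
    {X : Finset (Fin n)} {l : List (Fin n)} {v : Fin n} (h4 : s.reg 4 = v)
    (h15 : s.reg 15 = l.length) (hl : l.length < n) (hL : Listed X s)
    (hcnt : ∀ x : Fin n, s.arr 12 x = l.countP (fun y => G.Adj y x))
    (hw : n + M + 1 < 2 ^ w) (h16 : s.reg 16 + 1 < 2 ^ w) :
    Runs w keepVertex s ((adj v).length * 16 + 23) (fun s' => s'.reg 15 = (v :: l).length ∧
      s'.reg 16 = s.reg 16 + 1 ∧ Listed (insert v X) s' ∧
      ∀ x : Fin n, s'.arr 12 x = (v :: l).countP (fun y => G.Adj y x)) := by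
  have h1w : 1 % 2 ^ w = 1 := Nat.mod_eq_of_lt (by omega)
  refine Runs.seq (T₁ := 11) (T₂ := (adj v).length * 16 + 12)
    (R := fun s' => s'.reg 15 = (v :: l).length ∧ s'.reg 16 = s.reg 16 + 1 ∧
      Listed (insert v X) s') (Runs.flat rfl (by decide) ?_) ?_ (by omega)
  · have h15' : (s.reg 15 + 1) % 2 ^ w = l.length + 1 := by
      rw [h15, Nat.mod_eq_of_lt (by omega)]
    refine ⟨?_, ?_, ?_, ?_⟩
    · simp [Prog.seqs, Prog.den, Expr.eval, State.setReg, State.setArr, h1w, h15']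
    · simp [Prog.seqs, Prog.den, Expr.eval, State.setReg, State.setArr, h1w, Nat.mod_eq_of_lt h16]
    · intro q hq
      simp only [Prog.seqs, Prog.den, Expr.eval, State.setReg, State.setArr, h1w,
        Function.update_self, Nat.mod_eq_of_lt h16, ne_eq, Nat.reduceEqDiff, not_false_eq_true,
        Function.update_of_ne] at hq ⊢
      by_cases hqL : q = s.reg 16
      · exact ⟨v, Finset.mem_insert_self _ _, by rw [hqL, Function.update_self, h4]⟩
      · obtain ⟨x, hx, hqx⟩ := hL.1 q (by omega)
        exact ⟨x, Finset.mem_insert_of_mem hx, by rw [Function.update_of_ne hqL, hqx]⟩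
    · intro x hx
      simp only [Prog.seqs, Prog.den, Expr.eval, State.setReg, State.setArr, h1w,
        Function.update_self, Nat.mod_eq_of_lt h16, ne_eq, Nat.reduceEqDiff, not_false_eq_true,
        Function.update_of_ne]
      rcases Finset.mem_insert.1 hx with rfl | hx
      · exact ⟨s.reg 16, by omega, by rw [Function.update_self, h4]⟩
      · obtain ⟨q, hq, hqx⟩ := hL.2 x hx
        exact ⟨q, by omega, by rw [Function.update_of_ne hq.ne, hqx]⟩
  rintro s₁ hf₁ ⟨e15, e16, hL₁⟩
  have e12 : s₁.arr 12 = s.arr 12 := hf₁.arr 12 (by decide)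
  refine (Runs.forEdges (T := 8) (I := fun D s' => ∀ x : Fin n, s'.arr 12 x =
      l.countP (fun y => G.Adj y x) + if x ∈ D then 1 else 0)
    (hin.frame hf₁ (by decide) (by decide) (by decide)) (hrep _).1
    (by rw [hf₁.reg 4 (by decide), h4]) (by omega) (by decide)
    (by decide) (fun s' ha _ x => by rw [ha, e12, hcnt]; simp) le_rfl ?_).mono le_rfl ?_
  · intro D x s₂ hx _ _ hv _ hI
    refine Runs.flat rfl (by decide) fun e y => ?_
    have hle : l.countP (fun y => G.Adj y x) ≤ l.length := List.countP_le_length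
    have hx' : (s₂.arr 12 x + 1) % 2 ^ w = l.countP (fun y => G.Adj y x) + 1 := by
      rw [hI x, if_neg hx, Nat.mod_eq_of_lt (by omega)]
    simp only [Prog.den, Expr.eval, State.setArr, State.setReg, hv, h1w, hx',
      Function.update_self]
    by_cases hy : y = x
    · subst hy
      simp
    · rw [Function.update_of_ne (by simpa [Fin.val_inj] using hy), hI y]
      simp [hy]
  · intro s₂ hf₂ hI
    have f16 : s₂.reg 16 = s₁.reg 16 := hf₂.reg 16 (by decide)
    have f11 : s₂.arr 11 = s₁.arr 11 := hf₂.arr 11 (by decide)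
    refine ⟨by rw [hf₂.reg 15 (by decide), e15], by rw [f16, e16], ?_, fun x => ?_⟩
    · unfold Listed at hL₁ ⊢
      rw [f16, f11]
      exact hL₁
    · rw [hI x, List.countP_cons]
      simp [(hrep _).2]

-- Array `12` counts the kept neighbours of each vertex and register `15` the kept vertices, so a
-- vertex is kept when the two numbers agree. Only kept vertices have their lists read, which makes
-- the scan linear. The condition `b` may read the distances, register `17` and the current vertex.
open Classical in
theorem runs_scanProg {s : State} (hin : HasInput adj M s) (hrep : Represents adj G)
    (hsum : ∑ u, (adj u).length = M) {σ : Equiv.Perm (Fin n)} {o : ℕ}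
    (ho : o ≠ 11 ∧ o ≠ 12) (hσ : ∀ t : Fin n, s.arr o t = σ t) {b : Expr} {S : Set (Fin n)}
    (hb : ∀ s' : State, s'.arr 9 = s.arr 9 → s'.reg 17 = s.reg 17 → ∀ v : Fin n, s'.reg 4 = v →
      (b.eval w s' ≠ 0 ↔ v ∈ S)) (hbc : b.cost ≤ 10) {X : Finset (Fin n)} (hL : Listed X s)
    (hw : n + M + 1 < 2 ^ w) (h16 : s.reg 16 + n + 1 < 2 ^ w) :
    Runs w (scanProg o b) s (n * 70 + M * 16 + 20) (fun s' =>
      Listed (X ∪ ATGraph.scanClique G (numbering σ) S) s' ∧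
      s'.reg 16 = s.reg 16 + (ATGraph.scanClique G (numbering σ) S).card) := by
  refine Runs.seq (T₁ := 4) (T₂ := n * 70 + M * 16 + 14)
    (R := fun s' => s'.reg 3 = 0 ∧ s'.reg 15 = 0)
    (Runs.flat rfl (by decide) (by simp [Prog.seqs, Prog.den, Expr.eval, State.setReg])) ?_
    (by omega)
  rintro s₁ hf₁ ⟨h3, h15⟩
  have hin₁ := hin.frame hf₁ (by decide) (by decide) (by decide)
  refine Runs.seq (T₁ := n * 11 + 4) (T₂ := n * 50 + M * 16 + 6)
    (Runs.forUp (T := fun _ => 3) (I := fun i s' => ∀ t < i, s'.arr 12 t = 0) h3 hin₁.num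
      (Nat.zero_le _) (by omega) (by decide) (by decide) (by decide) (by simp) (by simp) ?_) ?_
    (by omega)
  · intro i s' _ hi hf h3 h0 hI
    refine Runs.flat rfl (by decide) fun t ht => ?_
    simp only [Prog.den, Expr.eval, State.setReg, State.setArr, h3, Function.update_self,
      Nat.zero_mod]
    by_cases hti : t = i
    · simp [hti]
    · simp [hti, hI t (by omega)]
  rintro s₂ hf₂ ⟨hcnt, -⟩
  have hin₂ := hin₁.frame hf₂ (by decide) (by decide) (by decide)
  refine Runs.seq (T₁ := 2) (T₂ := n * 50 + M * 16 + 4)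
    (R := fun s' => s'.reg 3 = 0)
    (Runs.flat rfl (by decide) (by simp [Prog.den, Expr.eval, State.setReg])) ?_ (by omega)
  intro s₃ hf₃ h3₃
  have hin₃ := hin₂.frame hf₃ (by decide) (by decide) (by decide)
  have h15₃ : s₃.reg 15 = 0 := by rw [hf₃.reg 15 (by decide), hf₂.reg 15 (by decide), h15]
  have h16₃ : s₃.reg 16 = s.reg 16 := by
    rw [hf₃.reg 16 (by decide), hf₂.reg 16 (by decide), hf₁.reg 16 (by decide)]
  have h17₃ : s₃.reg 17 = s.reg 17 := by
    rw [hf₃.reg 17 (by decide), hf₂.reg 17 (by decide), hf₁.reg 17 (by decide)]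
  have ha : ∀ a, a ≠ 12 → s₃.arr a = s.arr a := by
    intro a h
    rw [hf₃.arr a (by simp [Prog.wa]), hf₂.arr a (by simpa [forUp, Prog.wa] using h),
      hf₁.arr a (by simp [Prog.wa, Prog.seqs])]
  have hL₃ : Listed X s₃ := by
    unfold Listed at hL ⊢
    rw [h16₃, ha 11 (by decide)]
    exact hL
  -- Here `l` lists the vertices kept so far; continuing the scan from `l` yields the result of the
  -- whole scan.
  refine (Runs.forUp (T := fun i => (if h : i < n then (adj (σ ⟨i, h⟩)).length * 16 else 0) + 42)
    (I := fun i s' => ∃ l : List (Fin n),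
      ATGraph.scan G l (toScan σ S i) = ATGraph.scan G [] (toScan σ S 0) ∧ l.length ≤ i ∧
      s'.reg 15 = l.length ∧ s'.reg 16 = s.reg 16 + l.length ∧ Listed (X ∪ l.toFinset) s' ∧
      ∀ x : Fin n, s'.arr 12 x = l.countP (fun y => G.Adj y x))
    h3₃ hin₃.num (Nat.zero_le _) (by omega)
    (by simp [keepVertex, forEdges, forUp, Prog.wr, Prog.seqs])
    (by simp [keepVertex, forEdges, forUp, Prog.wr, Prog.seqs]) (by decide)
    ⟨[], rfl, le_rfl, h15₃, by simpa using h16₃, by simpa using hL₃, fun x => ?_⟩ ?_ ?_).mono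
    le_rfl ?_
  · rw [hf₃.arr 12 (by decide), hcnt x x.isLt]; simp
  · have h1 : ∑ i ∈ Finset.range n, (if h : i < n then (adj (σ ⟨i, h⟩)).length * 16 else 0) =
        M * 16 := by
      rw [← Fin.sum_univ_eq_sum_range (fun i => if h : i < n then (adj (σ ⟨i, h⟩)).length * 16
        else 0)]
      simp only [Fin.is_lt, dite_true, Fin.eta]
      rw [Equiv.sum_comp σ fun v => (adj v).length * 16, ← Finset.sum_mul, hsum]
    rw [Nat.Ico_zero_eq_range, Finset.sum_add_distrib, Finset.sum_add_distrib, h1]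
    simp
    omega
  · rintro i s₄ _ hi hf₄ h3₄ - ⟨l, hscan, hli, h15₄, h16₄, hL₄, hcnt₄⟩
    have hin₄ := hin₃.frame hf₄ (by simp [keepVertex, forEdges, forUp, Prog.wr, Prog.seqs])
      (by simp [keepVertex, forEdges, forUp, Prog.wa, Prog.seqs])
      (by simp [keepVertex, forEdges, forUp, Prog.wa, Prog.seqs])
    have hstep := toScan_step σ S hi
    set v := σ ⟨i, hi⟩ with hv
    have ho₄ : s₄.arr o i = v := by
      rw [hf₄.arr o (by simp [keepVertex, forEdges, forUp, Prog.wa, Prog.seqs, ho]), ha o ho.2]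
      exact hσ ⟨i, hi⟩
    have h9₄ : s₄.arr 9 = s.arr 9 := by
      rw [hf₄.arr 9 (by simp [keepVertex, forEdges, forUp, Prog.wa, Prog.seqs]),
        ha 9 (by decide)]
    have h17₄ : s₄.reg 17 = s.reg 17 := by
      rw [hf₄.reg 17 (by simp [keepVertex, forEdges, forUp, Prog.wr, Prog.seqs]), h17₃]
    refine Runs.seq (T₁ := 3) (T₂ := (adj v).length * 16 + 39)
      (R := fun s' => s' = s₄.setReg 4 v) (Runs.flat rfl (Nat.le_of_ble_eq_true rfl) ?_) ?_
      (by simp only [hi, dite_true, ← hv]; omega)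
    · simp [Prog.den, Expr.eval, h3₄, ho₄]
    rintro s₅ hf₅ rfl
    have r15 : (s₄.setReg 4 v).reg 15 = l.length := by simp [State.setReg, h15₄]
    have r16 : (s₄.setReg 4 v).reg 16 = s.reg 16 + l.length := by simp [State.setReg, h16₄]
    have r4 : (s₄.setReg 4 v).reg 4 = v := by simp [State.setReg]
    have hL₅ : Listed (X ∪ l.toFinset) (s₄.setReg 4 v) := by
      simpa [Listed, State.setReg] using hL₄
    have hb' := hb (s₄.setReg 4 v) h9₄ (by simp [State.setReg, h17₄]) v r4
    -- skipping a vertex preserves the invariant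
    have hskip : ATGraph.scan G l (toScan σ S (i + 1)) = ATGraph.scan G [] (toScan σ S 0) →
        ∀ T, 1 ≤ T → Runs w .skip (s₄.setReg 4 v) T (fun s' => ∃ l : List (Fin n),
          ATGraph.scan G l (toScan σ S (i + 1)) = ATGraph.scan G [] (toScan σ S 0) ∧
          l.length ≤ i + 1 ∧ (s'.setReg 3 (i + 1)).reg 15 = l.length ∧
          (s'.setReg 3 (i + 1)).reg 16 = s.reg 16 + l.length ∧
          Listed (X ∪ l.toFinset) (s'.setReg 3 (i + 1)) ∧
          ∀ x : Fin n, (s'.setReg 3 (i + 1)).arr 12 x = l.countP (fun y => G.Adj y x)) := by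
      intro hs T hT
      refine Runs.flat rfl hT ⟨l, hs, by omega, ?_, ?_, ?_, hcnt₄⟩
      · simpa [Prog.den, State.setReg] using r15
      · simpa [Prog.den, State.setReg] using r16
      · simpa [Prog.den, Listed, State.setReg] using hL₅
    refine Runs.ite (T' := (adj v).length * 16 + 28) (fun hne => ?_) (fun heq => ?_) (by omega)
    · have hvS := hb'.1 hne
      rw [hstep.1 hvS, ATGraph.scan] at hscan
      refine Runs.ite (T' := (adj v).length * 16 + 23) (fun hne => ?_) (fun heq => ?_)
        (by simp only [Expr.cost]; omega)
      · have hall : ∀ y ∈ l, G.Adj y v := by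
          have h1 : l.countP (fun y => G.Adj y v) = l.length := by
            by_contra hcon
            apply hne
            simp only [Expr.eval, r4, r15]
            rw [if_neg]
            simpa [State.setReg, hcnt₄] using hcon
          simpa using List.countP_eq_length.1 h1
        rw [if_pos hall] at hscan
        refine (runs_keepVertex (hin₄.frame hf₅ (by simp [Prog.wr]) (by simp [Prog.wa])
          (by simp [Prog.wa])) hrep r4 r15 (by omega) hL₅ hcnt₄ hw (by omega)).mono le_rfl ?_
        rintro s₆ - ⟨q15, q16, hL₆, hcnt₆⟩
        refine ⟨v :: l, hscan, by simpa using hli, ?_, ?_, ?_, hcnt₆⟩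
        · simpa [State.setReg] using q15
        · rw [List.length_cons, ← add_assoc, ← r16, ← q16]; simp [State.setReg]
        · rw [List.toFinset_cons, Finset.union_insert]
          simpa [Listed, State.setReg] using hL₆
      · have hall : ¬ ∀ y ∈ l, G.Adj y v := by
          intro hall
          have h1 : l.countP (fun y => G.Adj y v) = l.length :=
            List.countP_eq_length.2 (by simpa using hall)
          simp only [Expr.eval, r4, r15] at heq
          rw [if_pos (by simp [State.setReg, hcnt₄, h1])] at heq
          exact one_ne_zero heq
        rw [if_neg hall] at hscan
        exact hskip hscan _ (by omega)
    · have hvS : v ∉ S := fun h => hb'.2 h heq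
      rw [hstep.2 hvS] at hscan
      exact hskip hscan _ (by omega)
  · rintro s₄ - ⟨⟨l, hscan, -, -, e16, hL₄, -⟩, -⟩
    have hnil : toScan σ S n = [] := by
      unfold toScan
      rw [List.drop_of_length_le (by simp)]
      rfl
    rw [hnil, ATGraph.scan] at hscan
    rw [scanClique_numbering, ← hscan]
    have hnd : l.Nodup := hscan ▸ scan_nodup G _
    exact ⟨by convert hL₄, by rw [e16]; congr 1; rw [← List.toFinset_card_of_nodup hnd]⟩

/-! ### The algorithm for all eccentricities -/

variable {w n : ℕ} {G : SimpleGraph (Fin n)} {adj : Fin n → List (Fin n)} {M : ℕ}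

/-- Three consecutive searches, each from the last vertex of the one before. Array `10` receives
the second order, and register `17` the eccentricity of the last starting vertex. -/
def sweepsProg : Prog :=
  .seq (.set 2 (.const 0)) (.seq searchProg (.seq (.set 2 (.get 3 (.const 0))) (.seq searchProg
    (.seq (.seqs [.set 2 (.get 3 (.const 0)), .set 3 (.const 0)])
      (.seq (forUp 3 0 (.put 10 (.reg 3) (.get 3 (.reg 3))))
        (.seq searchProg (.set 17 (.get 9 (.get 3 (.const 0))))))))))

theorem isLast_numbering (σ : Equiv.Perm (Fin n)) (h : 0 < n) :
    ATGraph.IsLast (numbering σ) (σ ⟨0, h⟩) := by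
  simp [ATGraph.IsLast, numbering_symm_val]

/-- Distances do not decrease in the order of visits, so the last visited vertex is farthest from
the start. -/
theorem eccent_eq_dist_last (hG : G.Connected) {τ : Equiv.Perm (Fin n)} {v : Fin n}
    (h : ATGraph.IsLexBFS G v (numbering τ)) (hn : 0 < n) :
    G.eccent v = G.dist v (τ ⟨0, hn⟩) := by
  rw [ATGraph.coe_dist_edist hG]
  refine le_antisymm ((SimpleGraph.eccent_le_iff _ _).2 fun x => ?_) SimpleGraph.edist_le_eccent
  rw [← ATGraph.coe_dist_edist hG, ← ATGraph.coe_dist_edist hG]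
  exact_mod_cast h.dist_le hG (a := x) (b := τ ⟨0, hn⟩)
    (by rw [Fin.le_def, numbering_symm_val, numbering_symm_val]; simp)

theorem runs_sweepsProg (hG : G.Connected) {s : State} (hin : HasInput adj M s)
    (hrep : Represents adj G) (hsum : ∑ u, (adj u).length = M) (hw : 2 * (n + M + 2) < 2 ^ w) :
    Runs w sweepsProg s (n * 410 + M * 300 + 270) (fun s' => ∃ (σ τ : Equiv.Perm (Fin n))
      (v : Fin n), ATGraph.ThreeSweep G (numbering σ) (numbering τ) v ∧
      (∀ t : Fin n, s'.arr 10 t = σ t) ∧ (∀ t : Fin n, s'.arr 3 t = τ t) ∧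
      (∀ x : Fin n, s'.arr 9 x = G.dist v x) ∧ (s'.reg 17 : ℕ∞) = G.eccent v) := by
  have hn : 0 < n := by
    obtain ⟨x⟩ := hG.nonempty
    exact Fin.pos x
  refine Runs.seq (T₁ := 2) (T₂ := n * 410 + M * 300 + 268) (R := fun s' => s'.reg 2 = 0)
    (Runs.flat rfl (by decide) (by simp [Prog.den, Expr.eval, State.setReg])) ?_ (by omega)
  intro s₁ hf₁ h2
  have hin₁ := hin.frame hf₁ (by decide) (by decide) (by decide)
  refine Runs.seq (T₂ := n * 280 + M * 200 + 188)
    (runs_searchProg hG hin₁ hrep hsum (u := ⟨0, hn⟩) h2 hw) ?_ (by omega)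
  rintro s₂ hf₂ ⟨ρ, hρ, hρlex, -⟩
  have hin₂ := hin₁.frame hf₂ (by decide) (by decide) (by decide)
  refine Runs.seq (T₁ := 3) (T₂ := n * 280 + M * 200 + 185)
    (R := fun s' => s'.reg 2 = ρ ⟨0, hn⟩) (Runs.flat rfl (by decide) ?_) ?_ (by omega)
  · simp [Prog.den, Expr.eval, State.setReg, ← hρ ⟨0, hn⟩]
  intro s₃ hf₃ h2
  have hin₃ := hin₂.frame hf₃ (by decide) (by decide) (by decide)
  refine Runs.seq (T₂ := n * 150 + M * 100 + 105) (runs_searchProg hG hin₃ hrep hsum h2 hw) ?_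
    (by omega)
  rintro s₄ hf₄ ⟨σ, hσ, hσlex, -⟩
  have hin₄ := hin₃.frame hf₄ (by decide) (by decide) (by decide)
  refine Runs.seq (T₁ := 5) (T₂ := n * 150 + M * 100 + 100)
    (R := fun s' => s'.reg 2 = σ ⟨0, hn⟩ ∧ s'.reg 3 = 0 ∧ ∀ t : Fin n, s'.arr 3 t = σ t)
    (Runs.flat rfl (by decide) ?_) ?_ (by omega)
  · simp [Prog.seqs, Prog.den, Expr.eval, State.setReg, ← hσ ⟨0, hn⟩, hσ]
  rintro s₅ hf₅ ⟨h2, h3, hσ₅⟩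
  have hin₅ := hin₄.frame hf₅ (by decide) (by decide) (by decide)
  refine Runs.seq (T₁ := n * 12 + 4) (T₂ := n * 130 + M * 100 + 90)
    (Runs.forUp (T := fun _ => 4) (I := fun i s' => ∀ t : Fin n, (t : ℕ) < i → s'.arr 10 t = σ t)
      h3 hin₅.num (Nat.zero_le _) (by omega) (by decide) (by decide) (by decide)
      (fun t ht => absurd ht (Nat.not_lt_zero _)) (by simp) ?_) ?_ (by omega)
  · intro i s' _ hi hf h3 _ hI
    have h3' : s'.arr 3 = s₅.arr 3 := hf.arr 3 (by decide)
    refine Runs.flat rfl (by decide) fun t ht => ?_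
    simp only [Prog.den, Expr.eval, State.setReg, State.setArr, h3, Function.update_self, h3']
    by_cases hti : (t : ℕ) = i
    · rw [hti, Function.update_self, ← hti, hσ₅]
    · rw [Function.update_of_ne hti]
      exact hI t (by omega)
  rintro s₆ hf₆ ⟨h10, -⟩
  have hin₆ := hin₅.frame hf₆ (by decide) (by decide) (by decide)
  refine Runs.seq (T₂ := 4) (runs_searchProg hG hin₆ hrep hsum
    (u := σ ⟨0, hn⟩) (by rw [hf₆.reg 2 (by decide), h2]) hw) ?_ (by omega)
  rintro s₇ hf₇ ⟨τ, hτ, hτlex, hd⟩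
  have h10' : s₇.arr 10 = s₆.arr 10 := hf₇.arr 10 (by decide)
  refine Runs.flat rfl (by decide) ⟨σ, τ, σ ⟨0, hn⟩,
    ⟨_, _, numbering ρ, hρlex, isLast_numbering ρ hn, hσlex, isLast_numbering σ hn, hτlex⟩,
    fun t => ?_, hτ, hd, ?_⟩
  · simp only [Prog.den, State.setReg]
    rw [h10', h10 t t.isLt]
  · rw [eccent_eq_dist_last hG hτlex hn, ← hd, ← hτ]
    simp [Prog.den, Expr.eval, State.setReg]

/-- List the three cliques. -/
def cliquesProg : Prog :=
  .seq (scanProg 10 (.lt (.get 9 (.reg 4)) (.const 2)))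
    (.seq (scanProg 3 (.eq (.add (.get 9 (.reg 4)) (.const 1)) (.reg 17)))
      (scanProg 3 (.eq (.get 9 (.reg 4)) (.reg 17))))

/-- The cliques may overlap. The list then contains repetitions, and its length is the sum of the
three sizes. -/
theorem runs_cliquesProg (hG : G.Connected) {s : State} (hin : HasInput adj M s)
    (hrep : Represents adj G) (hsum : ∑ u, (adj u).length = M) {σ τ : Equiv.Perm (Fin n)}
    {v : Fin n} (hσ : ∀ t : Fin n, s.arr 10 t = σ t) (hτ : ∀ t : Fin n, s.arr 3 t = τ t)
    (hd : ∀ x : Fin n, s.arr 9 x = G.dist v x) (h17 : (s.reg 17 : ℕ∞) = G.eccent v)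
    (h16 : s.reg 16 = 0) (hw : 4 * (n + M + 2) < 2 ^ w) :
    Runs w cliquesProg s (n * 210 + M * 48 + 60) (fun s' =>
      Listed (ATGraph.cliqueA G (numbering σ) v ∪ ATGraph.cliqueB G (numbering τ) v ∪
        ATGraph.cliqueC G (numbering τ) v) s' ∧
      s'.reg 16 = (ATGraph.cliqueA G (numbering σ) v).card +
        (ATGraph.cliqueB G (numbering τ) v).card + (ATGraph.cliqueC G (numbering τ) v).card) := by
  have hcard : ∀ X : Finset (Fin n), X.card ≤ n := fun X => by
    simpa using Finset.card_le_univ X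
  have hcast : ∀ x : Fin n, ((s.arr 9 x : ℕ) : ℕ∞) = G.edist v x := fun x => by
    rw [hd, ATGraph.coe_dist_edist hG]
  have hlt : ∀ x : Fin n, s.arr 9 x < n := fun x => hd x ▸ dist_lt_card hG v x
  have hL₀ : Listed (∅ : Finset (Fin n)) s := by simp [Listed, h16]
  refine Runs.seq (T₂ := n * 140 + M * 32 + 40) (runs_scanProg hin hrep hsum (by decide) hσ
    (S := {x | G.edist v x ≤ 1}) ?_ (by decide) hL₀ (by omega) (by omega)) ?_ (by omega)
  · intro s' h9 _ x h4
    simp only [Expr.eval, h4, h9, Set.mem_ofPred_eq, ← hcast, Nat.mod_eq_of_lt (show 2 < 2 ^ w by omega)]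
    rw [Nat.cast_le_one]
    split_ifs with h <;> simp <;> omega
  rintro s₁ hf₁ ⟨hL₁, h16₁⟩
  rw [Finset.empty_union] at hL₁
  have hin₁ := hin.frame hf₁ (by decide) (by decide) (by decide)
  have e9 : s₁.arr 9 = s.arr 9 := hf₁.arr 9 (by decide)
  have e17 : s₁.reg 17 = s.reg 17 := hf₁.reg 17 (by decide)
  have hA := hcard (ATGraph.scanClique G (numbering σ) {x | G.edist v x ≤ 1})
  refine Runs.seq (T₂ := n * 70 + M * 16 + 20) (runs_scanProg hin₁ hrep hsum (by decide)
    (σ := τ) (by rw [hf₁.arr 3 (by decide)]; exact hτ)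
    (S := {x | G.edist v x + 1 = G.eccent v}) ?_ (by decide) hL₁ (by omega) (by omega)) ?_
    (by omega)
  · intro s' h9 h17' x h4
    have := hlt x
    simp only [Expr.eval, h4, h9, h17', e9, e17, Set.mem_ofPred_eq, ← hcast, ← h17,
      Nat.mod_eq_of_lt (show 1 < 2 ^ w by omega),
      Nat.mod_eq_of_lt (show s.arr 9 x + 1 < 2 ^ w by omega)]
    norm_cast
    split_ifs with h <;> simp [h]
  rintro s₂ hf₂ ⟨hL₂, h16₂⟩
  have hin₂ := hin₁.frame hf₂ (by decide) (by decide) (by decide)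
  have e9' : s₂.arr 9 = s.arr 9 := (hf₂.arr 9 (by decide)).trans e9
  have e17' : s₂.reg 17 = s.reg 17 := (hf₂.reg 17 (by decide)).trans e17
  have hB := hcard (ATGraph.scanClique G (numbering τ) {x | G.edist v x + 1 = G.eccent v})
  refine (runs_scanProg hin₂ hrep hsum (by decide)
    (σ := τ) (by rw [hf₂.arr 3 (by decide), hf₁.arr 3 (by decide)]; exact hτ)
    (S := {x | G.edist v x = G.eccent v}) ?_ (by decide) hL₂ (by omega) (by omega)).mono le_rfl ?_
  · intro s' h9 h17' x h4
    simp only [Expr.eval, h4, h9, h17', e9', e17', Set.mem_ofPred_eq, ← hcast, ← h17]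
    norm_cast
    split_ifs with h <;> simp [h]
  rintro s₃ - ⟨hL₃, h16₃⟩
  refine ⟨hL₃, ?_⟩
  rw [h16₃, h16₂, h16₁, h16, zero_add]
  rfl

/-- Record in array `2` the largest distances to the listed vertices. -/
def farthestProg : Prog :=
  .seq (.set 18 (.const 0)) (forUp 18 16 (.seq (.set 2 (.get 11 (.reg 18))) (.seq searchProg
    (.seq (.set 3 (.const 0)) (forUp 3 0
      (.ite (.lt (.get 2 (.reg 3)) (.get 9 (.reg 3))) (.put 2 (.reg 3) (.get 9 (.reg 3)))
        .skip))))))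

theorem runs_farthestProg (hG : G.Connected) {s : State} (hin : HasInput adj M s)
    (hrep : Represents adj G) (hsum : ∑ u, (adj u).length = M) {X : Finset (Fin n)}
    (hX : Listed X s) (h2 : ∀ v : Fin n, s.arr 2 v = 0) (hw : 2 * (n + M + 2) < 2 ^ w)
    (h16 : s.reg 16 < 2 ^ w) :
    Runs w farthestProg s (s.reg 16 * (n * 150 + M * 100 + 100) + 10) (fun s' =>
      ∀ v : Fin n, s'.arr 2 v = X.sup (fun x => G.dist v x)) := by
  have hn : 0 < n := by
    obtain ⟨x⟩ := hG.nonempty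
    exact Fin.pos x
  -- The vertex `0` serves as a default beyond the end of the list, so that the entries form a total
  -- function.
  have hx : ∀ q, ∃ x : Fin n, q < s.reg 16 → x ∈ X ∧ s.arr 11 q = x := by
    intro q
    by_cases hq : q < s.reg 16
    · obtain ⟨x, hx⟩ := hX.1 q hq
      exact ⟨x, fun _ => hx⟩
    · exact ⟨⟨0, hn⟩, fun h => absurd h hq⟩
  choose x hx using hx
  refine Runs.seq (T₁ := 2) (T₂ := s.reg 16 * (n * 150 + M * 100 + 100) + 4)
    (R := fun s' => s'.reg 18 = 0)
    (Runs.flat rfl (by decide) (by simp [Prog.den, Expr.eval, State.setReg])) ?_ (by omega)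
  intro s₁ hf₁ h18
  have hin₁ := hin.frame hf₁ (by decide) (by decide) (by decide)
  refine (Runs.forUp (T := fun _ => n * 150 + M * 100 + 92) (I := fun q s' => ∀ v : Fin n,
    s'.arr 2 v = (Finset.range q).sup (fun q => G.dist v (x q))) h18
    (hf₁.reg 16 (by decide)) (Nat.zero_le _) h16 (by decide) (by decide) (by decide)
    (fun v => by rw [hf₁.arr 2 (by decide), h2]; simp) (by simp) ?_).mono le_rfl ?_
  · intro q s₂ _ hq hf₂ h18 _ hI
    have hin₂ := hin₁.frame hf₂ (by decide) (by decide) (by decide)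
    refine Runs.seq (T₁ := 3) (T₂ := n * 150 + M * 100 + 89) (R := fun s' => s'.reg 2 = x q)
      (Runs.flat rfl (by decide) ?_) ?_ (by omega)
    · simp only [Prog.den, Expr.eval, State.setReg, h18, Function.update_self]
      rw [hf₂.arr 11 (by decide), hf₁.arr 11 (by decide), (hx q hq).2]
    intro s₃ hf₃ h2
    have hin₃ := hin₂.frame hf₃ (by decide) (by decide) (by decide)
    refine Runs.seq (T₂ := n * 20 + 9) (runs_searchProg hG hin₃ hrep hsum h2 hw) ?_ (by omega)
    rintro s₄ hf₄ ⟨-, -, -, hd⟩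
    have hin₄ := hin₃.frame hf₄ (by decide) (by decide) (by decide)
    refine Runs.seq (T₁ := 2) (T₂ := n * 20 + 4) (R := fun s' => s'.reg 3 = 0)
      (Runs.flat rfl (by decide) (by simp [Prog.den, Expr.eval, State.setReg])) ?_ (by omega)
    intro s₅ hf₅ h3
    have hin₅ := hin₄.frame hf₅ (by decide) (by decide) (by decide)
    have hI₅ : ∀ v : Fin n, s₅.arr 2 v = (Finset.range q).sup (fun q => G.dist v (x q)) := by
      rw [hf₅.arr 2 (by decide), hf₄.arr 2 (by decide), hf₃.arr 2 (by decide)]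
      exact hI
    have h9 : ∀ v : Fin n, s₅.arr 9 v = G.dist v (x q) := by
      intro v
      rw [hf₅.arr 9 (by decide), hd, SimpleGraph.dist_comm]
    refine (Runs.forUp (T := fun _ => 12) (I := fun i s' => ∀ v : Fin n, s'.arr 2 v =
      if (v : ℕ) < i then max (G.dist v (x q)) (s₅.arr 2 v) else s₅.arr 2 v)
      h3 hin₅.num (Nat.zero_le _) (by omega) (by decide) (by decide) (by decide)
      (fun v => by simp) (by simp) ?_).mono le_rfl ?_
    · intro i s₆ _ hi hf₆ h3 _ hI₆
      have e9 : s₆.arr 9 = s₅.arr 9 := hf₆.arr 9 (by decide)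
      have h9i := h9 ⟨i, hi⟩
      have hIi := hI₆ ⟨i, hi⟩
      simp only [lt_irrefl, if_false] at hIi h9i
      refine Runs.flat rfl (by decide) fun v => ?_
      by_cases hvi : (v : ℕ) = i
      · obtain rfl : v = ⟨i, hi⟩ := Fin.ext hvi
        simp only [Prog.den, Expr.eval, h3, e9, h9i, hIi, Nat.lt_succ_self, if_true]
        by_cases hlt : s₅.arr 2 i < G.dist ⟨i, hi⟩ (x q)
        · simp only [hlt, if_true, one_ne_zero, if_false]
          simp only [State.setReg, State.setArr, Function.update_self]
          omega
        · simp only [hlt, if_true, if_false]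
          simp only [State.setReg, hIi]
          omega
      · have h1 : (v : ℕ) < i + 1 ↔ (v : ℕ) < i := by omega
        simp only [h1]
        rw [← hI₆ v]
        simp only [Prog.den]
        split_ifs
        · rfl
        · simp [State.setReg, State.setArr, Expr.eval, h3, hvi]
    · rintro s₆ - ⟨hI₆, -⟩ v
      have e2 : (s₆.setReg 18 (q + 1)).arr 2 = s₆.arr 2 := rfl
      rw [e2, hI₆ v, if_pos v.isLt, hI₅ v, Finset.range_add_one, Finset.sup_insert]
  · rintro s₂ - ⟨hI, -⟩ v
    rw [hI v]
    apply le_antisymm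
    · exact Finset.sup_le fun q hq => Finset.le_sup (f := fun y => G.dist v y)
        (hx q (Finset.mem_range.1 hq)).1
    · refine Finset.sup_le fun y hy => ?_
      obtain ⟨q, hq, hqy⟩ := hX.2 y hy
      have : x q = y := Fin.ext ((hx q hq).2.symm.trans hqy)
      rw [← this]
      exact Finset.le_sup (f := fun q => G.dist v (x q)) (Finset.mem_range.2 hq)

/-- Correct the eccentricities below `3`, and compute the diameter. -/
def finishProg : Prog :=
  .seq (.set 3 (.const 0)) (forUp 3 0 (.seq
    (.ite (.eq (.add (.sub (.get 0 (.add (.reg 3) (.const 1))) (.get 0 (.reg 3))) (.const 1))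
        (.reg 0))
      (.put 2 (.reg 3) (.lt (.const 1) (.reg 0)))
      (.ite (.lt (.get 2 (.reg 3)) (.const 2)) (.put 2 (.reg 3) (.const 2)) .skip))
    (.ite (.lt (.reg 1) (.get 2 (.reg 3))) (.set 1 (.get 2 (.reg 3))) .skip)))

/-- A vertex adjacent to all others is recognised by its degree `n - 1`. In the one-vertex graph it
has eccentricity 0, hence the comparison of `1` with `n`. -/
theorem runs_finishProg {s : State} (hin : HasInput adj M s) (h1 : s.reg 1 = 0)
    (hw : n + M + 3 < 2 ^ w) {g : Fin n → ℕ}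
    (hg : ∀ v, g v = if (adj v).length + 1 = n then (if 1 < n then 1 else 0)
      else max 2 (s.arr 2 v)) :
    Runs w finishProg s (n * 60 + 10) (fun s' => (∀ v : Fin n, s'.arr 2 v = g v) ∧
      (∀ v, g v ≤ s'.reg 1) ∧ (s'.reg 1 = 0 ∨ ∃ v, s'.reg 1 = g v)) := by
  refine Runs.seq (T₁ := 2) (T₂ := n * 60 + 4) (R := fun s' => s'.reg 3 = 0)
    (Runs.flat rfl (by decide) (by simp [Prog.den, Expr.eval, State.setReg])) ?_ (by omega)
  intro s₁ hf₁ h3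
  have hin₁ := hin.frame hf₁ (by decide) (by decide) (by decide)
  have e2 : s₁.arr 2 = s.arr 2 := hf₁.arr 2 (by decide)
  refine (Runs.forUp (T := fun _ => 52) (I := fun i s' =>
    (∀ v : Fin n, s'.arr 2 v = if (v : ℕ) < i then g v else s.arr 2 v) ∧
    (∀ v : Fin n, (v : ℕ) < i → g v ≤ s'.reg 1) ∧ (s'.reg 1 = 0 ∨ ∃ v, s'.reg 1 = g v))
    h3 hin₁.num (Nat.zero_le _) (by omega) (by decide) (by decide) (by decide)
    ⟨fun v => by rw [e2]; simp, fun v hv => absurd hv (Nat.not_lt_zero _),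
      Or.inl (by rw [hf₁.reg 1 (by decide), h1])⟩ (by simp) ?_).mono le_rfl ?_
  · rintro i s₂ _ hi hf₂ h3 h0 ⟨hI1, hI2, hI3⟩
    have hin₂ := hin₁.frame hf₂ (by decide) (by decide) (by decide)
    have h1w : 1 % 2 ^ w = 1 := Nat.mod_eq_of_lt (by omega)
    have h2w : 2 % 2 ^ w = 2 := Nat.mod_eq_of_lt (by omega)
    have hiw : (i + 1) % 2 ^ w = i + 1 := Nat.mod_eq_of_lt (by omega)
    have hlen := hin₂.len ⟨i, hi⟩
    have hbd := hin₂.bound ⟨i, hi⟩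
    simp only at hlen hbd
    have hdeg : (s₂.arr 0 (i + 1) - s₂.arr 0 i + 1) % 2 ^ w = (adj ⟨i, hi⟩).length + 1 := by
      rw [Nat.mod_eq_of_lt (by omega), hlen]; omega
    have hIi := hI1 ⟨i, hi⟩
    have hgi := hg ⟨i, hi⟩
    simp only [lt_irrefl, if_false] at hIi hgi
    refine Runs.seq (T₁ := 30) (T₂ := 20) (R := fun s' => s'.arr 2 = Function.update (s₂.arr 2) i
      (g ⟨i, hi⟩) ∧ s'.reg = s₂.reg) (Runs.flat rfl (by decide) ?_) ?_ (by omega)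
    · simp only [Prog.den, Expr.eval, h3, h0, h1w, h2w, hiw, hdeg, hIi, hgi]
      by_cases hd : (adj ⟨i, hi⟩).length + 1 = n
      · simp [hd, State.setArr]
      · by_cases h2 : s.arr 2 i < 2
        · simp [hd, h2, State.setArr, max_eq_left h2.le]
        · rw [max_eq_right (not_lt.1 h2), ← hIi]
          rw [← hIi] at h2
          simp only [hd, h2, if_false, if_true, Function.update_eq_self, and_self]
    rintro s₃ - ⟨e2, er⟩
    refine Runs.flat rfl (by decide) ?_
    have harr : ∀ v : Fin n, s₃.arr 2 v = if (v : ℕ) < i + 1 then g v else s.arr 2 v := by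
      intro v
      rw [e2]
      by_cases hvi : (v : ℕ) = i
      · obtain rfl : v = ⟨i, hi⟩ := Fin.ext hvi
        simp
      · rw [Function.update_of_ne hvi, hI1 v]
        have h1 : (v : ℕ) < i + 1 ↔ (v : ℕ) < i := by omega
        simp only [h1]
    have hlast : ∀ v : Fin n, (v : ℕ) < i + 1 → (v : ℕ) < i ∨ v = ⟨i, hi⟩ := fun v hv => by
      rcases Nat.lt_succ_iff_lt_or_eq.1 hv with h | h
      exacts [Or.inl h, Or.inr (Fin.ext h)]
    simp only [Prog.den, Expr.eval, er, h3, e2, Function.update_self]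
    by_cases hlt : s₂.reg 1 < g ⟨i, hi⟩
    · simp only [hlt, if_true, one_ne_zero, if_false]
      refine ⟨harr, fun v hv => ?_, Or.inr ⟨⟨i, hi⟩, by simp [State.setReg]⟩⟩
      have : ((s₃.setReg 1 (g ⟨i, hi⟩)).setReg 3 (i + 1)).reg 1 = g ⟨i, hi⟩ := by
        simp [State.setReg]
      rw [this]
      rcases hlast v hv with h | rfl
      · exact (hI2 v h).trans hlt.le
      · exact le_rfl
    · simp only [hlt, if_true, if_false]
      have : (s₃.setReg 3 (i + 1)).reg 1 = s₂.reg 1 := by simp [State.setReg, er]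
      rw [this]
      refine ⟨harr, fun v hv => ?_, hI3⟩
      rcases hlast v hv with h | rfl
      · exact hI2 v h
      · exact not_lt.1 hlt
  · rintro s₂ - ⟨⟨hI1, hI2, hI3⟩, -⟩
    exact ⟨fun v => by rw [hI1 v, if_pos v.isLt], fun v => hI2 v v.isLt, hI3⟩

/-- All eccentricities of an AT-free graph. -/
def eccentricitiesProg : Prog :=
  .seq sweepsProg (.seq cliquesProg (.seq farthestProg finishProg))

theorem runs_eccentricitiesProg (hG : G.Connected) (hAT : ATGraph.ATFree G)
    (hrep : Represents adj G) (hw : 20000 * (n + G.edgeSet.ncard + 1) ≤ 2 ^ w) :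
    ∃ (k T : ℕ), (k : ℝ) ≤ 6 * √((G.edgeSet.ncard : ℝ) + 1) ∧
      T ≤ 2000 * (G.edgeSet.ncard + 1) * (k + 1) ∧
      Runs w eccentricitiesProg (input adj) T (fun s =>
        (∀ v : Fin n, ((s.arr 2 v.val : ℕ) : ℕ∞) = G.eccent v) ∧
          ((s.reg 1 : ℕ) : ℕ∞) = G.ediam) := by
  obtain ⟨hin, hsum, huniv⟩ := hasInput_input hrep
  -- By connectivity all bounds linear in `n` and `m` become linear in `m + 1`.
  have hnm : n ≤ G.edgeSet.ncard + 1 := by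
    have := hG.card_vert_le_card_edgeSet_add_one
    rwa [Nat.card_eq_fintype_card, Fintype.card_fin, Nat.card_coe_set_eq] at this
  set m := G.edgeSet.ncard with hm
  obtain ⟨t₁, s₁, e₁, b₁, σ, τ, v, hsw, h10, h3, h9, h17⟩ :=
    runs_sweepsProg (w := w) hG hin hrep hsum (by omega)
  have hf₁ := e₁.frame
  have hin₁ := hin.frame hf₁ (by decide) (by decide) (by decide)
  obtain ⟨-, ⟨hA, hB, hC⟩, -, hone, hmax⟩ := ATGraph.cliques_of_three_sweeps hG hAT hsw _ _ _
    rfl rfl rfl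
  have h16 : s₁.reg 16 = 0 := by rw [hf₁.reg 16 (by decide)]; simp [input]
  obtain ⟨t₂, s₂, e₂, b₂, hL, hk⟩ :=
    runs_cliquesProg (w := w) hG hin₁ hrep hsum h10 h3 h9 h17 h16 (by omega)
  have hf₂ := e₂.frame
  have hin₂ := hin₁.frame hf₂ (by decide) (by decide) (by decide)
  have hcard : ∀ X : Finset (Fin n), X.card ≤ n := fun X => by
    simpa using Finset.card_le_univ X
  have hA' := hcard (ATGraph.cliqueA G (numbering σ) v)
  have hB' := hcard (ATGraph.cliqueB G (numbering τ) v)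
  have hC' := hcard (ATGraph.cliqueC G (numbering τ) v)
  have h2 : ∀ x : Fin n, s₂.arr 2 x = 0 := by
    intro x
    rw [hf₂.arr 2 (by decide), hf₁.arr 2 (by decide)]
    simp [input]
  obtain ⟨t₃, s₃, e₃, b₃, hfar⟩ :=
    runs_farthestProg (w := w) hG hin₂ hrep hsum hL h2 (by omega) (by omega)
  have hf₃ := e₃.frame
  have hin₃ := hin₂.frame hf₃ (by decide) (by decide) (by decide)
  have h1 : s₃.reg 1 = 0 := by
    rw [hf₃.reg 1 (by decide), hf₂.reg 1 (by decide), hf₁.reg 1 (by decide)]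
    simp [input]
  obtain ⟨t₄, s₄, e₄, b₄, hg, hle, hor⟩ := runs_finishProg (w := w) hin₃ h1 (by omega)
    (g := fun x => if (adj x).length + 1 = n then (if 1 < n then 1 else 0)
      else max 2 (s₃.arr 2 x)) (fun _ => rfl)
  have hcast : Monotone fun k : ℕ => (k : ℕ∞) := fun _ _ h => Nat.cast_le.2 h
  have hecc : ∀ x : Fin n, ((s₄.arr 2 x : ℕ) : ℕ∞) = G.eccent x := by
    intro x
    rw [hg x]
    by_cases hx : (adj x).length + 1 = n
    · rw [if_pos hx]
      by_cases hn : 1 < n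
      · have : Nontrivial (Fin n) := Fin.nontrivial_iff_two_le.2 hn
        rw [if_pos hn, hone x this ((huniv x).1 hx), Nat.cast_one]
      · have : Subsingleton (Fin n) := Fin.subsingleton_iff_le_one.2 (by omega)
        rw [if_neg hn, SimpleGraph.eccent_eq_zero_of_subsingleton, Nat.cast_zero]
    -- The program computes the supremum in `ℕ`; the cast to `ℕ∞` is monotone and commutes with it.
    · rw [if_neg hx, hmax x (fun h => hx ((huniv x).2 h)), hfar x, hcast.map_max]
      congr 1
      rw [Finset.apply_sup_eq_sup_comp (fun k : ℕ => (k : ℕ∞)) (fun _ _ => hcast.map_max) rfl]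
      exact Finset.sup_congr rfl fun y _ => ATGraph.coe_dist_edist hG x y
  refine ⟨s₂.reg 16, t₁ + (t₂ + (t₃ + t₄)), ?_, ?_, _, s₄,
    e₁.seq (e₂.seq (e₃.seq e₄)), le_rfl, hecc, le_antisymm ?_ ?_⟩
  · rw [hk]
    push_cast
    linarith
  · have h5 : s₂.reg 16 * (n * 150 + 2 * m * 100 + 100) ≤ s₂.reg 16 * (2000 * (m + 1)) :=
      Nat.mul_le_mul_left _ (by omega)
    calc t₁ + (t₂ + (t₃ + t₄)) ≤ 2000 * (m + 1) + s₂.reg 16 * (2000 * (m + 1)) := by omega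
      _ = _ := by ring
  · rcases hor with h | ⟨x, hx⟩
    · rw [h]; simp
    · rw [hx, ← hg x, hecc x]
      exact SimpleGraph.eccent_le_ediam
  · refine SimpleGraph.ediam_le_iff.2 fun x y => SimpleGraph.edist_le_eccent.trans ?_
    rw [← hecc x, hg x]
    exact_mod_cast hle x

theorem exists_eccentricities_program :
    ∃ (P : Prog) (c : ℕ), ∀ (n : ℕ) (G : SimpleGraph (Fin n)),
      G.Connected → ATGraph.ATFree G →
      ∀ adj : Fin n → List (Fin n), Represents adj G →
      ∀ w : ℕ, c * (n + G.edgeSet.ncard + 1) ≤ 2 ^ w →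
      ∃ (t : ℕ) (s : State),
        Exec w P (input adj) t s ∧
        (t : ℝ) ≤ c * ((G.edgeSet.ncard : ℝ) + 1) ^ ((3 : ℝ) / 2) ∧
        (∀ v : Fin n, ((s.arr 2 v.val : ℕ) : ℕ∞) = G.eccent v) ∧
        ((s.reg 1 : ℕ) : ℕ∞) = G.ediam := by
  refine ⟨eccentricitiesProg, 20000, fun n G hG hAT adj hrep w hw => ?_⟩
  obtain ⟨k, T, hk, hT, t, s, he, ht, h⟩ := runs_eccentricitiesProg hG hAT hrep hw
  refine ⟨t, s, he, ?_, h⟩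
  set x : ℝ := (G.edgeSet.ncard : ℝ) + 1 with hx
  have hx1 : 1 ≤ x := by simp [hx]
  have hpow : x ^ ((3 : ℝ) / 2) = x * √x := by
    rw [show (3 : ℝ) / 2 = 1 + 1 / 2 by norm_num, Real.rpow_add (by linarith), Real.rpow_one,
      Real.sqrt_eq_rpow]
  have hs1 : 1 ≤ √x := Real.one_le_sqrt.2 hx1
  have h1 : (t : ℝ) ≤ 2000 * x * (k + 1) := by
    have : (t : ℝ) ≤ ((2000 * (G.edgeSet.ncard + 1) * (k + 1) : ℕ) : ℝ) := by
      exact_mod_cast ht.trans hT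
    push_cast at this
    exact this
  -- Here `k ≤ 6 √x` and `1 ≤ √x`.
  have h2 : x * (k + 1) ≤ x * (7 * √x) := mul_le_mul_of_nonneg_left (by linarith) (by linarith)
  have h3 : 0 ≤ x * √x := mul_nonneg (by linarith) (by linarith)
  rw [hpow]
  push_cast
  nlinarith

end WordRAM

theorem theorem1 :
    -- all eccentricities and the diameter in time `O(m ^ (3/2))`
    (∃ (P : WordRAM.Prog) (c : ℕ), ∀ (n : ℕ) (G : SimpleGraph (Fin n)),
      G.Connected → ATGraph.ATFree G →
      ∀ adj : Fin n → List (Fin n), WordRAM.Represents adj G →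
      ∀ w : ℕ, c * (n + G.edgeSet.ncard + 1) ≤ 2 ^ w →
      ∃ (t : ℕ) (s : WordRAM.State),
        WordRAM.Exec w P (WordRAM.input adj) t s ∧
        (t : ℝ) ≤ c * ((G.edgeSet.ncard : ℝ) + 1) ^ ((3 : ℝ) / 2) ∧
        (∀ v : Fin n, ((s.arr 2 v.val : ℕ) : ℕ∞) = G.eccent v) ∧
        ((s.reg 1 : ℕ) : ℕ∞) = G.ediam) ∧
    -- the three cliques
    (∃ c : ℝ, ∀ (V : Type*) [Fintype V] [DecidableEq V] (G : SimpleGraph V),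
      G.Connected → ATGraph.ATFree G →
      ∀ (σ τ : Fin (Fintype.card V) ≃ V) (v : V), ATGraph.ThreeSweep G σ τ v →
      ∀ A B C : Finset V,
        A = ATGraph.cliqueA G σ v → B = ATGraph.cliqueB G τ v → C = ATGraph.cliqueC G τ v →
      (G.IsClique (A : Set V) ∧ G.IsClique (B : Set V) ∧ G.IsClique (C : Set V)) ∧
      ((A.card : ℝ) ≤ c * √((G.edgeSet.ncard : ℝ) + 1) ∧
        (B.card : ℝ) ≤ c * √((G.edgeSet.ncard : ℝ) + 1) ∧
        (C.card : ℝ) ≤ c * √((G.edgeSet.ncard : ℝ) + 1)) ∧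
      (∀ w : V, 3 ≤ G.eccent w → ∃ x ∈ A ∪ B ∪ C, G.edist w x = G.eccent w) ∧
      (∀ w : V, Nontrivial V → (∀ x, x ≠ w → G.Adj w x) → G.eccent w = 1) ∧
      (∀ w : V, ¬ (∀ x, x ≠ w → G.Adj w x) →
        G.eccent w = max 2 ((A ∪ B ∪ C).sup (fun x => G.edist w x)))) := by
  refine ⟨WordRAM.exists_eccentricities_program, 2, ?_⟩
  intro V _ _ G hG hAT σ τ v h A B C hA hB hC
  exact ATGraph.cliques_of_three_sweeps hG hAT h A B C hA hB hC
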